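/- **Setting.** Fix bandwidths $\Omega_j>0$ and horizons $\overline\tau_j>0$ ($j=1,2,3$), put $K=\prod_{j=1}^3[0,\overline\tau_j]$, and let $\varphi(x_1,x_2,x_3)=\prod_{j=1}^3\frac{\sin(\Omega_jx_j)}{\pi x_j}$ (factor $\Omega_j/\pi$ at $x_j=0$). For $n=(n_1,n_2,n_3)$ let $\tau_j=\tau_{j,n_j}>0$ be sampling periods. One observes $$y_{i}=f_n(i_1\tau_1,i_2\tau_2,i_3\tau_3)+\varepsilon_{i},\qquad 1\le i_j\le n_j,$$ where $\{\varepsilon_i\}_{i\in\mathbb Z^3}$ is a weakly stationary, mean zero random field such that, in the Skorohod space $D[0,1]^3$, $$(n_1n_2n_3)^{-1/2}\sum_{i_1\le\lfloor n_1v_1\rfloor}\sum_{i_2\le\lfloor n_2v_2\rfloor}\sum_{i_3\le\lfloor n_3v_3\rfloor}\varepsilon_{i}\ \Rightarrow\ \sigma B(v_1,v_2,v_3)$$ for some $\sigma>0$ and a standard Brownian motion $B$ on $[0,1]^3$. With a reference signal $f_0$, the local alternative is $$f_n(x)-f_0(x)=\frac{\delta(x)}{n_1^{\beta_1}n_2^{\beta_2}n_3^{\beta_3}},\qquad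 \beta_j>0,\ \beta_1+\beta_2+\beta_3=\tfrac32,$$ with a deterministic $\delta:\mathbb R^3\to\mathbb R$ that is not identically zero on $K$. All limits, including the functional limit theorem above, are taken either as $\min_j n_j\to\infty$, in which case $\beta_1=\beta_2=\beta_3=\frac12$, or along $n_1=n_2=n_3\to\infty$, for arbitrary $\beta_j>0$ of sum $\frac32$. Suppose that either (a) $\delta$ is continuous on $K$ and bounded on $\prod_j[0,\overline\tau_j+\eta]$ for some $\eta>0$, and $m\,\tau_{j,m}\to\overline\tau_j$ as $m\to\infty$ for $j=1,2,3$; or (b) $\delta$ is of bounded variation on $K$ in the sense of Hardy and Krause, and $m\,\tau_{j,m}=\overline\tau_j$ for all $m\ge1$ and $j=1,2,3$. Let $s_0\in(0,1)$ and assume $f_n(t,r_2,r_3)=f_0(t,r_2,r_3)$ for all $n$ and all $(t,r_2,r_3)\in K$ with $t\le s_0\overline\tau_1$. Define $$\mathcal F_n(s,t,r_2,r_3)=\sqrt{\tau_1\tau_2\tau_3}\sum_{l_1=1}^{\lfloor n_1s\rfloor}\sum_{l_2=1}^{n_2}\sum_{l_3=1}^{n_3}\bigl[y_l-f_0(l_1\tau_1,l_2\tau_2,l_3\tau_3)\bigr]\varphi(t-l_1\tau_1,r_2-l_2\tau_2,r_3-l_3\tau_3)$$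 and, for control limits $c_L,c_M>0$ and $n_0=\lfloor n_1s_0\rfloor$, with $\min\emptyset=\infty$, $$\mathcal L_n=\min\Bigl\{n_0\le k\le n_1:\max_{r_2\in[0,\overline\tau_2],\,r_3\in[0,\overline\tau_3]}\bigl|\mathcal F_n(\tfrac k{n_1},\tfrac{\overline\tau_1k}{n_1},r_2,r_3)\bigr|>c_L\Bigr\},$$ $$\mathcal M_n=\min\Bigl\{n_0\le k\le n_1:\max_{0\le t\le\overline\tau_1k/n_1}\ \max_{r_2\in[0,\overline\tau_2],\,r_3\in[0,\overline\tau_3]}\bigl|\mathcal F_n(\tfrac k{n_1},t,r_2,r_3)\bigr|>c_M\Bigr\}.$$ Let $$\mathcal F(s,t,r_2,r_3)=\sqrt{\overline\tau_1\overline\tau_2\overline\tau_3}\,\sigma\int_0^s\!\int_0^1\!\int_0^1\varphi(t-\overline\tau_1z_1,r_2-\overline\tau_2z_2,r_3-\overline\tau_3z_3)\,\mathrm dB(z_1,z_2,z_3),$$ a multivariate Riemann--Stieltjes integral defined pathwise through integration by parts, and $$\mathcal F^\delta(s,t,r_2,r_3)=\mathcal F(s,t,r_2,r_3)+\frac1{\sqrt{\overline\tau_1\overline\tau_2\overline\tau_3}}\int_0^{s\overline\tau_1}\!\int_0^{\overline\tau_2}\!\int_0^{\overline\tau_3}\varphi(t-z_1,r_2-z_2,r_3-z_3)\,\delta(z_1,z_2,z_3)\,\mathrm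 dz_3\,\mathrm dz_2\,\mathrm dz_1.$$ **Claim.** As the sample sizes grow, weakly as random variables in $[0,\infty]$ (with $\inf\emptyset=\infty$), $$\mathcal L_n/n_1\Rightarrow\inf\Bigl\{s\in[s_0,1]:\sup_{r_2\in[0,\overline\tau_2],\,r_3\in[0,\overline\tau_3]}|\mathcal F^\delta(s,s\overline\tau_1,r_2,r_3)|>c_L\Bigr\},$$ $$\mathcal M_n/n_1\Rightarrow\inf\Bigl\{s\in[s_0,1]:\sup_{0\le t\le s\overline\tau_1}\ \sup_{r_2\in[0,\overline\tau_2],\,r_3\in[0,\overline\tau_3]}|\mathcal F^\delta(s,t,r_2,r_3)|>c_M\Bigr\}.$$ -/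

import Mathlib

open MeasureTheory ProbabilityTheory Filter Topology
open scoped ENNReal NNReal BigOperators

noncomputable section

/-! ### Alternating sums, ladders, variation, Riemann-Stieltjes integrals -/

/-- The alternating sum `∑_v (-1)^|v| f (a_v : b_{-v})` of `f` over the block with corners
`a`, `b`. -/
def altSum {ι α : Type*} [Fintype ι] [DecidableEq ι] (f : (ι → α) → ℝ) (a b : ι → α) : ℝ :=
  ∑ v : Finset ι, (-1 : ℝ) ^ v.card * f (v.piecewise a b)

/-- The point `x_v : z_{-v}`, with coordinates `x` on `v` and `z` off `v`. -/
def glue {ι : Type*} [DecidableEq ι] (v : Finset ι) (x : {j // j ∈ v} → ℝ) (z : ι → ℝ) :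
    ι → ℝ :=
  fun j => if h : j ∈ v then x ⟨j, h⟩ else z j

/-- A ladder on `[a, b]`: it contains `a` and finitely many points of `(a, b)`. -/
def IsLadder (Y : Finset ℝ) (a b : ℝ) : Prop :=
  a ∈ Y ∧ ∀ y ∈ Y, y = a ∨ (a < y ∧ y < b)

/-- The successor of `y` in a ladder `Y` on `[a, b]`: the next larger element, or `b`. -/
def ladderSucc (Y : Finset ℝ) (b y : ℝ) : ℝ :=
  if h : (Y.filter (fun z => y < z)).Nonempty then (Y.filter (fun z => y < z)).min' h else b

/-- The componentwise successor in a multidimensional ladder. -/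
def ladderSuccPi {ι : Type*} (Y : ι → Finset ℝ) (b y : ι → ℝ) : ι → ℝ :=
  fun j => ladderSucc (Y j) (b j) (y j)

/-- The variation of `f` on `[a, b]` in the sense of Vitali. -/
def vitaliVariation {ι : Type*} [Fintype ι] [DecidableEq ι] (f : (ι → ℝ) → ℝ) (a b : ι → ℝ) :
    ℝ≥0∞ :=
  ⨆ (Y : ι → Finset ℝ) (_ : ∀ j, IsLadder (Y j) (a j) (b j)),
    ∑ y ∈ Fintype.piFinset Y, ENNReal.ofReal |altSum f y (ladderSuccPi Y b y)|

/-- The variation of `f` on `[a, b]` in the sense of Hardy and Krause: the sum over nonempty `u`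
of the Vitali variations of `x_u ↦ f (x_u : b_{-u})` on `[a_u, b_u]`. -/
def hardyKrauseVariation {ι : Type*} [Fintype ι] [DecidableEq ι] (f : (ι → ℝ) → ℝ)
    (a b : ι → ℝ) : ℝ≥0∞ :=
  ∑ u ∈ (Finset.univ : Finset (Finset ι)).filter (fun u => u.Nonempty),
    vitaliVariation (fun x : {j // j ∈ u} → ℝ => f (glue u x b)) (fun j => a j) (fun j => b j)

/-- `f` is of bounded variation on `[a, b]` in the sense of Hardy and Krause. -/
def IsBVHK {ι : Type*} [Fintype ι] [DecidableEq ι] (f : (ι → ℝ) → ℝ) (a b : ι → ℝ) : Prop :=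
  hardyKrauseVariation f a b < ⊤

/-- `∫_a^b h df = c` as a multivariate Riemann-Stieltjes integral: the sums
`∑_y h (tag y) Δ(f; y, y⁺)` over ladders tend to `c` as the mesh tends to `0`, whatever the
tags in `[y, y⁺]`. -/
def HasRSIntegral {ι : Type*} [Fintype ι] [DecidableEq ι] (h f : (ι → ℝ) → ℝ) (a b : ι → ℝ)
    (c : ℝ) : Prop :=
  ∀ ε > 0, ∃ η > 0, ∀ (Y : ι → Finset ℝ) (tag : (ι → ℝ) → ι → ℝ),
    (∀ j, IsLadder (Y j) (a j) (b j)) →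
    (∀ j, ∀ y ∈ Y j, ladderSucc (Y j) (b j) y - y < η) →
    (∀ y ∈ Fintype.piFinset Y, tag y ∈ Set.Icc y (ladderSuccPi Y b y)) →
    |(∑ y ∈ Fintype.piFinset Y, h (tag y) * altSum f y (ladderSuccPi Y b y)) - c| < ε

open Classical in
/-- The multivariate Riemann-Stieltjes integral `∫_a^b h df` (and `0` if it does not exist). -/
def rsIntegral {ι : Type*} [Fintype ι] [DecidableEq ι] (h f : (ι → ℝ) → ℝ) (a b : ι → ℝ) : ℝ :=
  if H : ∃ c, HasRSIntegral h f a b c then H.choose else 0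

/-- The Riemann-Stieltjes integral `∫_a^b f dh` for an integrator `h` that need not be of bounded
variation, defined by the integration by parts formula
`[h f]_a^b + ∑_{1 ≤ |v| ≤ q-1} (-1)^|v| ∫_{a_v}^{b_v} [h df]_{a_{-v}}^{b_{-v}}
  + (-1)^q ∫_a^b h df`.
Here `[h f]_a^b` is the summand `v = ∅` and `(-1)^q ∫_a^b h df` the summand `v = univ`. -/
def rsIntegralByParts {ι : Type*} [Fintype ι] [DecidableEq ι] (f h : (ι → ℝ) → ℝ)
    (a b : ι → ℝ) : ℝ :=
  ∑ v : Finset ι, (-1 : ℝ) ^ v.card * ∑ w ∈ (vᶜ).powerset, (-1 : ℝ) ^ w.card *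
    rsIntegral (fun x : {j // j ∈ v} → ℝ => h (glue v x (w.piecewise a b)))
      (fun x : {j // j ∈ v} → ℝ => f (glue v x (w.piecewise a b)))
      (fun j => a j) (fun j => b j)

/-! ### The Skorohod space on the unit cube -/

/-- The quadrant of `t`: coordinates `≥ t p` where `R p` holds and `< t p` elsewhere. -/
def quadrant {ι : Type*} (R : ι → Bool) (t : ι → unitInterval) : Set (ι → unitInterval) :=
  {s | ∀ p, if R p then t p ≤ s p else s p < t p}

/-- Functions on the unit cube that are continuous from above with limits from below. -/
structure SkorohodSpace (ι : Type*) where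
  toFun : (ι → unitInterval) → ℝ
  exists_quadrant_limit : ∀ (t : ι → unitInterval) (R : ι → Bool),
    ∃ c, Tendsto toFun (𝓝[quadrant R t] t) (𝓝 c)
  continuous_above : ∀ t : ι → unitInterval,
    Tendsto toFun (𝓝[quadrant (fun _ => true) t] t) (𝓝 (toFun t))

namespace SkorohodSpace

instance {ι : Type*} : CoeFun (SkorohodSpace ι) (fun _ => (ι → unitInterval) → ℝ) := ⟨toFun⟩

/-- The Skorohod metric: the infimum over coordinatewise increasing bijections `l` of the cube of
`max (‖f - g ∘ l‖) (‖l - id‖)`. -/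
instance {ι : Type*} : PseudoEMetricSpace (SkorohodSpace ι) where
  edist f g := ⨅ l : ι → (unitInterval ≃o unitInterval),
    max (⨆ t : ι → unitInterval, edist (f t) (g (fun j => l j (t j))))
      (⨆ (j : ι) (u : unitInterval), edist (l j u) u)
  edist_self f := by
    refine le_antisymm (iInf_le_of_le (fun _ => OrderIso.refl _) ?_) bot_le
    simp
  edist_comm f g := by
    have key : ∀ f g : SkorohodSpace ι,
        (⨅ l : ι → (unitInterval ≃o unitInterval),
          max (⨆ t : ι → unitInterval, edist (f t) (g (fun j => l j (t j))))
            (⨆ (j : ι) (u : unitInterval), edist (l j u) u)) ≤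
        (⨅ l : ι → (unitInterval ≃o unitInterval),
          max (⨆ t : ι → unitInterval, edist (g t) (f (fun j => l j (t j))))
            (⨆ (j : ι) (u : unitInterval), edist (l j u) u)) := by
      intro f g
      refine le_iInf fun l => iInf_le_of_le (fun j => (l j).symm) (max_le_max ?_ ?_)
      · refine iSup_le fun t => ?_
        refine le_trans (le_of_eq ?_) (le_iSup _ (fun j => (l j).symm (t j)))
        simp [edist_comm]
      · refine iSup_mono fun j => iSup_le fun u => ?_
        refine le_trans (le_of_eq ?_) (le_iSup _ ((l j).symm u))
        simp [edist_comm]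
    exact le_antisymm (key f g) (key g f)
  edist_triangle f g k := by
    refine ENNReal.le_of_forall_pos_le_add ?_
    intro ε hε hfin
    have hε' : (0 : ℝ≥0∞) < (ε / 2 : ℝ≥0) := by
      exact_mod_cast half_pos hε
    have h1 := (ENNReal.add_lt_top.1 hfin).1
    have h2 := (ENNReal.add_lt_top.1 hfin).2
    obtain ⟨l, hl⟩ := iInf_lt_iff.1 (ENNReal.lt_add_right h1.ne hε'.ne')
    obtain ⟨m, hm⟩ := iInf_lt_iff.1 (ENNReal.lt_add_right h2.ne hε'.ne')
    have hsum : ((ε / 2 : ℝ≥0) : ℝ≥0∞) + ((ε / 2 : ℝ≥0) : ℝ≥0∞) = ε := by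
      rw [← ENNReal.coe_add, add_halves]
    refine iInf_le_of_le (fun j => (l j).trans (m j)) ?_
    rw [← hsum, add_add_add_comm]
    refine le_trans ?_ (add_le_add hl.le hm.le)
    refine max_le (iSup_le fun t => ?_) (iSup_le fun j => iSup_le fun u => ?_)
    · refine (edist_triangle _ (g (fun j => l j (t j))) _).trans (add_le_add ?_ ?_)
      · exact le_max_of_le_left
          (le_iSup (fun t : ι → unitInterval => edist (f t) (g (fun j => l j (t j)))) t)
      · exact le_max_of_le_left
          (le_iSup (fun t : ι → unitInterval => edist (g t) (k (fun j => m j (t j))))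
            (fun j => l j (t j)))
    · rw [add_comm]
      refine (edist_triangle _ (l j u) _).trans (add_le_add ?_ ?_)
      · exact le_max_of_le_right (le_iSup₂_of_le j (l j u) le_rfl)
      · exact le_max_of_le_right (le_iSup₂_of_le j u le_rfl)

instance {ι : Type*} : MeasurableSpace (SkorohodSpace ι) := borel _

instance {ι : Type*} : BorelSpace (SkorohodSpace ι) := ⟨rfl⟩

/-- Multiplication by a constant. -/
instance {ι : Type*} : SMul ℝ (SkorohodSpace ι) where
  smul c f :=
    { toFun := fun t => c * f t
      exists_quadrant_limit := fun t R =>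
        (f.exists_quadrant_limit t R).imp' (fun x => c * x) fun _ h => h.const_mul c
      continuous_above := fun t => (f.continuous_above t).const_mul c }

theorem floor_eventually_const (N : ℕ) (t : unitInterval) (r : Bool) :
    ∃ m : ℕ, ∀ᶠ s : unitInterval in 𝓝 t,
      (if r then t ≤ s else s < t) → ⌊(N : ℝ) * s⌋₊ = m := by
  have hcont : Tendsto (fun s : unitInterval => (N : ℝ) * s) (𝓝 t) (𝓝 ((N : ℝ) * t)) :=
    (continuous_const.mul continuous_subtype_val).tendsto t
  have hN : (0 : ℝ) ≤ N := Nat.cast_nonneg N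
  cases r with
  | true =>
    refine ⟨⌊(N : ℝ) * t⌋₊, ?_⟩
    filter_upwards [hcont.eventually (gt_mem_nhds (Nat.lt_floor_add_one ((N : ℝ) * t)))]
      with s hs hts
    have hts' : (t : ℝ) ≤ s := by simpa using hts
    have hmul : (N : ℝ) * t ≤ N * s := mul_le_mul_of_nonneg_left hts' hN
    rw [Nat.floor_eq_iff (mul_nonneg hN s.2.1)]
    exact ⟨(Nat.floor_le (mul_nonneg hN t.2.1)).trans hmul, hs⟩
  | false =>
    by_cases h0 : (N : ℝ) * t = 0
    · refine ⟨0, Eventually.of_forall fun s hs => ?_⟩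
      have hs' : (s : ℝ) ≤ t := by
        have : s < t := by simpa using hs
        exact this.le
      have : (N : ℝ) * s ≤ 0 := h0 ▸ mul_le_mul_of_nonneg_left hs' hN
      exact Nat.floor_of_nonpos this
    · have hpos : 0 < (N : ℝ) * t := lt_of_le_of_ne (mul_nonneg hN t.2.1) (Ne.symm h0)
      have hceil : 0 < ⌈(N : ℝ) * t⌉₊ := Nat.ceil_pos.2 hpos
      have hlt : ((⌈(N : ℝ) * t⌉₊ - 1 : ℕ) : ℝ) < N * t :=
        Nat.lt_ceil.1 (Nat.sub_lt hceil one_pos)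
      refine ⟨⌈(N : ℝ) * t⌉₊ - 1, ?_⟩
      filter_upwards [hcont.eventually (lt_mem_nhds hlt)] with s hs hst
      have hst' : (s : ℝ) ≤ t := by
        have : s < t := by simpa using hst
        exact this.le
      have hst'' : (s : ℝ) < t := by
        have : s < t := by simpa using hst
        exact this
      have hNpos : (0 : ℝ) < N := by
        rcases hN.lt_or_eq with h | h
        · exact h
        · exact absurd (by rw [← h, zero_mul]) h0
      rw [Nat.floor_eq_iff (mul_nonneg hN s.2.1)]
      refine ⟨hs.le, ?_⟩
      have : (N : ℝ) * s < ⌈(N : ℝ) * t⌉₊ :=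
        (mul_lt_mul_of_pos_left hst'' hNpos).trans_le (Nat.le_ceil _)
      have hcast : ((⌈(N : ℝ) * t⌉₊ - 1 : ℕ) : ℝ) + 1 = ⌈(N : ℝ) * t⌉₊ := by
        rw [← Nat.cast_add_one, Nat.sub_add_cancel hceil]
      rw [hcast]
      exact this

/-- Any function of `(⌊n_j v_j⌋)_j` is an element of the Skorohod space. -/
def step {ι : Type*} [Finite ι] (n : ι → ℕ) (g : (ι → ℕ) → ℝ) : SkorohodSpace ι where
  toFun v := g (fun j => ⌊(n j : ℝ) * v j⌋₊)
  exists_quadrant_limit t R := by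
    choose m hm using fun j => floor_eventually_const (n j) (t j) (R j)
    refine ⟨g m, tendsto_const_nhds.congr' ?_⟩
    have hall : ∀ᶠ s : ι → unitInterval in 𝓝 t, ∀ j,
        (if R j then t j ≤ s j else s j < t j) → ⌊(n j : ℝ) * s j⌋₊ = m j :=
      eventually_all.2 fun j => ((continuous_apply j).tendsto t).eventually (hm j)
    filter_upwards [hall.filter_mono nhdsWithin_le_nhds, self_mem_nhdsWithin] with s hs hq
    exact congrArg g (funext fun j => (hs j (hq j)).symm)
  continuous_above t := by
    choose m hm using fun j => floor_eventually_const (n j) (t j) true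
    have hall : ∀ᶠ s : ι → unitInterval in 𝓝 t, ∀ j,
        (if true then t j ≤ s j else s j < t j) → ⌊(n j : ℝ) * s j⌋₊ = m j :=
      eventually_all.2 fun j => ((continuous_apply j).tendsto t).eventually (hm j)
    have ht : ∀ j, ⌊(n j : ℝ) * t j⌋₊ = m j := fun j => hall.self_of_nhds j (by simp)
    refine tendsto_const_nhds.congr' ?_
    filter_upwards [hall.filter_mono nhdsWithin_le_nhds, self_mem_nhdsWithin] with s hs hq
    refine congrArg g (funext fun j => ?_)
    rw [hs j (hq j), ht j]

end SkorohodSpace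

/-! ### Brownian motion and the noise -/

/-- Standard Brownian motion on the unit cube: almost surely continuous, zero on the lower faces
(so that `B t` is its increment around `(0, t]`), and the increments around pairwise disjoint
blocks `∏ (s_j, t_j]` are independent centred normal variables with variances `∏ (t_j - s_j)`. -/
structure IsBrownianSheet {ι Ω : Type*} [Fintype ι] [DecidableEq ι] [MeasurableSpace Ω]
    (B : Ω → SkorohodSpace ι) (P : Measure Ω) : Prop where
  ae_continuous : ∀ᵐ ω ∂P, Continuous (B ω)
  ae_eq_zero : ∀ t : ι → unitInterval, (∃ j, t j = 0) → ∀ᵐ ω ∂P, B ω t = 0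
  indep_increments : ∀ (k : ℕ) (s t : Fin k → ι → unitInterval), (∀ i, s i ≤ t i) →
    Pairwise (fun i i' => Disjoint (Set.univ.pi fun j => Set.Ioc (s i j) (t i j))
      (Set.univ.pi fun j => Set.Ioc (s i' j) (t i' j))) →
    iIndepFun (fun i ω => altSum (B ω) (s i) (t i)) P
  increment_law : ∀ s t : ι → unitInterval, s ≤ t →
    P.map (fun ω => altSum (B ω) s t) =
      gaussianReal 0 (∏ j, ((t j : ℝ) - (s j : ℝ))).toNNReal

/-- A weakly stationary random field with mean zero. -/
structure IsCenteredWeaklyStationary {ι Ω : Type*} [MeasurableSpace Ω]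
    (ε : (ι → ℤ) → Ω → ℝ) (P : Measure Ω) : Prop where
  memLp : ∀ i, MemLp (ε i) 2 P
  mean_zero : ∀ i, ∫ ω, ε i ω ∂P = 0
  cov_shift : ∀ i j h, ∫ ω, ε (i + h) ω * ε (j + h) ω ∂P = ∫ ω, ε i ω * ε j ω ∂P

/-- The partial sum process
`Z_n(v) = (n₁n₂n₃)^{-1/2} ∑_{i₁ ≤ ⌊n₁v₁⌋} ∑_{i₂ ≤ ⌊n₂v₂⌋} ∑_{i₃ ≤ ⌊n₃v₃⌋} ε_i`. -/
def partialSumProcess {Ω : Type*} (ε : (Fin 3 → ℤ) → Ω → ℝ) (n : Fin 3 → ℕ) (ω : Ω) :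
    SkorohodSpace (Fin 3) :=
  SkorohodSpace.step n fun m =>
    (Real.sqrt (∏ j, (n j : ℝ)))⁻¹ *
      ∑ i ∈ Finset.Icc (fun _ => 1) m, ε (fun j => (i j : ℤ)) ω

/-! ### The detection process, its limit, and the detectors

Points `x : Fin 3 → ℝ` stand for `(t, r₂, r₃)`; the first coordinate is time. -/

/-- `sin (w x) / (π x)`, with value `w / π` at `x = 0`. -/
def sincKernel (w x : ℝ) : ℝ := if x = 0 then w / Real.pi else Real.sin (w * x) / (Real.pi * x)

/-- The product reconstruction kernel with bandwidths `w`. -/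
def reconKernel (w x : Fin 3 → ℝ) : ℝ := ∏ j, sincKernel (w j) (x j)

/-- The detection process `F_n(s, x)` computed from the data `y`, the sampling periods `τ` and
the reference signal `f₀`. -/
def detectionProcess (w : Fin 3 → ℝ) (τ : Fin 3 → ℝ) (n : Fin 3 → ℕ)
    (y : (Fin 3 → ℕ) → ℝ) (f₀ : (Fin 3 → ℝ) → ℝ) (s : ℝ) (x : Fin 3 → ℝ) : ℝ :=
  Real.sqrt (∏ j, τ j) *
    ∑ l ∈ Finset.Icc (fun _ => 1) ![⌊(n 0 : ℝ) * s⌋₊, n 1, n 2],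
      (y l - f₀ (fun j => l j * τ j)) * reconKernel w (fun j => x j - l j * τ j)

/-- The noisy samples `y_l = f(l₁τ₁, l₂τ₂, l₃τ₃) + ε_l`. -/
def noisySamples {Ω : Type*} (f : (Fin 3 → ℝ) → ℝ) (τ : Fin 3 → ℝ)
    (ε : (Fin 3 → ℤ) → Ω → ℝ) (ω : Ω) (l : Fin 3 → ℕ) : ℝ :=
  f (fun j => l j * τ j) + ε (fun j => (l j : ℤ)) ω

/-- The limit process under the null hypothesis,
`F(s, x) = (τ̄₁τ̄₂τ̄₃)^{1/2} σ ∫_0^s ∫_0^1 ∫_0^1 φ(x - τ̄ z) dB(z)`,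
for a path `b` of Brownian motion. -/
def nullLimit (w τbar : Fin 3 → ℝ) (σ : ℝ) (b : SkorohodSpace (Fin 3)) (s : ℝ)
    (x : Fin 3 → ℝ) : ℝ :=
  Real.sqrt (∏ j, τbar j) * σ *
    rsIntegralByParts (fun z => reconKernel w (fun j => x j - τbar j * z j))
      (fun z => b (fun j => Set.projIcc 0 1 zero_le_one (z j)))
      (fun _ => 0) ![s, 1, 1]

/-- The drifted limit process `F^δ`. -/
def driftedLimit (w τbar : Fin 3 → ℝ) (σ : ℝ) (δ : (Fin 3 → ℝ) → ℝ)
    (b : SkorohodSpace (Fin 3)) (s : ℝ) (x : Fin 3 → ℝ) : ℝ :=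
  nullLimit w τbar σ b s x +
    1 / Real.sqrt (∏ j, τbar j) *
      ∫ z in Set.Icc (fun _ => 0) ![s * τbar 0, τbar 1, τbar 2],
        reconKernel w (fun j => x j - z j) * δ z

/-- `sup_{r₂ ∈ [0, τ̄₂], r₃ ∈ [0, τ̄₃]} |G(s, s τ̄₁, r₂, r₃)|`. -/
def localStat (τbar : Fin 3 → ℝ) (G : ℝ → (Fin 3 → ℝ) → ℝ) (s : ℝ) : ℝ :=
  sSup ((fun x => |G s x|) ''
    Set.Icc ![s * τbar 0, 0, 0] ![s * τbar 0, τbar 1, τbar 2])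

/-- `sup_{0 ≤ t ≤ s τ̄₁} sup_{r₂ ∈ [0, τ̄₂], r₃ ∈ [0, τ̄₃]} |G(s, t, r₂, r₃)|`. -/
def globalStat (τbar : Fin 3 → ℝ) (G : ℝ → (Fin 3 → ℝ) → ℝ) (s : ℝ) : ℝ :=
  sSup ((fun x => |G s x|) '' Set.Icc ![0, 0, 0] ![s * τbar 0, τbar 1, τbar 2])

/-- `min {n₀ ≤ k ≤ N : S(k/N) > c}` with `n₀ = ⌊N s₀⌋`, and `∞` if there is no such `k`. -/
def firstAlarm (s₀ c : ℝ) (N : ℕ) (S : ℝ → ℝ) : ℝ≥0∞ :=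
  ⨅ k ∈ {k : ℕ | ⌊(N : ℝ) * s₀⌋₊ ≤ k ∧ k ≤ N ∧ c < S (k / N)}, (k : ℝ≥0∞)

/-- `inf {s ∈ [s₀, 1] : S(s) > c}`, and `∞` if there is no such `s`. -/
def passageTime (s₀ c : ℝ) (S : ℝ → ℝ) : ℝ≥0∞ :=
  ⨅ s ∈ {s : ℝ | s₀ ≤ s ∧ s ≤ 1 ∧ c < S s}, ENNReal.ofReal s

/-- The ways in which the sample sizes grow: either `min n_j → ∞` without further restriction,
where the local alternatives have exponents `β_j = 1/2`, or `n₁ = n₂ = n₃ → ∞`,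
where only `β₁ + β₂ + β₃ = 3/2` matters. -/
def SampleSizeRegime (β : Fin 3 → ℝ) (l : Filter (Fin 3 → ℕ)) : Prop :=
  (l = comap (fun n => min (n 0) (min (n 1) (n 2))) atTop ∧ ∀ j, β j = 1 / 2) ∨
    (l = map (fun m : ℕ => (fun _ => m : Fin 3 → ℕ)) atTop ∧ ∑ j, β j = 3 / 2)

end

/-! The kernel is a product of smooth one-variable factors, so a lattice sum of noise against it is
an integral with respect to the partial sum process that can be written by parts: derivatives of the
factors are integrated against the values of the process (`sheetIntegral`,
`sheetIntegral_lattice_sum`). For a continuous path vanishing on the lower faces the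
Riemann-Stieltjes expression in the limit is the same functional
(`rsIntegralByParts_eq_sheetIntegral`). This functional is continuous for uniform convergence,
jointly in path, scaling, time and location, and Skorohod convergence to a continuous path is
uniform.

The drift is a Riemann sum of kernel times disturbance. It converges because the disturbance is
bounded at the sampling points and continuous almost everywhere. Under bounded variation this holds
because such a function is a signed sum of coordinatewise monotone functions
(`IsBVHK.exists_antitoneOn`), and monotone functions are almost everywhere continuous, upper sets
having null frontier. Both parts converge jointly with the parameters; since these range over a
compact cube, the detection process converges uniformly, and so do its suprema.

First passage over a level is continuous at a limiting statistic `S` that never touches the level on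
`[s₀, q]` without exceeding it there, for `q` rational or `1` (`tendsto_firstAlarm_div`). The
probabilistic core is that this holds almost surely. A Brownian sheet splits as a residual field
plus its value at a point `t₀` times a fixed function `κ`, and the two are independent because the
field is Gaussian. On each line `b + r κ` the statistic is a supremum of absolute values of affine
functions of `r`. If their slopes are bounded away from zero this convex function takes its supremum
level `c` for at most two `r`, and the Gaussian coordinate has no atoms. Slopes are controlled by
`exists_sheetFunctional_sheetDirection_ne_zero`: for suitable `t₀` the functional applied to `κ` is
a nonzero multiple of a product of integrals of sinc factors, which cannot vanish for all small
upper limits. Compactness lets finitely many `t₀` serve all parameters.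

`TendstoInDistribution.of_tendsto_comap`, an extended continuous mapping theorem, turns the pathwise
convergence into convergence in distribution. -/

noncomputable section

/-! ### Ladders and alternating sums -/

namespace IsLadder

variable {Y : Finset ℝ} {a b : ℝ}

theorem left_le (hY : IsLadder Y a b) {y : ℝ} (hy : y ∈ Y) : a ≤ y := by
  rcases hY.2 y hy with h | h
  · exact h.ge
  · exact h.1.le

theorem le_right (hY : IsLadder Y a b) (hab : a ≤ b) {y : ℝ} (hy : y ∈ Y) : y ≤ b := by
  rcases hY.2 y hy with h | h
  · exact h.le.trans hab
  · exact h.2.le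

theorem eq_singleton (hY : IsLadder Y a a) : Y = {a} := by
  ext y
  rw [Finset.mem_singleton]
  refine ⟨fun hy => ?_, fun h => h ▸ hY.1⟩
  rcases hY.2 y hy with h | h
  · exact h
  · exact absurd (h.1.trans h.2) (lt_irrefl _)

end IsLadder

theorem ladderSucc_le_of_mem {Y : Finset ℝ} {b y z : ℝ} (hz : z ∈ Y) (hyz : y < z) :
    ladderSucc Y b y ≤ z := by
  have hz' : z ∈ Y.filter (fun z => y < z) := Finset.mem_filter.2 ⟨hz, hyz⟩
  rw [ladderSucc, dif_pos ⟨z, hz'⟩]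
  exact Finset.min'_le _ _ hz'

theorem ladderSucc_mem_or_eq (Y : Finset ℝ) (b y : ℝ) :
    (ladderSucc Y b y ∈ Y ∧ y < ladderSucc Y b y) ∨ ladderSucc Y b y = b := by
  by_cases h : (Y.filter (fun z => y < z)).Nonempty
  · left
    rw [ladderSucc, dif_pos h]
    simpa using Finset.mem_filter.1 (Finset.min'_mem _ h)
  · right
    rw [ladderSucc, dif_neg h]

theorem IsLadder.ladderSucc_le {Y : Finset ℝ} {a b : ℝ} (hY : IsLadder Y a b) (hab : a ≤ b)
    (y : ℝ) : ladderSucc Y b y ≤ b := by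
  rcases ladderSucc_mem_or_eq Y b y with h | h
  · exact hY.le_right hab h.1
  · exact h.le

theorem IsLadder.le_ladderSucc {Y : Finset ℝ} {a b : ℝ} (hY : IsLadder Y a b) (hab : a ≤ b)
    {y : ℝ} (hy : y ∈ Y) : y ≤ ladderSucc Y b y := by
  rcases ladderSucc_mem_or_eq Y b y with h | h
  · exact h.2.le
  · rw [h]; exact hY.le_right hab hy

/-- A new largest point `m` takes over the role of the right endpoint for all earlier points. This
is the inductive step for telescoping along a ladder. -/
theorem ladderSucc_insert_of_lt {s : Finset ℝ} {m b y : ℝ} (hs : ∀ x ∈ s, x < m) (hy : y < m) :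
    ladderSucc (insert m s) b y = ladderSucc s m y := by
  have hf : (insert m s).filter (fun z => y < z) = insert m (s.filter (fun z => y < z)) := by
    rw [Finset.filter_insert, if_pos hy]
  have hne : ((insert m s).filter (fun z => y < z)).Nonempty := by
    rw [hf]; exact Finset.insert_nonempty _ _
  rw [ladderSucc, dif_pos hne]
  by_cases h : (s.filter (fun z => y < z)).Nonempty
  · rw [ladderSucc, dif_pos h]
    refine le_antisymm (Finset.min'_le _ _ ?_) (Finset.le_min' _ _ _ fun z hz => ?_)
    · rw [hf]; exact Finset.mem_insert_of_mem (Finset.min'_mem _ h)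
    · rw [hf, Finset.mem_insert] at hz
      rcases hz with rfl | hz
      · exact (hs _ (Finset.mem_filter.1 (Finset.min'_mem _ h)).1).le
      · exact Finset.min'_le _ _ hz
  · rw [ladderSucc, dif_neg h]
    rw [Finset.not_nonempty_iff_eq_empty] at h
    refine le_antisymm (Finset.min'_le _ _ ?_) (Finset.le_min' _ _ _ fun z hz => ?_)
    · rw [hf]; exact Finset.mem_insert_self _ _
    · rw [hf, h] at hz
      exact (Finset.mem_singleton.1 (by simpa using hz)).ge

theorem ladderSucc_insert_self {s : Finset ℝ} {m b : ℝ} (hs : ∀ x ∈ s, x < m) :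
    ladderSucc (insert m s) b m = b := by
  rw [ladderSucc, dif_neg]
  rintro ⟨z, hz⟩
  rw [Finset.mem_filter, Finset.mem_insert] at hz
  rcases hz.1 with rfl | h
  · exact lt_irrefl _ hz.2
  · exact lt_asymm hz.2 (hs z h)

/-- Telescoping, by induction on the largest point. The right endpoint varies in the induction,
since removing the largest point `m` leaves a ladder on `[a, m]`. -/
theorem IsLadder.sum_sub {Y : Finset ℝ} {a b : ℝ} (hY : IsLadder Y a b) (g : ℝ → ℝ) :
    ∑ y ∈ Y, (g (ladderSucc Y b y) - g y) = g b - g a := by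
  induction Y using Finset.induction_on_max generalizing b with
  | empty => exact absurd hY.1 (Finset.notMem_empty _)
  | insert m s hs ih =>
    have hm : m ∉ s := fun h => lt_irrefl _ (hs m h)
    rw [Finset.sum_insert hm, ladderSucc_insert_self hs,
      Finset.sum_congr rfl fun y hy => by rw [ladderSucc_insert_of_lt hs (hs y hy)]]
    by_cases has : a ∈ s
    · rw [ih (b := m) ⟨has, fun y hy => ?_⟩]
      · ring
      · rcases hY.2 y (Finset.mem_insert_of_mem hy) with h | h
        · exact Or.inl h
        · exact Or.inr ⟨h.1, hs y hy⟩
    · have ham : a = m := by simpa [has] using hY.1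
      have hse : s = ∅ := by
        refine Finset.eq_empty_of_forall_notMem fun y hy => ?_
        have := hY.left_le (Finset.mem_insert_of_mem hy)
        exact lt_irrefl _ ((hs y hy).trans_le (ham ▸ this))
      simp [hse, ham]

theorem exists_isLadder_ladderSucc_sub_lt {a b : ℝ} (hab : a ≤ b) {η : ℝ} (hη : 0 < η) :
    ∃ Y, IsLadder Y a b ∧ ∀ y ∈ Y, ladderSucc Y b y - y < η := by
  rcases hab.eq_or_lt with rfl | hab
  · refine ⟨{a}, ⟨by simp, by simp⟩, fun y hy => ?_⟩
    rw [Finset.mem_singleton] at hy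
    subst hy
    have : ladderSucc {y} y y = y := by simp [ladderSucc]
    rw [this, sub_self]; exact hη
  · obtain ⟨N, hN⟩ := exists_nat_gt ((b - a) / η)
    have hba : 0 < b - a := sub_pos.2 hab
    have hN0 : (0 : ℝ) < N := (div_pos hba hη).trans hN
    have hh : (b - a) / N < η := by rwa [div_lt_comm₀ hN0 hη]
    have hh0 : 0 < (b - a) / N := div_pos hba hN0
    have hNN : 0 < N := by exact_mod_cast hN0
    have hlad : IsLadder ((Finset.range N).image fun k : ℕ => a + k * ((b - a) / N)) a b := by
      refine ⟨Finset.mem_image.2 ⟨0, Finset.mem_range.2 hNN, by simp⟩, fun y hy => ?_⟩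
      obtain ⟨k, hk, rfl⟩ := Finset.mem_image.1 hy
      rcases Nat.eq_zero_or_pos k with rfl | hk0
      · left; simp
      · right
        have hk0' : (0 : ℝ) < k := by exact_mod_cast hk0
        have hkN : (k : ℝ) < N := by exact_mod_cast Finset.mem_range.1 hk
        refine ⟨lt_add_of_pos_right _ (mul_pos hk0' hh0), ?_⟩
        have : (k : ℝ) * ((b - a) / N) < N * ((b - a) / N) := mul_lt_mul_of_pos_right hkN hh0
        rw [mul_div_cancel₀ _ hN0.ne'] at this
        linarith
    refine ⟨_, hlad, fun y hy => ?_⟩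
    obtain ⟨k, hk, rfl⟩ := Finset.mem_image.1 hy
    by_cases hk1 : k + 1 < N
    · have := ladderSucc_le_of_mem (b := b) (y := a + k * ((b - a) / N))
        (Finset.mem_image_of_mem (fun k : ℕ => a + k * ((b - a) / N))
          (Finset.mem_range.2 hk1)) (by push_cast; linarith)
      push_cast at this
      linarith
    · have hkN : k + 1 = N := le_antisymm (Finset.mem_range.1 hk) (not_lt.1 hk1)
      have := hlad.ladderSucc_le hab.le (a + k * ((b - a) / N))
      have hN' : (N : ℝ) * ((b - a) / N) = b - a := mul_div_cancel₀ _ hN0.ne'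
      have hc : (N : ℝ) = k + 1 := by rw [← hkN]; push_cast; ring
      have : ((k : ℝ) + 1) * ((b - a) / N) = b - a := by rw [← hc, hN']
      linarith

section AltSum

variable {ι α : Type*} [Fintype ι] [DecidableEq ι]

/-- Expanding the product of differences over subsets gives exactly the alternating sum. This is
what reduces multivariate increments to one-dimensional ones. -/
theorem altSum_prod (c : ℝ) (F : ι → α → ℝ) (a b : ι → α) :
    altSum (fun x => c * ∏ j, F j (x j)) a b = c * ∏ j, (F j (b j) - F j (a j)) := by
  rw [altSum, Finset.prod_sub, Finset.powerset_univ, Finset.mul_sum]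
  refine Finset.sum_congr rfl fun v _ => ?_
  have h : ∏ j, F j (v.piecewise a b j) =
      (∏ j ∈ Finset.univ \ v, F j (b j)) * ∏ j ∈ v, F j (a j) := by
    rw [← Finset.prod_sdiff (Finset.subset_univ v)]
    congr 1
    · refine Finset.prod_congr rfl fun j hj => ?_
      rw [Finset.piecewise_eq_of_notMem _ _ _ (Finset.mem_sdiff.1 hj).2]
    · refine Finset.prod_congr rfl fun j hj => ?_
      rw [Finset.piecewise_eq_of_mem _ _ _ hj]
  rw [h]
  ring

theorem altSum_sum {κ : Type*} (s : Finset κ) (F : κ → (ι → α) → ℝ) (a b : ι → α) :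
    altSum (fun x => ∑ k ∈ s, F k x) a b = ∑ k ∈ s, altSum (F k) a b := by
  simp_rw [altSum, Finset.mul_sum]
  exact Finset.sum_comm

theorem altSum_congr {f g : (ι → α) → ℝ} {a b : ι → α}
    (h : ∀ v : Finset ι, f (v.piecewise a b) = g (v.piecewise a b)) :
    altSum f a b = altSum g a b := by
  simp_rw [altSum, h]

/-- Toggling membership of `j` in `v` leaves the corner unchanged and flips the sign, so the terms
cancel in pairs. -/
theorem altSum_eq_zero_of_eq {f : (ι → α) → ℝ} {a b : ι → α} {j : ι} (h : a j = b j) :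
    altSum f a b = 0 := by
  classical
  rw [altSum]
  refine Finset.sum_involution (fun v _ => if j ∈ v then v.erase j else insert j v) ?_ ?_ ?_ ?_
  · intro v _
    have key : (if j ∈ v then v.erase j else insert j v).piecewise a b = v.piecewise a b := by
      funext i
      by_cases hij : i = j
      · subst hij
        by_cases hv : i ∈ v <;> simp [hv, Finset.piecewise, h]
      · by_cases hv : j ∈ v <;> simp [hv, Finset.piecewise, hij]
    rw [key]
    by_cases hv : j ∈ v
    · simp only [hv, if_true]
      rw [← Finset.card_erase_add_one hv, pow_succ]
      ring
    · simp only [hv, if_false]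
      rw [Finset.card_insert_of_notMem hv, pow_succ]
      ring
  · intro v _ _ hne
    by_cases hv : j ∈ v
    · simp only [hv, if_true] at hne
      exact Finset.notMem_erase j v (by rw [hne]; exact hv)
    · simp only [hv, if_false] at hne
      exact hv (hne ▸ Finset.mem_insert_self j v)
  · intro v _
    exact Finset.mem_univ _
  · intro v _
    by_cases hv : j ∈ v
    · rw [if_pos hv, if_neg (Finset.notMem_erase j v), Finset.insert_erase hv]
    · rw [if_neg hv, if_pos (Finset.mem_insert_self j v), Finset.erase_insert hv]

/-- On a finite grid every function is a combination of products of point indicators. Identities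
linear in `f` that only involve grid values therefore need checking for products alone. -/
theorem sum_mul_prod_ite_eq (f : (ι → ℝ) → ℝ) {G : ι → Finset ℝ} {x : ι → ℝ}
    (hx : x ∈ Fintype.piFinset G) :
    ∑ p ∈ Fintype.piFinset G, f p * ∏ j, (if x j = p j then (1 : ℝ) else 0) = f x := by
  classical
  have h1 : ∀ p, (∏ j, if x j = p j then (1 : ℝ) else 0) = if p = x then 1 else 0 := by
    intro p
    by_cases h : p = x
    · simp [h]
    · rw [if_neg h]
      obtain ⟨j, hj⟩ := Function.ne_iff.1 h
      exact Finset.prod_eq_zero (Finset.mem_univ j) (by simp [Ne.symm hj])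
  simp only [h1]
  simp [hx]

/-- After replacing `f` by a combination of products of point indicators, the sum over cells factors
into one-dimensional telescoping sums. -/
theorem sum_altSum_ladder (f : (ι → ℝ) → ℝ) {Y : ι → Finset ℝ} {a b : ι → ℝ}
    (hY : ∀ j, IsLadder (Y j) (a j) (b j)) :
    ∑ y ∈ Fintype.piFinset Y, altSum f y (ladderSuccPi Y b y) = altSum f a b := by
  classical
  -- The right endpoints are added because successors can equal `b j`, which need not lie in the
  -- ladder.
  set G : ι → Finset ℝ := fun j => insert (b j) (Y j)
  set g : (ι → ℝ) → ℝ := fun x => ∑ p ∈ Fintype.piFinset G,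
    f p * ∏ j, if x j = p j then (1 : ℝ) else 0
  have hfg : ∀ x ∈ Fintype.piFinset G, f x = g x := fun x hx => (sum_mul_prod_ite_eq f hx).symm
  have hg : ∀ a b : ι → ℝ, altSum g a b = ∑ p ∈ Fintype.piFinset G, f p *
      ∏ j, ((if b j = p j then (1 : ℝ) else 0) - if a j = p j then 1 else 0) := by
    intro a b
    rw [altSum_sum]
    refine Finset.sum_congr rfl fun p _ => ?_
    exact altSum_prod (f p) (fun j t => if t = p j then (1 : ℝ) else 0) a b
  have hpw : ∀ (x z : ι → ℝ), x ∈ Fintype.piFinset G → z ∈ Fintype.piFinset G →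
      altSum f x z = altSum g x z := by
    intro x z hx hz
    refine altSum_congr fun v => hfg _ (Fintype.mem_piFinset.2 fun j => ?_)
    rw [Fintype.mem_piFinset] at hx hz
    by_cases hv : j ∈ v <;> simp [Finset.piecewise, hv, hx j, hz j]
  have hmem : ∀ y ∈ Fintype.piFinset Y, y ∈ Fintype.piFinset G := fun y hy =>
    Fintype.mem_piFinset.2 fun j => Finset.mem_insert_of_mem (Fintype.mem_piFinset.1 hy j)
  rw [Finset.sum_congr rfl fun y hy => hpw y (ladderSuccPi Y b y) (hmem y hy)
    (Fintype.mem_piFinset.2 fun j => ?_)]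
  · rw [hpw a b (Fintype.mem_piFinset.2 fun j => Finset.mem_insert_of_mem (hY j).1)
      (Fintype.mem_piFinset.2 fun j => Finset.mem_insert_self _ _), hg]
    simp_rw [hg]
    rw [Finset.sum_comm]
    refine Finset.sum_congr rfl fun p _ => ?_
    rw [← Finset.mul_sum]
    congr 1
    refine (Finset.prod_univ_sum Y (fun j y => (if ladderSucc (Y j) (b j) y = p j then (1 : ℝ)
      else 0) - if y = p j then 1 else 0)).symm.trans ?_
    exact Finset.prod_congr rfl fun j _ => (hY j).sum_sub (fun t => if t = p j then (1 : ℝ) else 0)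
  · rcases ladderSucc_mem_or_eq (Y j) (b j) (y j) with h | h
    · exact Finset.mem_insert_of_mem h.1
    · rw [ladderSuccPi, h]; exact Finset.mem_insert_self _ _

end AltSum

theorem indicator_Ioc_eq_sub {a b : ℝ} (hab : a ≤ b) (x : ℝ) :
    (Set.Ioc a b).indicator (fun _ => (1 : ℝ)) x =
      (if x ≤ b then 1 else 0) - if x ≤ a then 1 else 0 := by
  by_cases h1 : x ≤ a
  · simp [h1, h1.trans hab, Set.indicator, not_lt.2 h1]
  · by_cases h2 : x ≤ b <;> simp [h1, h2, Set.indicator, not_le.1 h1]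

theorem sum_indicator_ladder {ι : Type*} [Fintype ι] [DecidableEq ι] {Y : ι → Finset ℝ}
    {a b : ι → ℝ} (hab : a ≤ b) (hY : ∀ j, IsLadder (Y j) (a j) (b j)) (x : ι → ℝ) :
    ∑ y ∈ Fintype.piFinset Y,
        (Set.univ.pi fun j => Set.Ioc (y j) (ladderSuccPi Y b y j)).indicator (fun _ => (1 : ℝ)) x =
      (Set.univ.pi fun j => Set.Ioc (a j) (b j)).indicator (fun _ => (1 : ℝ)) x := by
  classical
  have key : ∀ p q : ι → ℝ, (Set.univ.pi fun j => Set.Ioc (p j) (q j)).indicator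
      (fun _ => (1 : ℝ)) x = ∏ j, (Set.Ioc (p j) (q j)).indicator (fun _ => (1 : ℝ)) (x j) := by
    intro p q
    by_cases h : ∀ j, x j ∈ Set.Ioc (p j) (q j)
    · rw [Set.indicator_of_mem (by simpa using h),
        Finset.prod_congr rfl fun j _ => Set.indicator_of_mem (h j) _]
      simp
    · rw [Set.indicator_of_notMem (by simpa using h)]
      push Not at h
      obtain ⟨j, hj⟩ := h
      exact (Finset.prod_eq_zero (Finset.mem_univ j) (Set.indicator_of_notMem hj _)).symm
  simp_rw [key, ladderSuccPi]
  rw [← Finset.prod_univ_sum Y (fun j y =>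
    (Set.Ioc y (ladderSucc (Y j) (b j) y)).indicator (fun _ => (1 : ℝ)) (x j))]
  refine Finset.prod_congr rfl fun j _ => ?_
  rw [indicator_Ioc_eq_sub (hab j), ← (hY j).sum_sub (fun t => if x j ≤ t then (1 : ℝ) else 0)]
  exact Finset.sum_congr rfl fun y hy =>
    indicator_Ioc_eq_sub ((hY j).le_ladderSucc (hab j) hy) _

/-! ### Riemann-Stieltjes integrals with respect to smooth product integrators -/

theorem setIntegral_pi_Ioc_prod {ι : Type*} [Fintype ι] (g : ι → ℝ → ℝ) (a b : ι → ℝ) :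
    ∫ z in Set.univ.pi fun j => Set.Ioc (a j) (b j), ∏ j, g j (z j) =
      ∏ j, ∫ t in Set.Ioc (a j) (b j), g j t := by
  rw [volume_pi, Measure.restrict_pi_pi]
  exact integral_fintype_prod_eq_prod g

section RiemannStieltjes

variable {ι : Type*} [Fintype ι] [DecidableEq ι]

theorem setIntegral_Icc_eq_sum_ladder {Y : ι → Finset ℝ} {a b : ι → ℝ} (hab : a ≤ b)
    (hY : ∀ j, IsLadder (Y j) (a j) (b j)) {ψ : (ι → ℝ) → ℝ}
    (hψ : IntegrableOn ψ (Set.Icc a b)) :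
    ∫ z in Set.Icc a b, ψ z = ∑ y ∈ Fintype.piFinset Y,
      ∫ z in Set.univ.pi fun j => Set.Ioc (y j) (ladderSuccPi Y b y j), ψ z := by
  have hmeas : ∀ p q : ι → ℝ, MeasurableSet (Set.univ.pi fun j => Set.Ioc (p j) (q j)) :=
    fun p q => MeasurableSet.univ_pi fun j => measurableSet_Ioc
  have hmul : ∀ (s : Set (ι → ℝ)) x, s.indicator ψ x = s.indicator (fun _ => (1 : ℝ)) x * ψ x := by
    intro s x
    by_cases hx : x ∈ s <;> simp [hx]
  have hae : (Set.univ.pi fun j => Set.Ioc (a j) (b j)) =ᵐ[volume] Set.Icc a b :=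
    Measure.univ_pi_Ioc_ae_eq_Icc (μ := fun _ : ι => (volume : Measure ℝ))
  rw [← setIntegral_congr_set hae, ← integral_indicator (hmeas a b)]
  simp_rw [hmul, ← sum_indicator_ladder hab hY, Finset.sum_mul, ← hmul]
  rw [integral_finsetSum]
  · exact Finset.sum_congr rfl fun y _ => integral_indicator (hmeas _ _)
  · intro y hy
    refine IntegrableOn.integrable_indicator (hψ.mono_set ?_) (hmeas _ _)
    intro z hz
    rw [Fintype.mem_piFinset] at hy
    exact ⟨fun j => ((hY j).left_le (hy j)).trans (hz j trivial).1.le,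
      fun j => (hz j trivial).2.trans ((hY j).ladderSucc_le (hab j) _)⟩

/-- The increment of a smooth product over a cell is the integral of the product of derivatives. A
Riemann-Stieltjes sum thus differs from the integral only through the oscillation of `h` on cells,
which uniform continuity controls. -/
theorem hasRSIntegral_of_prod {h : (ι → ℝ) → ℝ} {a b : ι → ℝ} (hab : a ≤ b)
    (hh : ContinuousOn h (Set.Icc a b)) (c : ℝ) {F F' : ι → ℝ → ℝ}
    (hF : ∀ j x, HasDerivAt (F j) (F' j x) x) (hF' : ∀ j, Continuous (F' j)) :
    HasRSIntegral h (fun x => c * ∏ j, F j (x j)) a b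
      (c * ∫ z in Set.Icc a b, (∏ j, F' j (z j)) * h z) := by
  set D : (ι → ℝ) → ℝ := fun z => ∏ j, F' j (z j) with hD
  have hDc : Continuous D := continuous_finsetProd _ fun j _ => (hF' j).comp (continuous_apply j)
  have hK : IsCompact (Set.Icc a b) := isCompact_Icc
  obtain ⟨M, hM⟩ := hK.exists_bound_of_continuousOn hDc.continuousOn
  have hM0 : 0 ≤ M := (norm_nonneg _).trans (hM a (Set.left_mem_Icc.2 hab))
  set V := volume.real (Set.Icc a b)
  have hV : 0 ≤ V := measureReal_nonneg
  intro ε hε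
  have hq : 0 ≤ |c| * M * V := by positivity
  -- `ρ` is the allowed oscillation of `h`. The `+ 1` keeps the denominator positive and the final
  -- bound strictly below `ε`.
  set ρ := ε / (|c| * M * V + 1) with hρ
  have hρ0 : 0 < ρ := by positivity
  have hlt : |c| * (M * ρ * V) < ε := by
    rw [hρ]
    have : |c| * (M * (ε / (|c| * M * V + 1)) * V) = ε * ((|c| * M * V) / (|c| * M * V + 1)) := by
      ring
    rw [this]
    exact mul_lt_of_lt_one_right hε ((div_lt_one (by positivity)).2 (lt_add_one _))
  obtain ⟨η, hη, hunif⟩ := Metric.uniformContinuousOn_iff.1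
    (hK.uniformContinuousOn_of_continuous hh) ρ hρ0
  refine ⟨η, hη, fun Y tag hY hmesh htag => ?_⟩
  have hint : IntegrableOn (fun z => D z * h z) (Set.Icc a b) :=
    (hDc.continuousOn.mul hh).integrableOn_compact hK
  have hcell : ∀ y ∈ Fintype.piFinset Y,
      (Set.univ.pi fun j => Set.Ioc (y j) (ladderSuccPi Y b y j)) ⊆ Set.Icc a b := by
    intro y hy z hz
    rw [Fintype.mem_piFinset] at hy
    exact ⟨fun j => ((hY j).left_le (hy j)).trans (hz j trivial).1.le,
      fun j => (hz j trivial).2.trans ((hY j).ladderSucc_le (hab j) _)⟩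
  have hle : ∀ y ∈ Fintype.piFinset Y, ∀ j, y j ≤ ladderSuccPi Y b y j := fun y hy j =>
    (hY j).le_ladderSucc (hab j) (Fintype.mem_piFinset.1 hy j)
  have hincr : ∀ y ∈ Fintype.piFinset Y,
      altSum (fun x => c * ∏ j, F j (x j)) y (ladderSuccPi Y b y) =
        c * ∫ z in Set.univ.pi fun j => Set.Ioc (y j) (ladderSuccPi Y b y j), D z := by
    intro y hy
    rw [altSum_prod, hD, setIntegral_pi_Ioc_prod]
    congr 1
    refine Finset.prod_congr rfl fun j _ => ?_
    rw [← intervalIntegral.integral_of_le (hle y hy j),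
      intervalIntegral.integral_eq_sub_of_hasDerivAt (fun x _ => hF j x)
        ((hF' j).intervalIntegrable _ _)]
  rw [setIntegral_Icc_eq_sum_ladder hab hY hint, Finset.mul_sum, ← Finset.sum_sub_distrib]
  have hVsum : V = ∑ y ∈ Fintype.piFinset Y,
      volume.real (Set.univ.pi fun j => Set.Ioc (y j) (ladderSuccPi Y b y j)) := by
    have := setIntegral_Icc_eq_sum_ladder hab hY (ψ := fun _ => (1 : ℝ))
      (continuousOn_const.integrableOn_compact hK)
    simpa [V] using this
  refine lt_of_le_of_lt (Finset.abs_sum_le_sum_abs _ _) (lt_of_le_of_lt ?_ hlt)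
  rw [hVsum, Finset.mul_sum, Finset.mul_sum]
  refine Finset.sum_le_sum fun y hy => ?_
  rw [hincr y hy]
  set S := Set.univ.pi fun j => Set.Ioc (y j) (ladderSuccPi Y b y j) with hS
  have hSm : MeasurableSet S := MeasurableSet.univ_pi fun j => measurableSet_Ioc
  have htagS : tag y ∈ Set.Icc a b := by
    have := htag y hy
    rw [Fintype.mem_piFinset] at hy
    exact ⟨fun j => ((hY j).left_le (hy j)).trans (this.1 j),
      fun j => (this.2 j).trans ((hY j).ladderSucc_le (hab j) _)⟩
  have hSfin : volume S < ⊤ := (measure_mono (hcell y hy)).trans_lt hK.measure_lt_top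
  have hDint : IntegrableOn D S := (hDc.continuousOn.integrableOn_compact hK).mono_set (hcell y hy)
  have e1 : h (tag y) * (c * ∫ z in S, D z) - c * ∫ z in S, D z * h z =
      c * ∫ z in S, D z * (h (tag y) - h z) := by
    have : ∀ z, D z * (h (tag y) - h z) = D z * h (tag y) - D z * h z := fun z => by ring
    simp_rw [this]
    rw [integral_sub (hDint.mul_const _) (hint.mono_set (hcell y hy)), integral_mul_const]
    ring
  rw [e1, abs_mul]
  refine mul_le_mul_of_nonneg_left ?_ (abs_nonneg c)
  rw [← Real.norm_eq_abs]
  refine norm_setIntegral_le_of_norm_le_const hSfin fun z hz => ?_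
  rw [norm_mul]
  refine mul_le_mul (hM z (hcell y hy hz)) ?_ (norm_nonneg _) hM0
  have hdist : dist (tag y) z < η := by
    rw [dist_pi_lt_iff hη]
    intro j
    have h1 := (htag y hy).1 j
    have h2 := (htag y hy).2 j
    have h3 := (hz j trivial).1
    have h4 := (hz j trivial).2
    have h5 := hmesh j (y j) (Fintype.mem_piFinset.1 hy j)
    rw [ladderSuccPi] at h2 h4
    rw [Real.dist_eq, abs_lt]
    constructor <;> linarith
  exact (hunif _ htagS _ (hcell y hy hz) hdist).le

/-- Both values are compared with the sum over one ladder fine enough for both, tagged at lower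
corners. Uniqueness is what allows the chosen value in `rsIntegral` to be computed. -/
theorem HasRSIntegral.unique {h f : (ι → ℝ) → ℝ} {a b : ι → ℝ} {c c' : ℝ} (hab : a ≤ b)
    (hc : HasRSIntegral h f a b c) (hc' : HasRSIntegral h f a b c') : c = c' := by
  refine eq_of_abs_sub_le_all fun ε hε => ?_
  obtain ⟨η, hη, H⟩ := hc (ε / 2) (half_pos hε)
  obtain ⟨η', hη', H'⟩ := hc' (ε / 2) (half_pos hε)
  choose Y hY hmesh using fun j => exists_isLadder_ladderSucc_sub_lt (hab j) (lt_min hη hη')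
  have htag : ∀ y ∈ Fintype.piFinset Y, y ∈ Set.Icc y (ladderSuccPi Y b y) := fun y hy =>
    Set.left_mem_Icc.2 fun j => (hY j).le_ladderSucc (hab j) (Fintype.mem_piFinset.1 hy j)
  have h1 := H Y (fun y => y) hY (fun j y hy => (hmesh j y hy).trans_le (min_le_left _ _)) htag
  have h2 := H' Y (fun y => y) hY (fun j y hy => (hmesh j y hy).trans_le (min_le_right _ _)) htag
  rw [abs_lt] at h1 h2
  rw [abs_le]
  constructor <;> linarith

theorem HasRSIntegral.rsIntegral_eq {h f : (ι → ℝ) → ℝ} {a b : ι → ℝ} {c : ℝ} (hab : a ≤ b)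
    (hc : HasRSIntegral h f a b c) : rsIntegral h f a b = c := by
  have H : ∃ c, HasRSIntegral h f a b c := ⟨c, hc⟩
  rw [rsIntegral, dif_pos H]
  exact H.choose_spec.unique hab hc

theorem hasRSIntegral_zero {h f : (ι → ℝ) → ℝ} {a b : ι → ℝ} (hab : a ≤ b)
    (hh : ∀ x ∈ Set.Icc a b, h x = 0) : HasRSIntegral h f a b 0 := by
  refine fun ε hε => ⟨1, one_pos, fun Y tag hY _ htag => ?_⟩
  rw [Finset.sum_eq_zero, sub_zero, abs_zero]
  · exact hε
  · intro y hy
    have ht := htag y hy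
    rw [Fintype.mem_piFinset] at hy
    rw [hh _ ⟨fun j => ((hY j).left_le (hy j)).trans (ht.1 j),
      fun j => (ht.2 j).trans ((hY j).ladderSucc_le (hab j) _)⟩, zero_mul]

end RiemannStieltjes

/-! ### Integration by parts against product kernels -/

section SheetIntegral

variable {ι : Type*} [Fintype ι] [DecidableEq ι]

/-- The integral of the product kernel `∏ j, G j` with respect to `db` over `[0, e]`, written
by parts with `H j` the derivative of `G j`. -/
def sheetIntegral (G H : ι → ℝ → ℝ) (e : ι → ℝ) (b : (ι → ℝ) → ℝ) : ℝ :=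
  ∑ v : Finset ι, (-1 : ℝ) ^ v.card * ((∏ j ∈ vᶜ, G j (e j)) *
    ∫ z : {j // j ∈ v} → ℝ in Set.Icc (fun _ => 0) (fun j : {j // j ∈ v} => e j),
      (∏ j : {j // j ∈ v}, H j (z j)) * b (glue v z e))

theorem prod_glue (g : ι → ℝ → ℝ) (v : Finset ι) (x : {j // j ∈ v} → ℝ) (z : ι → ℝ) :
    ∏ j, g j (glue v x z j) = (∏ j ∈ vᶜ, g j (z j)) * ∏ j : {j // j ∈ v}, g j (x j) := by
  rw [← Finset.prod_mul_prod_compl v, mul_comm]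
  congr 1
  · refine Finset.prod_congr rfl fun j hj => ?_
    rw [glue, dif_neg (Finset.mem_compl.1 hj)]
  · rw [← Finset.prod_coe_sort v]
    refine Finset.prod_congr rfl fun j _ => ?_
    rw [glue, dif_pos j.2]

omit [Fintype ι] in
theorem continuous_glue (v : Finset ι) : Continuous
    fun p : ({j // j ∈ v} → ℝ) × (ι → ℝ) => glue v p.1 p.2 := by
  refine continuous_pi fun j => ?_
  by_cases h : j ∈ v
  · simp only [glue, h, dif_pos]
    fun_prop
  · simp only [glue, h, dif_neg, not_false_eq_true]
    fun_prop

omit [Fintype ι] in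
theorem glue_mem_Icc {v : Finset ι} {x : {j // j ∈ v} → ℝ} {z c d : ι → ℝ}
    (hx : x ∈ Set.Icc (fun j : {j // j ∈ v} => c j) (fun j => d j)) (hz : z ∈ Set.Icc c d) :
    glue v x z ∈ Set.Icc c d := by
  constructor <;> intro j <;> by_cases h : j ∈ v
  · simpa [glue, h] using hx.1 ⟨j, h⟩
  · simpa [glue, h] using hz.1 j
  · simpa [glue, h] using hx.2 ⟨j, h⟩
  · simpa [glue, h] using hz.2 j

/-- For a product kernel each Riemann-Stieltjes term has a smooth product integrator, so it is an
ordinary integral with the derivatives as density. -/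
theorem rsIntegralByParts_eq_sheetIntegral {G H : ι → ℝ → ℝ}
    (hG : ∀ j x, HasDerivAt (G j) (H j x) x) (hH : ∀ j, Continuous (H j)) {e : ι → ℝ}
    (he : ∀ j, 0 ≤ e j) {b : (ι → ℝ) → ℝ} (hb : ContinuousOn b (Set.Icc (fun _ => 0) e))
    (hb0 : ∀ z, (∃ j, z j = 0) → b z = 0) :
    rsIntegralByParts (fun z => ∏ j, G j (z j)) b (fun _ => 0) e = sheetIntegral G H e b := by
  refine Finset.sum_congr rfl fun v _ => ?_
  congr 1
  have hle : (fun _ : {j // j ∈ v} => (0 : ℝ)) ≤ fun j : {j // j ∈ v} => e j := fun j => he j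
  -- A nonempty `w` fixes some coordinate off `v` at the lower endpoint `0`, where `b` vanishes;
  -- only upper boundary terms survive.
  rw [Finset.sum_eq_single ∅]
  · simp only [Finset.card_empty, pow_zero, one_mul, Finset.piecewise_empty, prod_glue]
    refine (hasRSIntegral_of_prod hle ?_ _ (fun j x => hG j x) fun j => hH j).rsIntegral_eq hle
    refine hb.comp ((continuous_glue v).comp (Continuous.prodMk_left e)).continuousOn ?_
    exact fun x hx => glue_mem_Icc hx ⟨fun j => he j, le_rfl⟩
  · intro w hw hne
    obtain ⟨j, hj⟩ := Finset.nonempty_iff_ne_empty.2 hne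
    have hjv : j ∉ v := Finset.mem_compl.1 (Finset.mem_powerset.1 hw hj)
    rw [(hasRSIntegral_zero hle fun x _ => hb0 _ ⟨j, ?_⟩).rsIntegral_eq hle, mul_zero]
    simp [glue, hjv, Finset.piecewise, hj]
  · intro h
    exact absurd (Finset.empty_mem_powerset _) h

theorem sheetIntegral_const_mul (G H : ι → ℝ → ℝ) (e : ι → ℝ) (c : ℝ) (b : (ι → ℝ) → ℝ) :
    sheetIntegral G H e (fun z => c * b z) = c * sheetIntegral G H e b := by
  rw [sheetIntegral, sheetIntegral, Finset.mul_sum]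
  refine Finset.sum_congr rfl fun v _ => ?_
  simp_rw [mul_left_comm _ c]
  rw [integral_const_mul]
  ring

theorem integrableOn_sheetIntegrand {H : ι → ℝ → ℝ} (hH : ∀ j, Continuous (H j)) {e : ι → ℝ}
    (he : ∀ j, 0 ≤ e j) {b : (ι → ℝ) → ℝ} (hb : Measurable b) {C : ℝ}
    (hC : ∀ z ∈ Set.Icc (fun _ => 0) e, |b z| ≤ C) (v : Finset ι) :
    IntegrableOn (fun z : {j // j ∈ v} → ℝ => (∏ j : {j // j ∈ v}, H j (z j)) * b (glue v z e))
      (Set.Icc (fun _ => 0) (fun j : {j // j ∈ v} => e j)) := by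
  have h0 : Continuous fun z : {j // j ∈ v} → ℝ => ∏ j : {j // j ∈ v}, H j (z j) :=
    continuous_finsetProd _ fun j _ => (hH j).comp (continuous_apply j)
  have h1 := (h0.continuousOn (s := Set.Icc (fun _ => 0)
    (fun j : {j // j ∈ v} => e j))).integrableOn_compact (μ := volume) isCompact_Icc
  refine h1.mul_bdd (c := C) ?_ ?_
  · exact (hb.comp ((continuous_glue v).comp
      (Continuous.prodMk_left e)).measurable).aestronglyMeasurable
  · refine (ae_restrict_iff' measurableSet_Icc).2 (Eventually.of_forall fun z hz => ?_)
    exact hC _ (glue_mem_Icc hz ⟨fun j => he j, le_rfl⟩)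

theorem sheetIntegral_finset_sum {κ : Type*} (s : Finset κ) {G H : ι → ℝ → ℝ}
    (hH : ∀ j, Continuous (H j)) {e : ι → ℝ} (he : ∀ j, 0 ≤ e j) {b : κ → (ι → ℝ) → ℝ}
    (hb : ∀ k ∈ s, Measurable (b k))
    (hC : ∀ k ∈ s, ∃ C, ∀ z ∈ Set.Icc (fun _ => 0) e, |b k z| ≤ C) :
    sheetIntegral G H e (fun z => ∑ k ∈ s, b k z) = ∑ k ∈ s, sheetIntegral G H e (b k) := by
  simp_rw [sheetIntegral]
  rw [Finset.sum_comm]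
  refine Finset.sum_congr rfl fun v _ => ?_
  simp_rw [Finset.mul_sum]
  rw [integral_finsetSum]
  · simp_rw [Finset.mul_sum]
  · intro k hk
    obtain ⟨C, hC⟩ := hC k hk
    exact integrableOn_sheetIntegrand hH he (hb k hk) hC v

/-- By Fubini, the sum over `v` is the expansion of a product of differences, each factor being a
one-dimensional integration by parts. -/
theorem sheetIntegral_prod (G H : ι → ℝ → ℝ) (e : ι → ℝ) (k : ι → ℝ → ℝ) :
    sheetIntegral G H e (fun z => ∏ j, k j (z j)) =
      ∏ j, (G j (e j) * k j (e j) - ∫ t in Set.Icc 0 (e j), H j t * k j t) := by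
  rw [Finset.prod_sub, Finset.powerset_univ]
  refine Finset.sum_congr rfl fun v _ => ?_
  simp_rw [prod_glue]
  have h1 : ∀ z : {j // j ∈ v} → ℝ, (∏ j : {j // j ∈ v}, H j (z j)) *
      ((∏ j ∈ vᶜ, k j (e j)) * ∏ j : {j // j ∈ v}, k j (z j)) =
      (∏ j ∈ vᶜ, k j (e j)) * ∏ j : {j // j ∈ v}, H j (z j) * k j (z j) := by
    intro z
    rw [Finset.prod_mul_distrib]
    ring
  simp_rw [h1]
  rw [integral_const_mul, ← Set.pi_univ_Icc, volume_pi, Measure.restrict_pi_pi,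
    integral_fintype_prod_eq_prod (fun (j : {j // j ∈ v}) t => H j t * k j t),
    Finset.prod_coe_sort v (fun j => ∫ t in Set.Icc 0 (e j), H j t * k j t),
    Finset.prod_mul_distrib, ← Finset.compl_eq_univ_sdiff]
  ring

theorem ae_forall_ne {κ : Type*} [Fintype κ] (c : κ → ℝ) :
    ∀ᵐ z : κ → ℝ, ∀ j, z j ≠ c j := by
  rw [ae_all_iff]
  intro j
  rw [ae_iff]
  simp only [not_not]
  exact Measure.pi_hyperplane (fun _ : κ => (volume : Measure ℝ)) j (c j)

/-- Dominated convergence over a box with moving upper corner. -/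
theorem tendsto_setIntegral_Icc {κ α : Type*} [Fintype κ] {𝓕 : Filter α}
    [𝓕.IsCountablyGenerated] {e' : α → κ → ℝ} {e E : κ → ℝ} {a : κ → ℝ}
    (he : Tendsto e' 𝓕 (𝓝 e)) (heE : ∀ᶠ i in 𝓕, e' i ≤ E) (hE : e ≤ E)
    {f : α → (κ → ℝ) → ℝ} {g : (κ → ℝ) → ℝ}
    (hm : ∀ᶠ i in 𝓕, AEStronglyMeasurable (f i) (volume.restrict (Set.Icc a E))) {C : ℝ}
    (hC : ∀ᶠ i in 𝓕, ∀ z ∈ Set.Icc a E, |f i z| ≤ C)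
    (hlim : ∀ᵐ z, z ∈ Set.Icc a E → Tendsto (fun i => f i z) 𝓕 (𝓝 (g z))) :
    Tendsto (fun i => ∫ z in Set.Icc a (e' i), f i z) 𝓕 (𝓝 (∫ z in Set.Icc a e, g z)) := by
  have key : ∀ (d : κ → ℝ) (h : (κ → ℝ) → ℝ), d ≤ E → ∫ z in Set.Icc a d, h z =
      ∫ z in Set.Icc a E, (Set.Icc a d).indicator h z := by
    intro d h hd
    rw [setIntegral_indicator measurableSet_Icc,
      Set.inter_eq_self_of_subset_right (Set.Icc_subset_Icc_right hd)]
  rw [key e g hE]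
  refine Tendsto.congr' (f₁ := fun i => ∫ z in Set.Icc a E, (Set.Icc a (e' i)).indicator (f i) z)
    (heE.mono fun i hi => (key _ _ hi).symm) ?_
  refine tendsto_integral_filter_of_dominated_convergence (fun _ => C)
    (hm.mono fun i hi => hi.indicator measurableSet_Icc) ?_ ?_ ?_
  · filter_upwards [hC] with i hi
    refine (ae_restrict_iff' measurableSet_Icc).2 (Eventually.of_forall fun z hz => ?_)
    exact (norm_indicator_le_norm_self _ _).trans (hi z hz)
  · exact continuousOn_const.integrableOn_compact isCompact_Icc
  -- Off the null hyperplanes `z j = e j`, membership in the moving box is eventually constant, so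
  -- its indicator converges.
  · refine (ae_restrict_iff' measurableSet_Icc).2 ?_
    filter_upwards [hlim, ae_forall_ne e] with z hz hne hzE
    rw [tendsto_pi_nhds] at he
    by_cases hze : z ≤ e
    · rw [Set.indicator_of_mem (show z ∈ Set.Icc a e from ⟨hzE.1, hze⟩)]
      have h1 : ∀ᶠ i in 𝓕, ∀ j, z j < e' i j := eventually_all.2 fun j =>
        (he j).eventually (lt_mem_nhds (lt_of_le_of_ne (hze j) (hne j)))
      refine (hz hzE).congr' (h1.mono fun i hi => ?_)
      exact (Set.indicator_of_mem (show z ∈ Set.Icc a (e' i) from ⟨hzE.1, fun j => (hi j).le⟩)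
        _).symm
    · rw [Set.indicator_of_notMem (fun h => hze h.2)]
      rw [Pi.le_def] at hze
      push Not at hze
      obtain ⟨j, hj⟩ := hze
      refine tendsto_const_nhds.congr' (((he j).eventually (gt_mem_nhds hj)).mono fun i hi => ?_)
      exact (Set.indicator_of_notMem (fun h => absurd (h.2 j) (not_le.2 hi)) _).symm

/-- Dominated convergence in each term. The paths must converge along moving arguments because the
glued points contain the moving corner `e'`. -/
theorem tendsto_sheetIntegral {α : Type*} {𝓕 : Filter α} [𝓕.IsCountablyGenerated]
    {G' H' : α → ι → ℝ → ℝ} {e' : α → ι → ℝ} {b' : α → (ι → ℝ) → ℝ}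
    {G H : ι → ℝ → ℝ} {e : ι → ℝ} {b : (ι → ℝ) → ℝ}
    (hG : ∀ j, Tendsto (fun i => G' i j (e' i j)) 𝓕 (𝓝 (G j (e j))))
    (hHc : ∀ i j, Continuous (H' i j))
    {C : ℝ} (hHb : ∀ᶠ i in 𝓕, ∀ j, ∀ t ∈ Set.Icc (0 : ℝ) 1, |H' i j t| ≤ C)
    (hH : ∀ j, ∀ t ∈ Set.Icc (0 : ℝ) 1, Tendsto (fun i => H' i j t) 𝓕 (𝓝 (H j t)))
    (he : Tendsto e' 𝓕 (𝓝 e)) (he1 : ∀ i, e' i ∈ Set.Icc (fun _ => 0) (fun _ => 1))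
    (hee : e ∈ Set.Icc (fun _ => 0) (fun _ => 1))
    (hbm : ∀ i, Measurable (b' i)) {D : ℝ}
    (hbb : ∀ᶠ i in 𝓕, ∀ z ∈ Set.Icc (fun _ => 0) (fun _ => 1), |b' i z| ≤ D)
    (hb : ∀ z ∈ Set.Icc (fun _ => 0) (fun _ => 1), ∀ z' : α → ι → ℝ,
      (∀ i, z' i ∈ Set.Icc (fun _ => 0) (fun _ => 1)) → Tendsto z' 𝓕 (𝓝 z) →
      Tendsto (fun i => b' i (z' i)) 𝓕 (𝓝 (b z))) :
    Tendsto (fun i => sheetIntegral (G' i) (H' i) (e' i) (b' i)) 𝓕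
      (𝓝 (sheetIntegral G H e b)) := by
  refine tendsto_finsetSum _ fun v _ => Tendsto.const_mul _ (Tendsto.mul
    (tendsto_finsetProd _ fun j _ => hG j) ?_)
  have he' := tendsto_pi_nhds.1 he
  have hgl : ∀ i, ∀ z ∈ Set.Icc (fun _ : {j // j ∈ v} => (0 : ℝ)) (fun _ => 1),
      glue v z (e' i) ∈ Set.Icc (fun _ => 0) (fun _ => 1) := fun i z hz =>
    glue_mem_Icc (c := fun _ => (0 : ℝ)) (d := fun _ => 1) hz (he1 i)
  refine tendsto_setIntegral_Icc (e' := fun i (j : {j // j ∈ v}) => e' i j)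
    (e := fun j : {j // j ∈ v} => e j) (E := fun _ => 1) (C := (∏ _j : {j // j ∈ v}, C) * D)
    (tendsto_pi_nhds.2 fun j => he' j) (Eventually.of_forall fun i j => (he1 i).2 j)
    (fun j => hee.2 j) (Eventually.of_forall fun i => ?_) ?_ (Eventually.of_forall fun z hz => ?_)
  · refine Measurable.aestronglyMeasurable (Measurable.mul ?_ ?_)
    · have h0 : Continuous fun z : {j // j ∈ v} → ℝ => ∏ j : {j // j ∈ v}, H' i j (z j) :=
        continuous_finsetProd _ fun j _ => (hHc i j).comp (continuous_apply j)
      exact h0.measurable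
    · exact (hbm i).comp ((continuous_glue v).comp (Continuous.prodMk_left (e' i))).measurable
  · filter_upwards [hHb, hbb] with i h1 h2 z hz
    rw [abs_mul, Finset.abs_prod]
    have hp : ∏ j : {j // j ∈ v}, |H' i j (z j)| ≤ ∏ _j : {j // j ∈ v}, C :=
      Finset.prod_le_prod (fun _ _ => abs_nonneg _) fun j _ => h1 j _ ⟨hz.1 j, hz.2 j⟩
    exact mul_le_mul hp (h2 _ (hgl i z hz)) (abs_nonneg _)
      ((Finset.prod_nonneg fun _ _ => abs_nonneg _).trans hp)
  · refine Tendsto.mul (tendsto_finsetProd _ fun j _ => hH j _ ⟨hz.1 j, hz.2 j⟩) ?_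
    refine hb _ (glue_mem_Icc (c := fun _ => (0 : ℝ)) (d := fun _ => 1) hz hee) _
      (fun i => hgl i z hz) ?_
    exact ((continuous_glue v).tendsto (z, e)).comp (Tendsto.prodMk_nhds tendsto_const_nhds he)

end SheetIntegral

/-! ### The reconstruction kernel -/

theorem sincKernel_eq (w x : ℝ) : sincKernel w x = w / Real.pi * Real.sinc (w * x) := by
  by_cases hx : x = 0
  · simp [sincKernel, hx]
  · rcases eq_or_ne w 0 with rfl | hw
    · simp [sincKernel, hx]
    · rw [sincKernel, if_neg hx, Real.sinc_of_ne_zero (mul_ne_zero hw hx)]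
      field_simp

/-- At the removable singularity `sinc` is the divided slope of `sin`, whose power series is a shift
of that of `sin`. -/
theorem analyticAt_sinc (x : ℝ) : AnalyticAt ℝ Real.sinc x := by
  rw [Real.sinc_eq_dslope]
  rcases eq_or_ne x 0 with rfl | hx
  · obtain ⟨p, hp⟩ := Real.analyticAt_sin (x := 0)
    exact ⟨_, hp.has_fpower_series_dslope_fslope⟩
  · have h : AnalyticAt ℝ (fun y => Real.sin y / y) x :=
      Real.analyticAt_sin.div analyticAt_id hx
    refine h.congr ?_
    filter_upwards [isOpen_ne.mem_nhds hx] with y hy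
    rw [← Real.sinc_eq_dslope, Real.sinc_of_ne_zero hy]

theorem contDiff_sincKernel (w : ℝ) : ContDiff ℝ 1 (sincKernel w) := by
  have h : ContDiff ℝ 1 Real.sinc :=
    contDiff_iff_contDiffAt.2 fun x => (analyticAt_sinc x).contDiffAt
  have : sincKernel w = fun x => w / Real.pi * Real.sinc (w * x) := funext (sincKernel_eq w)
  rw [this]
  fun_prop

theorem continuous_sincKernel (w : ℝ) : Continuous (sincKernel w) :=
  (contDiff_sincKernel w).continuous

theorem continuous_deriv_sincKernel (w : ℝ) : Continuous (deriv (sincKernel w)) :=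
  (contDiff_sincKernel w).continuous_deriv le_rfl

theorem hasDerivAt_sincKernel (w x : ℝ) :
    HasDerivAt (sincKernel w) (deriv (sincKernel w) x) x :=
  ((contDiff_sincKernel w).differentiable (by norm_num) x).hasDerivAt

theorem continuous_reconKernel (w : Fin 3 → ℝ) : Continuous (reconKernel w) :=
  continuous_finsetProd _ fun j _ => (continuous_sincKernel (w j)).comp (continuous_apply j)

/-- If all these integrals vanished, differentiating would make the kernel, hence a sine, vanish on
an interval. Differentiating again kills the cosine at the midpoint, against `sin² + cos² = 1`. -/
theorem exists_integral_sincKernel_ne_zero {w a : ℝ} (hw : 0 < w) (ha : 0 < a) (x : ℝ) {δ : ℝ}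
    (hδ : 0 < δ) : ∃ t ∈ Set.Ioo 0 δ, ∫ z in (0 : ℝ)..t, sincKernel w (x - a * z) ≠ 0 := by
  by_contra! hcon
  have hc : Continuous fun z => sincKernel w (x - a * z) :=
    (continuous_sincKernel w).comp (by fun_prop)
  have h0 : ∀ t ∈ Set.Ioo 0 δ, sincKernel w (x - a * t) = 0 := by
    intro t ht
    have h1 : HasDerivAt (fun u => ∫ z in (0 : ℝ)..u, sincKernel w (x - a * z))
        (sincKernel w (x - a * t)) t := hc.integral_hasStrictDerivAt 0 t |>.hasDerivAt
    have h2 : (fun u => ∫ z in (0 : ℝ)..u, sincKernel w (x - a * z)) =ᶠ[𝓝 t] fun _ => 0 := by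
      filter_upwards [isOpen_Ioo.mem_nhds ht] with u hu
      exact hcon u hu
    exact h1.unique ((hasDerivAt_const t (0 : ℝ)).congr_of_eventuallyEq h2)
  have hsin : ∀ t ∈ Set.Ioo 0 δ, Real.sin (w * (x - a * t)) = 0 := by
    intro t ht
    have := h0 t ht
    rw [sincKernel] at this
    split_ifs at this with hx
    · simp [hx]
    · rw [div_eq_zero_iff] at this
      exact this.resolve_right (mul_ne_zero Real.pi_ne_zero hx)
  have hmid : δ / 2 ∈ Set.Ioo 0 δ := ⟨half_pos hδ, half_lt_self hδ⟩
  have h1 : HasDerivAt (fun t => Real.sin (w * (x - a * t)))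
      (Real.cos (w * (x - a * (δ / 2))) * (w * -a)) (δ / 2) := by
    refine HasDerivAt.sin ?_
    have := (((hasDerivAt_id (δ / 2)).const_mul a).const_sub x).const_mul w
    simpa using this
  have h2 : (fun t => Real.sin (w * (x - a * t))) =ᶠ[𝓝 (δ / 2)] fun _ => 0 := by
    filter_upwards [isOpen_Ioo.mem_nhds hmid] with u hu
    exact hsin u hu
  have h3 := h1.unique ((hasDerivAt_const (δ / 2) (0 : ℝ)).congr_of_eventuallyEq h2)
  have hcos : Real.cos (w * (x - a * (δ / 2))) = 0 := by
    rcases mul_eq_zero.1 h3 with h | h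
    · exact h
    · exact absurd h (mul_ne_zero hw.ne' (neg_ne_zero.2 ha.ne'))
  have := Real.sin_sq_add_cos_sq (w * (x - a * (δ / 2)))
  rw [hsin _ hmid, hcos] at this
  norm_num at this

/-- The factors of `z ↦ φ (x - a z)`. -/
def scaledKernel (w a x : Fin 3 → ℝ) (j : Fin 3) (z : ℝ) : ℝ := sincKernel (w j) (x j - a j * z)

/-- The derivatives of the factors of `z ↦ φ (x - a z)`. -/
def scaledKernelDeriv (w a x : Fin 3 → ℝ) (j : Fin 3) (z : ℝ) : ℝ :=
  deriv (sincKernel (w j)) (x j - a j * z) * -a j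

theorem hasDerivAt_scaledKernel (w a x : Fin 3 → ℝ) (j : Fin 3) (z : ℝ) :
    HasDerivAt (scaledKernel w a x j) (scaledKernelDeriv w a x j z) z := by
  refine HasDerivAt.comp z (hasDerivAt_sincKernel (w j) _) ?_
  simpa using ((hasDerivAt_id z).const_mul (a j)).const_sub (x j)

theorem continuous_scaledKernel (w : Fin 3 → ℝ) (j : Fin 3) :
    Continuous fun p : (Fin 3 → ℝ) × (Fin 3 → ℝ) × ℝ => scaledKernel w p.1 p.2.1 j p.2.2 :=
  (continuous_sincKernel (w j)).comp (by fun_prop)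

theorem continuous_scaledKernelDeriv (w : Fin 3 → ℝ) (j : Fin 3) :
    Continuous fun p : (Fin 3 → ℝ) × (Fin 3 → ℝ) × ℝ => scaledKernelDeriv w p.1 p.2.1 j p.2.2 :=
  ((continuous_deriv_sincKernel (w j)).comp (by fun_prop)).mul (by fun_prop)

theorem continuous_scaledKernelDeriv_apply (w a x : Fin 3 → ℝ) (j : Fin 3) :
    Continuous (scaledKernelDeriv w a x j) :=
  (continuous_scaledKernelDeriv w j).comp (by fun_prop : Continuous fun z => (a, x, z))

/-! ### Lattice sums as integrals by parts -/

section LatticeSum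

variable {ι : Type*} [Fintype ι] [DecidableEq ι]

theorem sheetIntegral_congr {G H : ι → ℝ → ℝ} {e : ι → ℝ} (he : ∀ j, 0 ≤ e j)
    {b b' : (ι → ℝ) → ℝ} (hb : ∀ z ∈ Set.Icc (fun _ => 0) e, b z = b' z) :
    sheetIntegral G H e b = sheetIntegral G H e b' := by
  refine Finset.sum_congr rfl fun v _ => ?_
  congr 2
  refine setIntegral_congr_fun measurableSet_Icc fun z hz => ?_
  exact congrArg (fun t => _ * t) (hb _ (glue_mem_Icc hz ⟨fun j => he j, le_rfl⟩))

/-- The partial sum is a combination of products of indicators of `[l j / n j, ∞)`. For each of them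
the by-parts formula collapses, coordinate by coordinate, to `G (e) - (G (e) - G (l / n)) = G (l /
n)`. -/
theorem sheetIntegral_lattice_sum {G H : ι → ℝ → ℝ} (hG : ∀ j x, HasDerivAt (G j) (H j x) x)
    (hH : ∀ j, Continuous (H j)) {n m : ι → ℕ} (hn : ∀ j, 1 ≤ n j) {e : ι → ℝ}
    (he : ∀ j, e j = m j / n j) (ε : (ι → ℕ) → ℝ) :
    sheetIntegral G H e
        (fun z => ∑ l ∈ Finset.Icc (fun _ => 1) (fun j => ⌊(n j : ℝ) * z j⌋₊), ε l) =
      ∑ l ∈ Finset.Icc (fun _ => 1) m, ε l * ∏ j, G j (l j / n j) := by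
  have hn0 : ∀ j, (0 : ℝ) < n j := fun j => by exact_mod_cast hn j
  have he0 : ∀ j, 0 ≤ e j := fun j => by rw [he j]; positivity
  set k : (ι → ℕ) → ι → ℝ → ℝ := fun l j => (Set.Ici ((l j : ℝ) / n j)).indicator fun _ => 1
  have hk : ∀ l (z : ι → ℝ), ∏ j, k l j (z j) = if ∀ j, (l j : ℝ) / n j ≤ z j then 1 else 0 := by
    intro l z
    split_ifs with h
    · exact Finset.prod_eq_one fun j _ => Set.indicator_of_mem (h j) _
    · push Not at h
      obtain ⟨j, hj⟩ := h
      exact Finset.prod_eq_zero (Finset.mem_univ j) (Set.indicator_of_notMem (not_le.2 hj) _)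
  have hkm : ∀ l j, Measurable (k l j) := fun l j => measurable_const.indicator measurableSet_Ici
  have hstep : ∀ z ∈ Set.Icc (fun _ => 0) e,
      ∑ l ∈ Finset.Icc (fun _ => 1) (fun j => ⌊(n j : ℝ) * z j⌋₊), ε l =
        ∑ l ∈ Finset.Icc (fun _ => 1) m, ε l * ∏ j, k l j (z j) := by
    intro z hz
    simp_rw [hk, mul_ite, mul_one, mul_zero]
    rw [← Finset.sum_filter]
    refine Finset.sum_congr ?_ fun _ _ => rfl
    ext l
    have hiff : ∀ j, l j ≤ ⌊(n j : ℝ) * z j⌋₊ ↔ (l j : ℝ) / n j ≤ z j := by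
      intro j
      rw [Nat.le_floor_iff (mul_nonneg (hn0 j).le (hz.1 j)), div_le_iff₀' (hn0 j)]
    simp only [Finset.mem_Icc, Finset.mem_filter, Pi.le_def, hiff]
    refine ⟨fun h => ⟨⟨h.1, fun j => ?_⟩, h.2⟩, fun h => ⟨h.1.1, h.2⟩⟩
    have := (h.2 j).trans (hz.2 j)
    rw [he j, div_le_div_iff_of_pos_right (hn0 j)] at this
    exact_mod_cast this
  rw [sheetIntegral_congr he0 hstep, sheetIntegral_finset_sum _ hH he0]
  · refine Finset.sum_congr rfl fun l hl => ?_
    rw [sheetIntegral_const_mul, sheetIntegral_prod]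
    congr 1
    refine Finset.prod_congr rfl fun j _ => ?_
    have hlj : (l j : ℝ) / n j ≤ e j := by
      rw [he j, div_le_div_iff_of_pos_right (hn0 j)]
      exact_mod_cast (Finset.mem_Icc.1 hl).2 j
    have hl0 : (0 : ℝ) ≤ (l j : ℝ) / n j := by positivity
    have h1 : k l j (e j) = 1 := Set.indicator_of_mem hlj _
    have h2 : ∀ t, H j t * k l j t = (Set.Ici ((l j : ℝ) / n j)).indicator (H j) t := by
      intro t
      by_cases ht : t ∈ Set.Ici ((l j : ℝ) / n j) <;> simp [k, ht]
    have h3 : Set.Icc 0 (e j) ∩ Set.Ici ((l j : ℝ) / n j) = Set.Icc ((l j : ℝ) / n j) (e j) := by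
      ext t
      simp only [Set.mem_inter_iff, Set.mem_Icc, Set.mem_Ici]
      exact ⟨fun h => ⟨h.2, h.1.2⟩, fun h => ⟨⟨hl0.trans h.1, h.2⟩, h.1⟩⟩
    simp_rw [h2]
    rw [setIntegral_indicator measurableSet_Ici, h3, h1, integral_Icc_eq_integral_Ioc,
      ← intervalIntegral.integral_of_le hlj,
      intervalIntegral.integral_eq_sub_of_hasDerivAt (fun x _ => hG j x)
        ((hH j).intervalIntegrable _ _)]
    ring
  · intro l _
    exact (Finset.measurable_prod _ fun j _ => (hkm l j).comp (measurable_pi_apply j)).const_mul _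
  · intro l _
    refine ⟨|ε l|, fun z _ => ?_⟩
    rw [hk, abs_mul]
    split_ifs <;> simp

end LatticeSum

/-! ### Riemann sums -/

theorem abs_sincKernel_le {w : ℝ} (hw : 0 < w) (x : ℝ) : |sincKernel w x| ≤ w / Real.pi := by
  rw [sincKernel_eq, abs_mul, abs_of_pos (div_pos hw Real.pi_pos)]
  exact mul_le_of_le_one_right (div_pos hw Real.pi_pos).le
    (abs_le.2 ⟨Real.neg_one_le_sinc _, Real.sinc_le_one _⟩)

theorem abs_reconKernel_le {w : Fin 3 → ℝ} (hw : ∀ j, 0 < w j) (x : Fin 3 → ℝ) :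
    |reconKernel w x| ≤ ∏ j, w j / Real.pi := by
  rw [reconKernel, Finset.abs_prod]
  exact Finset.prod_le_prod (fun _ _ => abs_nonneg _) fun j _ => abs_sincKernel_le (hw j) _

/-- The integrand is constant on the cells `∏ ((l j - 1) h j, l j h j]`, which fill the box up to a
null set. Thus a lattice sum becomes an integral to which dominated convergence applies. -/
theorem setIntegral_Icc_ceil {ι : Type*} [Fintype ι] [DecidableEq ι] {h : ι → ℝ}
    (hh : ∀ j, 0 < h j) (g : (ι → ℕ) → ℝ) (M : ι → ℕ) :
    ∫ z in Set.Icc (fun _ => 0) (fun j => M j * h j), g (fun j => ⌈z j / h j⌉₊) =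
      (∏ j, h j) * ∑ l ∈ Finset.Icc (fun _ => 1) M, g l := by
  classical
  set cell : (ι → ℕ) → Set (ι → ℝ) := fun l =>
    Set.univ.pi fun j => Set.Ioc (((l j : ℝ) - 1) * h j) (l j * h j) with hcell
  have hmeas : ∀ l, MeasurableSet (cell l) := fun l =>
    MeasurableSet.univ_pi fun j => measurableSet_Ioc
  have hae : (Set.univ.pi fun j => Set.Ioc 0 (M j * h j)) =ᵐ[volume]
      Set.Icc (fun _ => 0) (fun j => M j * h j) :=
    Measure.univ_pi_Ioc_ae_eq_Icc (μ := fun _ : ι => (volume : Measure ℝ))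
  have hmem : ∀ (t : ℝ) (k : ℕ) (j : ι), 1 ≤ k →
      (t ∈ Set.Ioc (((k : ℝ) - 1) * h j) (k * h j) ↔ k = ⌈t / h j⌉₊) := by
    intro t k j hk
    rw [eq_comm, Nat.ceil_eq_iff (by omega), Set.mem_Ioc, lt_div_iff₀ (hh j), div_le_iff₀ (hh j),
      Nat.cast_sub hk, Nat.cast_one]
  rw [← setIntegral_congr_set hae,
    ← integral_indicator (MeasurableSet.univ_pi fun j => measurableSet_Ioc)]
  have hpt : ∀ z, (Set.univ.pi fun j => Set.Ioc 0 (M j * h j)).indicator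
      (fun z => g (fun j => ⌈z j / h j⌉₊)) z =
      ∑ l ∈ Finset.Icc (fun _ => 1) M, (cell l).indicator (fun _ => g l) z := by
    intro z
    have hcz : ∀ l ∈ Finset.Icc (fun _ => 1) M, z ∈ cell l ↔ l = fun j => ⌈z j / h j⌉₊ := by
      intro l hl
      simp only [hcell, Set.mem_univ_pi, funext_iff]
      exact forall_congr' fun j => hmem _ _ _ ((Finset.mem_Icc.1 hl).1 j)
    have hsum : ∀ l ∈ Finset.Icc (fun _ => 1) M, (cell l).indicator (fun _ => g l) z =
        if l = (fun j => ⌈z j / h j⌉₊) then g l else 0 := by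
      intro l hl
      rw [Set.indicator_apply]
      exact if_congr (hcz l hl) rfl rfl
    rw [Finset.sum_congr rfl hsum, Finset.sum_ite_eq', Set.indicator_apply]
    refine if_congr ?_ rfl rfl
    simp only [Set.mem_univ_pi, Set.mem_Ioc, Finset.mem_Icc, Pi.le_def, ← forall_and]
    refine forall_congr' fun j => ?_
    rw [Nat.one_le_ceil_iff, Nat.ceil_le, div_le_iff₀ (hh j)]
    exact and_congr_left fun _ => (div_pos_iff_of_pos_right (hh j)).symm
  simp_rw [hpt]
  have hvol : ∀ l, volume.real (cell l) = ∏ j, h j := by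
    intro l
    rw [hcell, measureReal_def, Real.volume_pi_Ioc_toReal]
    · exact Finset.prod_congr rfl fun j _ => by ring
    · intro j
      have := hh j
      nlinarith
  rw [integral_finsetSum, Finset.mul_sum]
  · refine Finset.sum_congr rfl fun l _ => ?_
    rw [integral_indicator (hmeas l), setIntegral_const, hvol, smul_eq_mul]
  · intro l _
    refine (integrable_indicator_iff (hmeas l)).2 (integrableOn_const ?_)
    rw [hcell, Real.volume_pi_Ioc]
    exact ENNReal.prod_ne_top fun _ _ => ENNReal.ofReal_ne_top

theorem tendsto_floor_mul_div {α : Type*} {𝓕 : Filter α} {N : α → ℕ} (hN : Tendsto N 𝓕 atTop)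
    {s' : α → ℝ} {s : ℝ} (hs' : ∀ i, 0 ≤ s' i) (hs : Tendsto s' 𝓕 (𝓝 s)) :
    Tendsto (fun i => (⌊(N i : ℝ) * s' i⌋₊ : ℝ) / N i) 𝓕 (𝓝 s) := by
  have hinv : Tendsto (fun i => (1 : ℝ) / N i) 𝓕 (𝓝 0) :=
    (tendsto_one_div_atTop_nhds_zero_nat (𝕜 := ℝ)).comp hN
  have hpos : ∀ᶠ i in 𝓕, 0 < N i := hN.eventually (eventually_gt_atTop 0)
  refine tendsto_of_tendsto_of_tendsto_of_le_of_le' (g := fun i => s' i - 1 / N i) (h := s') ?_ hs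
    ?_ ?_
  · simpa using hs.sub hinv
  · filter_upwards [hpos] with i hi
    have hi' : (0 : ℝ) < N i := by exact_mod_cast hi
    rw [le_div_iff₀ hi', sub_mul, one_div, inv_mul_cancel₀ hi'.ne']
    have := (Nat.lt_floor_add_one ((N i : ℝ) * s' i)).le
    linarith
  · filter_upwards [hpos] with i hi
    have hi' : (0 : ℝ) < N i := by exact_mod_cast hi
    rw [div_le_iff₀ hi', mul_comm (s' i)]
    exact Nat.floor_le (mul_nonneg hi'.le (hs' i))

/-- The sum is the integral of a step function on cells of side `τbar j / N j`, evaluated at the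
true sampling points `l j * τ j`. Choosing the cells from `τbar` makes them fit the fixed box
exactly even if `N j * τ j ≠ τbar j`. -/
theorem tendsto_driftSum {α : Type*} {𝓕 : Filter α} [𝓕.IsCountablyGenerated]
    {w : Fin 3 → ℝ} (hw : ∀ j, 0 < w j) {τbar : Fin 3 → ℝ} (hτbar : ∀ j, 0 < τbar j)
    {N : α → Fin 3 → ℕ} (hN : ∀ j, Tendsto (fun i => N i j) 𝓕 atTop)
    {τ : α → Fin 3 → ℝ} (hτ : ∀ j, Tendsto (fun i => N i j * τ i j) 𝓕 (𝓝 (τbar j)))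
    {δ : (Fin 3 → ℝ) → ℝ} (hδ : ∀ᵐ z, z ∈ Set.Icc (fun _ => 0) τbar → ContinuousAt δ z)
    {C : ℝ} (hC : ∀ᶠ i in 𝓕, ∀ k : Fin 3 → ℕ, (∀ j, k j ≤ N i j) → |δ (fun j => k j * τ i j)| ≤ C)
    {s' : α → ℝ} {s : ℝ} (hs' : ∀ i, s' i ∈ Set.Icc (0 : ℝ) 1) (hs1 : s ≤ 1)
    (hs : Tendsto s' 𝓕 (𝓝 s))
    {x' : α → Fin 3 → ℝ} {x : Fin 3 → ℝ} (hx : Tendsto x' 𝓕 (𝓝 x)) :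
    Tendsto (fun i => (∏ j, τbar j / N i j) *
        ∑ l ∈ Finset.Icc (fun _ => 1) ![⌊(N i 0 : ℝ) * s' i⌋₊, N i 1, N i 2],
          reconKernel w (fun j => x' i j - l j * τ i j) * δ (fun j => l j * τ i j)) 𝓕
      (𝓝 (∫ z in Set.Icc (fun _ => 0) ![s * τbar 0, τbar 1, τbar 2],
        reconKernel w (fun j => x j - z j) * δ z)) := by
  have hpos : ∀ᶠ i in 𝓕, ∀ j, 0 < N i j :=
    eventually_all.2 fun j => (hN j).eventually (eventually_gt_atTop 0)
  set M : α → Fin 3 → ℕ := fun i => ![⌊(N i 0 : ℝ) * s' i⌋₊, N i 1, N i 2] with hM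
  -- `r i z` is the sampling point attached to the cell of `z`; it tends to `z`.
  set r : α → (Fin 3 → ℝ) → Fin 3 → ℝ := fun i z j => ⌈z j / (τbar j / N i j)⌉₊ * τ i j with hr
  have hMN : ∀ i j, M i j ≤ N i j := by
    intro i j
    fin_cases j
    · refine Nat.floor_le_of_le ?_
      exact mul_le_of_le_one_right (Nat.cast_nonneg _) (hs' i).2
    · exact le_rfl
    · exact le_rfl
  have hMlim : Tendsto (fun i j => M i j * (τbar j / N i j)) 𝓕
      (𝓝 ![s * τbar 0, τbar 1, τbar 2]) := by
    have h1 : ∀ j, Tendsto (fun i => (N i j : ℝ) * (τbar j / N i j)) 𝓕 (𝓝 (τbar j)) := by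
      intro j
      refine tendsto_const_nhds.congr' (hpos.mono fun i hi => ?_)
      exact (mul_div_cancel₀ (τbar j) (by exact_mod_cast (hi j).ne' : (N i j : ℝ) ≠ 0)).symm
    refine tendsto_pi_nhds.2 fun j => ?_
    fin_cases j
    · have := (tendsto_floor_mul_div (hN 0) (fun i => (hs' i).1) hs).mul_const (τbar 0)
      refine this.congr fun i => ?_
      simp only [hM]
      show _ = (⌊(N i 0 : ℝ) * s' i⌋₊ : ℝ) * (τbar 0 / N i 0)
      ring
    · exact h1 1
    · exact h1 2
  have hkey := tendsto_setIntegral_Icc (𝓕 := 𝓕) (a := fun _ => 0) (E := τbar)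
    (e' := fun i j => M i j * (τbar j / N i j)) (e := ![s * τbar 0, τbar 1, τbar 2])
    (f := fun i z => reconKernel w (fun j => x' i j - r i z j) * δ (r i z))
    (g := fun z => reconKernel w (fun j => x j - z j) * δ z)
    (C := (∏ j, w j / Real.pi) * C) hMlim ?_ ?_ ?_ ?_ ?_
  · refine hkey.congr' (hpos.mono fun i hi => ?_)
    exact setIntegral_Icc_ceil (fun j => div_pos (hτbar j) (by exact_mod_cast hi j))
      (fun l => reconKernel w (fun j => x' i j - l j * τ i j) * δ (fun j => l j * τ i j)) (M i)
  · filter_upwards [hpos] with i hi j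
    have : (0 : ℝ) < N i j := by exact_mod_cast hi j
    have h2 : (M i j : ℝ) ≤ N i j := by exact_mod_cast hMN i j
    calc (M i j : ℝ) * (τbar j / N i j) ≤ N i j * (τbar j / N i j) :=
          mul_le_mul_of_nonneg_right h2 (div_pos (hτbar j) this).le
      _ = τbar j := mul_div_cancel₀ _ this.ne'
  · intro j
    fin_cases j
    · exact mul_le_of_le_one_left (hτbar 0).le hs1
    · exact le_rfl
    · exact le_rfl
  · refine Eventually.of_forall fun i => Measurable.aestronglyMeasurable ?_
    have h1 : Measurable fun (z : Fin 3 → ℝ) (j : Fin 3) => ⌈z j / (τbar j / N i j)⌉₊ :=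
      measurable_pi_lambda _ fun j => Nat.measurable_ceil.comp
        ((measurable_pi_apply j).div_const _)
    exact (measurable_of_countable fun l : Fin 3 → ℕ =>
      reconKernel w (fun j => x' i j - l j * τ i j) * δ (fun j => l j * τ i j)).comp h1
  · filter_upwards [hC, hpos] with i hi hip z hz
    rw [abs_mul]
    refine mul_le_mul (abs_reconKernel_le hw _) (hi _ fun j => ?_) (abs_nonneg _)
      (Finset.prod_nonneg fun j _ => (div_pos (hw j) Real.pi_pos).le)
    have hNp : (0 : ℝ) < N i j := by exact_mod_cast hip j
    rw [Nat.ceil_le, div_le_iff₀ (div_pos (hτbar j) hNp), mul_div_cancel₀ _ hNp.ne']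
    exact hz.2 j
  · filter_upwards [hδ] with z hz hzK
    have hrz : Tendsto (fun i => r i z) 𝓕 (𝓝 z) := by
      refine tendsto_pi_nhds.2 fun j => ?_
      have h1 : Tendsto (fun i => (⌈z j / τbar j * (N i j : ℝ)⌉₊ : ℝ) / N i j) 𝓕
          (𝓝 (z j / τbar j)) :=
        (tendsto_nat_ceil_mul_div_atTop (div_nonneg (hzK.1 j) (hτbar j).le)).comp
          (tendsto_natCast_atTop_atTop.comp (hN j))
      have h2 := h1.mul (hτ j)
      rw [div_mul_cancel₀ _ (hτbar j).ne'] at h2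
      refine h2.congr' (hpos.mono fun i hi => ?_)
      have hNp : (N i j : ℝ) ≠ 0 := by exact_mod_cast (hi j).ne'
      have : z j / (τbar j / N i j) = z j / τbar j * N i j := by rw [div_div_eq_mul_div]; ring
      rw [hr]
      simp only [this]
      field_simp
    refine Tendsto.mul ?_ ((hz hzK).tendsto.comp hrz)
    exact ((continuous_reconKernel w).tendsto _).comp (tendsto_pi_nhds.2 fun j =>
      ((tendsto_pi_nhds.1 hx) j).sub ((tendsto_pi_nhds.1 hrz) j))

/-! ### Functions of bounded variation in the sense of Hardy and Krause -/

theorem AntitoneOn.exists_abs_le {α : Type*} [Preorder α] {h : α → ℝ} {a b : α}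
    (hh : AntitoneOn h (Set.Icc a b)) : ∃ C, ∀ x ∈ Set.Icc a b, |h x| ≤ C := by
  refine ⟨|h a| + |h b|, fun x hx => ?_⟩
  have hab : a ≤ b := hx.1.trans hx.2
  have h1 := hh (Set.left_mem_Icc.2 hab) hx hx.1
  have h2 := hh hx (Set.right_mem_Icc.2 hab) hx.2
  rw [abs_le]
  constructor
  · have := neg_abs_le (h b)
    have := abs_nonneg (h a)
    linarith
  · have := le_abs_self (h a)
    have := abs_nonneg (h b)
    linarith

section BoundedVariation

variable {ι : Type*} [Fintype ι]

/-- Superlevel sets are upper sets, which have null frontier. A point outside the frontiers of all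
rational superlevel sets is a continuity point. -/
theorem Monotone.ae_continuousAt {F : (ι → ℝ) → ℝ} (hF : Monotone F) :
    ∀ᵐ z, ContinuousAt F z := by
  have hup : ∀ q : ℚ, IsUpperSet {z | (q : ℝ) ≤ F z} := fun q x y hxy hx =>
    le_trans (show (q : ℝ) ≤ F x from hx) (hF hxy)
  have hnull : ∀ᵐ z : ι → ℝ, ∀ q : ℚ, z ∉ frontier {z | (q : ℝ) ≤ F z} :=
    ae_all_iff.2 fun q => measure_eq_zero_iff_ae_notMem.1 (hup q).null_frontier
  filter_upwards [hnull] with z hz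
  rw [ContinuousAt, tendsto_order]
  constructor
  · intro a ha
    obtain ⟨q, hq1, hq2⟩ := exists_rat_btwn ha
    have hint : z ∈ interior {z | (q : ℝ) ≤ F z} := by
      by_contra h
      exact hz q ⟨subset_closure hq2.le, h⟩
    filter_upwards [mem_interior_iff_mem_nhds.1 hint] with y hy
    exact hq1.trans_le hy
  · intro a ha
    obtain ⟨q, hq1, hq2⟩ := exists_rat_btwn ha
    have hcl : z ∉ closure {z | (q : ℝ) ≤ F z} := by
      refine fun h => hz q ⟨h, fun hi => ?_⟩
      have h' : z ∈ {z | (q : ℝ) ≤ F z} := interior_subset hi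
      exact absurd h' (not_le.2 hq1)
    filter_upwards [isClosed_closure.isOpen_compl.mem_nhds hcl] with y hy
    have : ¬ (q : ℝ) ≤ F y := fun h => hy (subset_closure h)
    exact (not_le.1 this).trans hq2

theorem Antitone.ae_continuousAt {F : (ι → ℝ) → ℝ} (hF : Antitone F) :
    ∀ᵐ z, ContinuousAt F z := by
  filter_upwards [hF.neg.ae_continuousAt] with z hz
  exact (neg_neg F) ▸ hz.neg

/-- The projection of `ι → ℝ` onto the box `[a, b]`. -/
def clampBox (a b x : ι → ℝ) : ι → ℝ := fun j => max (a j) (min (b j) (x j))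

omit [Fintype ι] in
theorem clampBox_mem {a b : ι → ℝ} (hab : a ≤ b) (x : ι → ℝ) : clampBox a b x ∈ Set.Icc a b :=
  ⟨fun _ => le_max_left _ _, fun j => max_le (hab j) (min_le_left _ _)⟩

omit [Fintype ι] in
theorem clampBox_of_mem {a b x : ι → ℝ} (hx : x ∈ Set.Icc a b) : clampBox a b x = x :=
  funext fun j => by
    have h1 := hx.1 j
    have h2 := hx.2 j
    simp only [clampBox]
    rw [min_eq_right h2, max_eq_right h1]

omit [Fintype ι] in
theorem clampBox_mono (a b : ι → ℝ) : Monotone (clampBox a b) := fun _ _ h j =>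
  max_le_max le_rfl (min_le_min le_rfl (h j))

theorem ae_mem_Icc_mem_nhds (a b : ι → ℝ) :
    ∀ᵐ z : ι → ℝ, z ∈ Set.Icc a b → Set.Icc a b ∈ 𝓝 z := by
  filter_upwards [ae_forall_ne a, ae_forall_ne b] with z ha hb hz
  rw [← Set.pi_univ_Icc]
  exact set_pi_mem_nhds Set.finite_univ fun j _ =>
    Icc_mem_nhds (lt_of_le_of_ne (hz.1 j) (ha j).symm) (lt_of_le_of_ne (hz.2 j) (hb j))

variable [DecidableEq ι]

/-- A ladder on `[x', b]` becomes one on `[x, b]` by adding the coordinates of `x`. Its old cells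
persist, and the increments over the new cells add up to the difference of the two block increments.
-/
theorem vitaliVariation_add_le (f : (ι → ℝ) → ℝ) {x x' b : ι → ℝ} (hxx : x ≤ x') (hxb : x' ≤ b) :
    vitaliVariation f x' b + ENNReal.ofReal |altSum f x b - altSum f x' b| ≤
      vitaliVariation f x b := by
  classical
  -- In this case the old ladder contains the endpoint `b j`, which a ladder on `[x j, b j]` may
  -- not; but then the block `[x', b]` is degenerate and its variation is zero.
  by_cases hdeg : ∃ j, x' j = b j ∧ x j ≠ b j
  · obtain ⟨j, hj, hjx⟩ := hdeg
    have h0 : vitaliVariation f x' b = 0 := by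
      refine le_antisymm (iSup₂_le fun Y hY => ?_) bot_le
      rw [Finset.sum_eq_zero]
      intro y hy
      have hYj := hY j
      rw [hj] at hYj
      have hyj : y j = b j := by
        have := Fintype.mem_piFinset.1 hy j
        rwa [hYj.eq_singleton, Finset.mem_singleton] at this
      rw [altSum_eq_zero_of_eq (j := j), abs_zero, ENNReal.ofReal_zero]
      rw [ladderSuccPi, hyj, hYj.eq_singleton]
      simp [ladderSucc]
    rw [h0, altSum_eq_zero_of_eq (a := x') hj, zero_add, sub_zero]
    have hY : ∀ j, IsLadder ({x j} : Finset ℝ) (x j) (b j) := fun j => ⟨by simp, by simp⟩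
    refine le_trans ?_ (le_iSup₂ (fun j => {x j}) hY)
    rw [← sum_altSum_ladder f hY]
    rw [← ENNReal.ofReal_sum_of_nonneg fun _ _ => abs_nonneg _]
    exact ENNReal.ofReal_le_ofReal (Finset.abs_sum_le_sum_abs _ _)
  · push Not at hdeg
    rw [vitaliVariation, ENNReal.biSup_add' ⟨fun j => {x' j}, fun j => ⟨by simp, by simp⟩⟩]
    refine iSup₂_le fun Y hY => ?_
    set Y' : ι → Finset ℝ := fun j => insert (x j) (Y j) with hY'
    have hlad : ∀ j, IsLadder (Y' j) (x j) (b j) := by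
      intro j
      refine ⟨Finset.mem_insert_self _ _, fun y hy => ?_⟩
      rcases Finset.mem_insert.1 hy with h | h
      · exact Or.inl h
      · rcases (hY j).2 y h with h' | h'
        · rcases (hxx j).eq_or_lt with he | hlt
          · exact Or.inl (h'.trans he.symm)
          · refine Or.inr ⟨h' ▸ hlt, h' ▸ lt_of_le_of_ne (hxb j) fun hc => ?_⟩
            exact absurd ((hdeg j hc).trans hc.symm) hlt.ne
        · exact Or.inr ⟨(hxx j).trans_lt h'.1, h'.2⟩
    have hsub : Fintype.piFinset Y ⊆ Fintype.piFinset Y' :=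
      Fintype.piFinset_subset _ _ fun j => Finset.subset_insert _ _
    have hsucc : ∀ y ∈ Fintype.piFinset Y, ladderSuccPi Y' b y = ladderSuccPi Y b y := by
      intro y hy
      funext j
      have hxy : ¬ y j < x j := not_lt.2
        ((hxx j).trans ((hY j).left_le (Fintype.mem_piFinset.1 hy j)))
      have : (Y' j).filter (fun z => y j < z) = (Y j).filter (fun z => y j < z) := by
        rw [hY', Finset.filter_insert, if_neg hxy]
      simp only [ladderSuccPi, ladderSucc, this]
    refine le_trans ?_ (le_iSup₂ Y' hlad)
    rw [← Finset.sum_sdiff hsub, add_comm]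
    refine add_le_add ?_ (le_of_eq (Finset.sum_congr rfl fun y hy => by rw [hsucc y hy]))
    have hsum : ∑ y ∈ Fintype.piFinset Y, altSum f y (ladderSuccPi Y b y) =
        ∑ y ∈ Fintype.piFinset Y, altSum f y (ladderSuccPi Y' b y) :=
      Finset.sum_congr rfl fun y hy => by rw [hsucc y hy]
    rw [← sum_altSum_ladder f hY, ← sum_altSum_ladder f hlad, ← Finset.sum_sdiff hsub, hsum,
      add_sub_cancel_right,
      ← ENNReal.ofReal_sum_of_nonneg fun _ _ => abs_nonneg _]
    exact ENNReal.ofReal_le_ofReal (Finset.abs_sum_le_sum_abs _ _)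

/-- The anchored decomposition at `b`: for products of point indicators it is the expansion of `∏ (β
- (β - ξ))`, with `β` and `ξ` the factors at `b` and at `x`. The general case follows by linearity.
-/
theorem eq_sum_altSum_glue (f : (ι → ℝ) → ℝ) (x b : ι → ℝ) :
    f x = ∑ u : Finset ι, (-1 : ℝ) ^ u.card *
      altSum (fun y : {j // j ∈ u} → ℝ => f (glue u y b)) (fun j => x j) (fun j => b j) := by
  classical
  set G : ι → Finset ℝ := fun j => {x j, b j}
  have hx : x ∈ Fintype.piFinset G := Fintype.mem_piFinset.2 fun j => by simp [G]
  have hglue : ∀ (u : Finset ι) (v : Finset {j // j ∈ u}),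
      glue u (v.piecewise (fun j => x j) (fun j => b j)) b ∈ Fintype.piFinset G := by
    refine fun u v => Fintype.mem_piFinset.2 fun j => ?_
    by_cases hj : j ∈ u
    · by_cases hv : (⟨j, hj⟩ : {j // j ∈ u}) ∈ v <;> simp [glue, hj, Finset.piecewise, hv, G]
    · simp [glue, hj, G]
  have hu : ∀ u : Finset ι,
      altSum (fun y : {j // j ∈ u} → ℝ => f (glue u y b)) (fun j => x j) (fun j => b j) =
      ∑ p ∈ Fintype.piFinset G, f p * ((∏ j ∈ uᶜ, if b j = p j then (1 : ℝ) else 0) *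
        ∏ j ∈ u, ((if b j = p j then (1 : ℝ) else 0) - if x j = p j then 1 else 0)) := by
    intro u
    rw [altSum_congr (g := fun y => ∑ p ∈ Fintype.piFinset G, (f p *
      ∏ j ∈ uᶜ, if b j = p j then (1 : ℝ) else 0) *
      ∏ j : {j // j ∈ u}, if y j = p j then (1 : ℝ) else 0), altSum_sum]
    · refine Finset.sum_congr rfl fun p _ => ?_
      rw [← mul_assoc, ← Finset.prod_coe_sort u]
      exact altSum_prod _ (fun (j : {j // j ∈ u}) t => if t = p j then (1 : ℝ) else 0) _ _
    · intro v
      rw [← sum_mul_prod_ite_eq f (hglue u v)]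
      refine Finset.sum_congr rfl fun p _ => ?_
      rw [prod_glue (fun j t => if t = p j then (1 : ℝ) else 0), mul_assoc]
  simp_rw [hu, Finset.mul_sum]
  rw [Finset.sum_comm, ← sum_mul_prod_ite_eq f hx]
  refine Finset.sum_congr rfl fun p _ => ?_
  have := Finset.prod_sub (fun j => if b j = p j then (1 : ℝ) else 0)
    (fun j => (if b j = p j then (1 : ℝ) else 0) - if x j = p j then 1 else 0) Finset.univ
  simp only [sub_sub_cancel, Finset.powerset_univ] at this
  rw [this, Finset.mul_sum]
  refine Finset.sum_congr rfl fun u _ => ?_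
  rw [Finset.compl_eq_univ_sdiff]
  ring

/-- A Jordan decomposition of each anchored increment `D`: the variation `V` and `V - D` both
decrease in the lower corner `x`, by `vitaliVariation_add_le`. -/
theorem IsBVHK.exists_antitoneOn {f : (ι → ℝ) → ℝ} {a b : ι → ℝ} (hf : IsBVHK f a b) :
    ∃ (c : ℝ) (P Q : Finset ι → (ι → ℝ) → ℝ), (∀ u, AntitoneOn (P u) (Set.Icc a b)) ∧
      (∀ u, AntitoneOn (Q u) (Set.Icc a b)) ∧
      ∀ x, f x = c + ∑ u : Finset ι, (-1 : ℝ) ^ u.card * (P u x - Q u x) := by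
  classical
  set V : Finset ι → (ι → ℝ) → ℝ≥0∞ := fun u x =>
    vitaliVariation (fun y : {j // j ∈ u} → ℝ => f (glue u y b)) (fun j => x j) (fun j => b j)
  set D : Finset ι → (ι → ℝ) → ℝ := fun u x =>
    altSum (fun y : {j // j ∈ u} → ℝ => f (glue u y b)) (fun j => x j) (fun j => b j)
  have hstep : ∀ u x x', x ≤ x' → x' ≤ b →
      V u x' + ENNReal.ofReal |D u x - D u x'| ≤ V u x := fun u x x' h1 h2 =>
    vitaliVariation_add_le _ (fun j => h1 j) (fun j => h2 j)
  have hfin : ∀ u : Finset ι, u.Nonempty → V u a < ⊤ := fun u hu =>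
    (Finset.single_le_sum (f := fun u => V u a) (fun _ _ => zero_le)
      (Finset.mem_filter.2 ⟨Finset.mem_univ u, hu⟩)).trans_lt hf
  have hreal : ∀ u : Finset ι, u.Nonempty → ∀ x ∈ Set.Icc a b, ∀ x' ∈ Set.Icc a b, x ≤ x' →
      (V u x').toReal + |D u x - D u x'| ≤ (V u x).toReal := by
    intro u hu x hx x' hx' hxx
    have h1 : V u x < ⊤ := (le_self_add.trans (hstep u a x hx.1 hx.2)).trans_lt (hfin u hu)
    have h2 := ENNReal.toReal_mono h1.ne (hstep u x x' hxx hx'.2)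
    rwa [ENNReal.toReal_add ((le_self_add.trans (hstep u x x' hxx hx'.2)).trans_lt h1).ne
      ENNReal.ofReal_ne_top, ENNReal.toReal_ofReal (abs_nonneg _)] at h2
  -- The empty set is treated separately: its increment is the constant `f b`, and its Vitali
  -- variation is not part of the Hardy-Krause sum.
  refine ⟨f b, fun u x => if u.Nonempty then (V u x).toReal else 0,
    fun u x => if u.Nonempty then (V u x).toReal - D u x else 0, ?_, ?_, ?_⟩
  · intro u x hx x' hx' hxx
    by_cases hu : u.Nonempty
    · simp only [hu, if_true]
      have := hreal u hu x hx x' hx' hxx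
      have := abs_nonneg (D u x - D u x')
      linarith
    · simp [hu]
  · intro u x hx x' hx' hxx
    by_cases hu : u.Nonempty
    · simp only [hu, if_true]
      have := hreal u hu x hx x' hx' hxx
      have := le_abs_self (D u x - D u x')
      linarith
    · simp [hu]
  · intro x
    have hempty : D ∅ x = f b := by
      have : ∀ y, glue (∅ : Finset ι) y b = b := fun y => by
        funext j
        simp [glue]
      simp only [D, altSum, this]
      rw [Finset.univ_unique, Finset.sum_singleton,
        Subsingleton.elim (default : Finset {j // j ∈ (∅ : Finset ι)}) ∅]
      simp
    rw [eq_sum_altSum_glue f x b, ← Finset.add_sum_erase _ _ (Finset.mem_univ (∅ : Finset ι)),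
      ← Finset.add_sum_erase (Finset.univ : Finset (Finset ι)) (fun u => (-1 : ℝ) ^ u.card *
        ((if u.Nonempty then (V u x).toReal else 0) -
          if u.Nonempty then (V u x).toReal - D u x else 0)) (Finset.mem_univ (∅ : Finset ι))]
    have h0 : altSum (fun y : {j // j ∈ (∅ : Finset ι)} → ℝ => f (glue ∅ y b)) (fun j => x j)
        (fun j => b j) = f b := hempty
    rw [h0]
    simp only [Finset.card_empty, pow_zero, one_mul, Finset.not_nonempty_empty, if_false, sub_zero,
      zero_add]
    congr 1
    refine Finset.sum_congr rfl fun u hu => ?_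
    have : u.Nonempty := Finset.nonempty_iff_ne_empty.2 (Finset.ne_of_mem_erase hu)
    simp only [this, if_true, sub_sub_cancel]
    rfl

theorem IsBVHK.exists_abs_le {f : (ι → ℝ) → ℝ} {a b : ι → ℝ} (hf : IsBVHK f a b) :
    ∃ C, ∀ x ∈ Set.Icc a b, |f x| ≤ C := by
  obtain ⟨c, P, Q, hP, hQ, h⟩ := hf.exists_antitoneOn
  choose CP hCP using fun u => (hP u).exists_abs_le
  choose CQ hCQ using fun u => (hQ u).exists_abs_le
  refine ⟨|c| + ∑ u, (CP u + CQ u), fun x hx => ?_⟩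
  rw [h]
  refine (abs_add_le _ _).trans (add_le_add le_rfl ((Finset.abs_sum_le_sum_abs _ _).trans
    (Finset.sum_le_sum fun u _ => ?_)))
  rw [abs_mul, abs_pow, abs_neg, abs_one, one_pow, one_mul]
  exact (abs_sub _ _).trans (add_le_add (hCP u x hx) (hCQ u x hx))

/-- Composing with the projection onto the box makes the antitone components globally antitone. Near
interior points the projection is the identity, and the boundary is null. -/
theorem IsBVHK.ae_continuousAt {f : (ι → ℝ) → ℝ} {a b : ι → ℝ} (hab : a ≤ b)
    (hf : IsBVHK f a b) : ∀ᵐ z, z ∈ Set.Icc a b → ContinuousAt f z := by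
  obtain ⟨c, P, Q, hP, hQ, h⟩ := hf.exists_antitoneOn
  have hcl : ∀ g : (ι → ℝ) → ℝ, AntitoneOn g (Set.Icc a b) →
      ∀ᵐ z, ContinuousAt (fun x => g (clampBox a b x)) z := fun g hg =>
    Antitone.ae_continuousAt fun x y hxy =>
      hg (clampBox_mem hab x) (clampBox_mem hab y) (clampBox_mono a b hxy)
  filter_upwards [ae_mem_Icc_mem_nhds a b, ae_all_iff.2 fun u => hcl _ (hP u),
    ae_all_iff.2 fun u => hcl _ (hQ u)] with z hz hzP hzQ hzK
  have hcont : ContinuousAt (fun x => f (clampBox a b x)) z := by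
    simp_rw [h]
    exact continuousAt_const.add (tendsto_finsetSum _ fun u _ =>
      ((hzP u).sub (hzQ u)).const_mul _)
  refine hcont.congr ?_
  filter_upwards [hz hzK] with y hy
  rw [clampBox_of_mem hy]

end BoundedVariation

/-! ### The Brownian sheet as a Gaussian process -/

theorem IsLadder.filter_lt {Y : Finset ℝ} {a b t : ℝ} (hY : IsLadder Y a b) (hat : a < t) :
    IsLadder (Y.filter (fun y => y < t)) a t := by
  refine ⟨Finset.mem_filter.2 ⟨hY.1, hat⟩, fun y hy => ?_⟩
  obtain ⟨hy, hyt⟩ := Finset.mem_filter.1 hy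
  exact (hY.2 y hy).imp id fun h => ⟨h.1, hyt⟩

theorem ladderSucc_filter_lt {Y : Finset ℝ} {b t y : ℝ} (hYb : ∀ z ∈ Y, z < b)
    (ht : t ∈ Y ∨ t = b) (hyt : y < t) :
    ladderSucc (Y.filter (fun z => z < t)) t y = ladderSucc Y b y := by
  rcases ht with ht | rfl
  · have hne : (Y.filter (fun z => y < z)).Nonempty := ⟨t, Finset.mem_filter.2 ⟨ht, hyt⟩⟩
    rw [ladderSucc, ladderSucc, dif_pos hne]
    split_ifs with h
    · have hmem := Finset.min'_mem _ h
      simp only [Finset.mem_filter] at hmem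
      refine le_antisymm (Finset.le_min' _ _ _ fun z hz => ?_) (Finset.min'_le _ _ ?_)
      · rw [Finset.mem_filter] at hz
        rcases lt_or_ge z t with hzt | hzt
        · exact Finset.min'_le _ _ (by simp [hz.1, hz.2, hzt])
        · exact hmem.1.2.le.trans hzt
      · exact Finset.mem_filter.2 ⟨hmem.1.1, hmem.2⟩
    · refine le_antisymm (Finset.le_min' _ _ _ fun z hz => ?_)
        (Finset.min'_le _ _ (Finset.mem_filter.2 ⟨ht, hyt⟩))
      rw [Finset.mem_filter] at hz
      by_contra hzt
      exact h ⟨z, by simp [hz.1, hz.2, not_le.1 hzt]⟩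
  · rw [Finset.filter_true_of_mem hYb]

theorem ite_mul_ite_of_iff {p q r : Prop} [Decidable p] [Decidable q] [Decidable r]
    (h : r ↔ p ∧ q) :
    (if p then (1 : ℝ) else 0) * (if q then 1 else 0) = if r then 1 else 0 := by
  by_cases hp : p <;> by_cases hq : q <;> simp [h, hp, hq]

section Grid

variable {ι : Type*} [Fintype ι] [DecidableEq ι]

theorem altSum_of_zero_left {f : (ι → ℝ) → ℝ} (hf : ∀ z, (∃ j, z j = 0) → f z = 0) (t : ι → ℝ) :
    altSum f (fun _ => 0) t = f t := by
  rw [altSum, Finset.sum_eq_single ∅]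
  · simp
  · intro v _ hv
    obtain ⟨j, hj⟩ := Finset.nonempty_iff_ne_empty.2 hv
    rw [hf _ ⟨j, by simp [Finset.piecewise, hj]⟩, mul_zero]
  · simp

/-- Vanishing on the lower faces makes `f t` the increment over `[0, t]`, and the cells with lower
corner strictly below `t` tile that block. -/
theorem sum_ite_altSum_ladder {f : (ι → ℝ) → ℝ} (hf : ∀ z, (∃ j, z j = 0) → f z = 0)
    {Y : ι → Finset ℝ} (hY : ∀ j, IsLadder (Y j) 0 1) {t : ι → ℝ} (ht0 : ∀ j, 0 ≤ t j)
    (ht : ∀ j, t j ∈ Y j ∨ t j = 1) :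
    ∑ y ∈ Fintype.piFinset Y,
      (if ∀ j, y j < t j then 1 else 0) * altSum f y (ladderSuccPi Y (fun _ => 1) y) = f t := by
  classical
  simp_rw [ite_mul, one_mul, zero_mul]
  rw [← Finset.sum_filter]
  have hfil : (Fintype.piFinset Y).filter (fun y => ∀ j, y j < t j) =
      Fintype.piFinset fun j => (Y j).filter (fun y => y < t j) := by
    ext y
    simp only [Finset.mem_filter, Fintype.mem_piFinset, forall_and]
  rw [hfil]
  by_cases h0 : ∃ j, t j = 0
  · rw [hf t h0]
    obtain ⟨j, hj⟩ := h0
    have hemp : (Y j).filter (fun y => y < t j) = ∅ := by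
      refine Finset.filter_eq_empty_iff.2 fun y hy => not_lt.2 ?_
      rw [hj]
      exact (hY j).left_le hy
    refine Finset.sum_eq_zero fun y hy => ?_
    have := Fintype.mem_piFinset.1 hy j
    rw [hemp] at this
    exact absurd this (Finset.notMem_empty _)
  · push Not at h0
    have hpos : ∀ j, 0 < t j := fun j => lt_of_le_of_ne (ht0 j) (h0 j).symm
    have hY1 : ∀ j, ∀ z ∈ Y j, z < 1 := fun j z hz => by
      rcases (hY j).2 z hz with h | h
      · rw [h]; exact one_pos
      · exact h.2
    rw [← altSum_of_zero_left hf t, ← sum_altSum_ladder f fun j => (hY j).filter_lt (hpos j)]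
    refine Finset.sum_congr rfl fun y hy => ?_
    congr 1
    funext j
    have := Fintype.mem_piFinset.1 hy j
    exact (ladderSucc_filter_lt (hY1 j) (ht j) (Finset.mem_filter.1 this).2).symm

/-- The projection of `ι → ℝ` onto the unit cube. -/
def projCube {ι : Type*} (z : ι → ℝ) : ι → unitInterval :=
  fun j => Set.projIcc 0 1 zero_le_one (z j)

omit [Fintype ι] [DecidableEq ι] in
theorem continuous_projCube : Continuous (projCube : (ι → ℝ) → ι → unitInterval) :=
  continuous_pi fun j => continuous_projIcc.comp (continuous_apply j)

omit [Fintype ι] [DecidableEq ι] in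
theorem projCube_coe (t : ι → unitInterval) : projCube (fun j => (t j : ℝ)) = t :=
  funext fun j => Set.projIcc_val zero_le_one (t j)

omit [Fintype ι] [DecidableEq ι] in
theorem coe_projCube {z : ι → ℝ} (hz : z ∈ Set.Icc (fun _ => 0) (fun _ => 1)) (j : ι) :
    (projCube z j : ℝ) = z j := by
  rw [projCube, Set.projIcc_of_mem zero_le_one ⟨hz.1 j, hz.2 j⟩]

theorem altSum_comp_projCube (f : (ι → unitInterval) → ℝ) (a b : ι → ℝ) :
    altSum (fun z => f (projCube z)) a b = altSum f (projCube a) (projCube b) := by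
  refine Finset.sum_congr rfl fun v _ => ?_
  have : projCube (v.piecewise a b) = v.piecewise (projCube a) (projCube b) := by
    funext j
    by_cases h : j ∈ v <;> simp [projCube, Finset.piecewise, h]
  simp only [this]

end Grid

namespace IsBrownianSheet

variable {ι Ω : Type*} [Fintype ι] [DecidableEq ι] [MeasurableSpace Ω]
  {B : Ω → SkorohodSpace ι} {P : Measure Ω}

/-- One null set serves all points of the faces: it suffices to treat a dense sequence pushed onto
each face, by continuity of the path. -/
theorem ae_forall_eq_zero (hB : IsBrownianSheet B P) :
    ∀ᵐ ω ∂P, ∀ t : ι → unitInterval, (∃ j, t j = 0) → B ω t = 0 := by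
  have h1 : ∀ᵐ ω ∂P, ∀ (k : ℕ) (j : ι),
      B ω (Function.update (TopologicalSpace.denseSeq (ι → unitInterval) k) j 0) = 0 :=
    ae_all_iff.2 fun k => ae_all_iff.2 fun j => hB.ae_eq_zero _ ⟨j, by simp⟩
  filter_upwards [h1, hB.ae_continuous] with ω hω hc t ⟨j, hj⟩
  have hc' : Continuous fun t : ι → unitInterval => B ω (Function.update t j 0) :=
    hc.comp (continuous_id.update j continuous_const)
  have := congrFun (hc'.ext_on (TopologicalSpace.denseRange_denseSeq (ι → unitInterval))
    (continuous_const (y := (0 : ℝ))) (by rintro _ ⟨k, rfl⟩; exact hω k j)) t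
  simpa [← hj] using this

theorem hasGaussianLaw_increment (hB : IsBrownianSheet B P) {s t : ι → unitInterval}
    (hst : s ≤ t) : HasGaussianLaw (fun ω => altSum (B ω) s t) P :=
  ⟨by rw [hB.increment_law s t hst]; infer_instance⟩

/-- Finitely many values of a Brownian sheet are combinations of independent increments. -/
theorem exists_grid (hB : IsBrownianSheet B P) (T : Finset (ι → unitInterval)) :
    ∃ (k : ℕ) (a b : Fin k → ι → unitInterval) (c : (ι → unitInterval) → Fin k → ℝ),
      (∀ i, a i ≤ b i) ∧ iIndepFun (fun i ω => altSum (B ω) (a i) (b i)) P ∧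
      (∀ᵐ ω ∂P, ∀ t ∈ T, B ω t = ∑ i, c t i * altSum (B ω) (a i) (b i)) ∧
      ∀ s ∈ T, ∀ t ∈ T, ∑ i, c s i * c t i * ∏ j, ((b i j : ℝ) - (a i j : ℝ)) =
        ∏ j, min (s j : ℝ) (t j) := by
  classical
  -- The grid is generated by all coordinates of points of `T`; the value `1` is left out, being the
  -- right endpoint of the ladder.
  set Y : ι → Finset ℝ := fun j =>
    insert 0 ((T.image fun t => (t j : ℝ)).filter fun y => 0 < y ∧ y < 1) with hYdef
  have hY : ∀ j, IsLadder (Y j) 0 1 := fun j =>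
    ⟨Finset.mem_insert_self _ _, fun y hy => by
      rcases Finset.mem_insert.1 hy with h | h
      · exact Or.inl h
      · exact Or.inr (Finset.mem_filter.1 h).2⟩
  have hTY : ∀ t ∈ T, ∀ j, (t j : ℝ) ∈ Y j ∨ (t j : ℝ) = 1 := by
    intro t ht j
    by_cases h1 : (t j : ℝ) = 1
    · exact Or.inr h1
    · left
      by_cases h0 : (t j : ℝ) = 0
      · rw [h0]; exact Finset.mem_insert_self _ _
      · refine Finset.mem_insert_of_mem (Finset.mem_filter.2
          ⟨Finset.mem_image_of_mem (fun t => (t j : ℝ)) ht, lt_of_le_of_ne (t j).2.1 (Ne.symm h0),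
          lt_of_le_of_ne (t j).2.2 h1⟩)
  set G := Fintype.piFinset Y
  have hmem01 : ∀ y ∈ G, y ∈ Set.Icc (fun _ => 0) (fun _ => (1 : ℝ)) := fun y hy =>
    ⟨fun j => (hY j).left_le (Fintype.mem_piFinset.1 hy j),
      fun j => (hY j).le_right zero_le_one (Fintype.mem_piFinset.1 hy j)⟩
  have hsucc : ∀ y ∈ G, y ≤ ladderSuccPi Y (fun _ => 1) y := fun y hy j =>
    (hY j).le_ladderSucc zero_le_one (Fintype.mem_piFinset.1 hy j)
  have hsucc01 : ∀ y ∈ G, ladderSuccPi Y (fun _ => 1) y ∈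
      Set.Icc (fun _ => 0) (fun _ => (1 : ℝ)) := fun y hy =>
    ⟨(hmem01 y hy).1.trans (hsucc y hy), fun j => (hY j).ladderSucc_le zero_le_one _⟩
  set φ := G.equivFin
  have hsumG : ∀ F : (ι → ℝ) → ℝ, ∑ i, F (φ.symm i) = ∑ y ∈ G, F y := by
    intro F
    rw [← Finset.sum_coe_sort G]
    exact Equiv.sum_comp φ.symm fun y : G => F y
  refine ⟨G.card, fun i => projCube (φ.symm i : ι → ℝ),
    fun i => projCube (ladderSuccPi Y (fun _ => 1) (φ.symm i)),
    fun t i => if ∀ j, (φ.symm i : ι → ℝ) j < t j then 1 else 0, ?_, ?_, ?_, ?_⟩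
  · exact fun i j => Set.monotone_projIcc zero_le_one (hsucc _ (φ.symm i).2 j)
  · refine hB.indep_increments _ _ _
      (fun i j => Set.monotone_projIcc zero_le_one (hsucc _ (φ.symm i).2 j)) ?_
    intro i i' hii
    have hne : (φ.symm i : ι → ℝ) ≠ φ.symm i' := fun h => hii (φ.symm.injective (Subtype.ext h))
    obtain ⟨j, hj⟩ := Function.ne_iff.1 hne
    refine Set.disjoint_left.2 fun x hx hx' => ?_
    have key : ∀ p q : G, (p : ι → ℝ) j < (q : ι → ℝ) j →
        x j ≤ projCube (ladderSuccPi Y (fun _ => 1) p) j → projCube (q : ι → ℝ) j < x j →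
        False := by
      intro p q hpq h1 h2
      have h3 : ladderSuccPi Y (fun _ => 1) p j ≤ (q : ι → ℝ) j :=
        ladderSucc_le_of_mem (Fintype.mem_piFinset.1 q.2 j) hpq
      exact absurd (h1.trans (Set.monotone_projIcc zero_le_one h3)) (not_le.2 h2)
    rcases lt_or_gt_of_ne hj with h | h
    · exact key _ _ h (hx j trivial).2 (hx' j trivial).1
    · exact key _ _ h (hx' j trivial).2 (hx j trivial).1
  · filter_upwards [hB.ae_forall_eq_zero] with ω hω t ht
    have h := sum_ite_altSum_ladder (f := fun z => B ω (projCube z))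
      (fun z ⟨j, hj⟩ => hω _ ⟨j, by simp [projCube, hj]⟩) hY (t := fun j => (t j : ℝ))
      (fun j => (t j).2.1) (hTY t ht)
    simp only [altSum_comp_projCube, projCube_coe] at h
    rw [← h]
    exact (hsumG fun y => (if ∀ j, y j < (t j : ℝ) then 1 else 0) *
      altSum (B ω) (projCube y) (projCube (ladderSuccPi Y (fun _ => 1) y))).symm
  · intro s hs t ht
    -- The volume identity is the same tiling, applied to `∏ z j` at the point `min s t`: a cell
    -- lies below both `s` and `t` exactly when it lies below their minimum.
    have h := sum_ite_altSum_ladder (f := fun z => 1 * ∏ j, z j)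
      (fun z ⟨j, hj⟩ => by rw [Finset.prod_eq_zero (Finset.mem_univ j) hj, mul_zero]) hY
      (t := fun j => min (s j : ℝ) (t j)) (fun j => le_min (s j).2.1 (t j).2.1) (fun j => by
        rcases le_total (s j : ℝ) (t j) with h | h
        · rw [min_eq_left h]; exact hTY s hs j
        · rw [min_eq_right h]; exact hTY t ht j)
    rw [one_mul] at h
    rw [← h, ← hsumG]
    refine Finset.sum_congr rfl fun i _ => ?_
    rw [altSum_prod 1 (fun (_ : ι) t => t), one_mul]
    congr 1
    · exact ite_mul_ite_of_iff (by simp only [lt_min_iff, forall_and])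
    · refine Finset.prod_congr rfl fun j _ => ?_
      rw [coe_projCube (hsucc01 _ (φ.symm i).2), coe_projCube (hmem01 _ (φ.symm i).2)]

theorem isGaussianProcess (hB : IsBrownianSheet B P) :
    IsGaussianProcess (fun t ω => B ω t) P where
  hasGaussianLaw T := by
    obtain ⟨k, a, b, c, hab, hind, hrep, -⟩ := hB.exists_grid T
    have h := iIndepFun.hasGaussianLaw (fun i => hB.hasGaussianLaw_increment (hab i)) hind
    have h2 := h.map_fun (ContinuousLinearMap.pi fun t : T =>
      ∑ i, c t i • ContinuousLinearMap.proj (R := ℝ) (φ := fun _ : Fin k => ℝ) i)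
    refine h2.congr ?_
    filter_upwards [hrep] with ω hω
    funext t
    simp [Finset.restrict, hω t t.2]

theorem covariance_eq [IsProbabilityMeasure P] (hB : IsBrownianSheet B P)
    (s t : ι → unitInterval) :
    cov[fun ω => B ω s, fun ω => B ω t; P] = ∏ j, min (s j : ℝ) (t j) := by
  classical
  obtain ⟨k, a, b, c, hab, hind, hrep, hcov⟩ := hB.exists_grid {s, t}
  have hs : s ∈ ({s, t} : Finset (ι → unitInterval)) := by simp
  have ht : t ∈ ({s, t} : Finset (ι → unitInterval)) := by simp
  have hL2 : ∀ i, MemLp (fun ω => altSum (B ω) (a i) (b i)) 2 P := fun i =>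
    (hB.hasGaussianLaw_increment (hab i)).memLp_two
  have hcongr : cov[fun ω => B ω s, fun ω => B ω t; P] =
      cov[fun ω => ∑ i, c s i * altSum (B ω) (a i) (b i),
        fun ω => ∑ i, c t i * altSum (B ω) (a i) (b i); P] := by
    have h1 : (fun ω => B ω s) =ᵐ[P] fun ω => ∑ i, c s i * altSum (B ω) (a i) (b i) :=
      hrep.mono fun ω h => h s hs
    have h2 : (fun ω => B ω t) =ᵐ[P] fun ω => ∑ i, c t i * altSum (B ω) (a i) (b i) :=
      hrep.mono fun ω h => h t ht
    rw [covariance, covariance, integral_congr_ae h1, integral_congr_ae h2]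
    refine integral_congr_ae ?_
    filter_upwards [h1, h2] with ω e1 e2
    rw [e1, e2]
  rw [hcongr, covariance_fun_sum_fun_sum (fun i => (hL2 i).const_mul _)
    (fun i => (hL2 i).const_mul _), ← hcov s hs t ht]
  refine Finset.sum_congr rfl fun i _ => ?_
  rw [Finset.sum_eq_single i]
  · rw [covariance_const_mul_left, covariance_const_mul_right,
      covariance_self (hL2 i).aemeasurable]
    have hvar : Var[fun ω => altSum (B ω) (a i) (b i); P] =
        ∏ j, ((b i j : ℝ) - (a i j : ℝ)) := by
      have h1 := variance_map (X := id) (Y := fun ω => altSum (B ω) (a i) (b i)) (μ := P)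
        aemeasurable_id (hL2 i).aemeasurable
      rw [hB.increment_law _ _ (hab i), variance_id_gaussianReal] at h1
      rw [Real.coe_toNNReal] at h1
      · exact h1.symm
      · exact Finset.prod_nonneg fun j _ => sub_nonneg.2 (hab i j)
    rw [hvar]
    ring
  · intro i' _ hne
    rw [covariance_const_mul_left, covariance_const_mul_right,
      (hind.indepFun hne.symm).covariance_eq_zero (hL2 i) (hL2 i'), mul_zero, mul_zero]
  · simp

end IsBrownianSheet

/-! ### Continuous paths and absence of atoms -/

section ContinuousPaths

variable {T : Type*} [TopologicalSpace T] [CompactSpace T] [TopologicalSpace.MetrizableSpace T]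

/-- A continuous injection of the Polish space of continuous functions is a measurable embedding.
Measurability and independence of random paths can thus be read off at countably many points. -/
theorem measurableEmbedding_evalDense [Nonempty T] [TopologicalSpace.SeparableSpace T]
    [MeasurableSpace C(T, ℝ)] [BorelSpace C(T, ℝ)] :
    MeasurableEmbedding fun (f : C(T, ℝ)) (k : ℕ) => f (TopologicalSpace.denseSeq T k) := by
  refine Continuous.measurableEmbedding (continuous_pi fun k => continuous_eval_const _) ?_
  intro f g hfg
  refine DFunLike.coe_injective (f.continuous.ext_on
    (TopologicalSpace.denseRange_denseSeq T) g.continuous ?_)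
  rintro _ ⟨k, rfl⟩
  exact congrFun hfg k

theorem aemeasurable_continuousMap [Nonempty T] [TopologicalSpace.SeparableSpace T]
    [MeasurableSpace C(T, ℝ)] [BorelSpace C(T, ℝ)] {Ω : Type*} [MeasurableSpace Ω] {P : Measure Ω}
    {X : Ω → C(T, ℝ)} (hX : ∀ t, AEMeasurable (fun ω => X ω t) P) : AEMeasurable X P :=
  measurableEmbedding_evalDense.aemeasurable_comp_iff.1
    (aemeasurable_pi_iff.2 fun k => hX (TopologicalSpace.denseSeq T k))

/-- The covariance of a Brownian sheet at `t₀`, normalised by the variance. -/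
def sheetDirection {ι : Type*} [Fintype ι] (t₀ : ι → unitInterval) :
    C(ι → unitInterval, ℝ) where
  toFun t := ∏ j, min (t₀ j : ℝ) (t j) / t₀ j
  continuous_toFun := by fun_prop

end ContinuousPaths

namespace IsBrownianSheet

variable {ι Ω : Type*} [Fintype ι] [DecidableEq ι] [MeasurableSpace Ω]
  {B : Ω → SkorohodSpace ι} {P : Measure Ω}
  [MeasurableSpace C(ι → unitInterval, ℝ)] [BorelSpace C(ι → unitInterval, ℝ)]

theorem exists_continuousMap (hB : IsBrownianSheet B P) :
    ∃ X : Ω → C(ι → unitInterval, ℝ), AEMeasurable X P ∧ ∀ᵐ ω ∂P, ∀ t, X ω t = B ω t := by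
  classical
  have hae : ∀ᵐ ω ∂P, ∀ t, (if h : Continuous (B ω) then
      (⟨B ω, h⟩ : C(ι → unitInterval, ℝ)) else 0) t = B ω t := by
    filter_upwards [hB.ae_continuous] with ω hω t
    rw [dif_pos hω]
    rfl
  refine ⟨_, aemeasurable_continuousMap fun t => ?_, hae⟩
  exact (hB.isGaussianProcess.aemeasurable t).congr (hae.mono fun ω h => (h t).symm)

/-- Subtracting the regression on the value at `t₀` leaves a field uncorrelated with that value;
joint Gaussianity upgrades this to independence. -/
theorem indepFun_residual [IsProbabilityMeasure P] (hB : IsBrownianSheet B P)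
    {X : Ω → C(ι → unitInterval, ℝ)} (hX : ∀ᵐ ω ∂P, ∀ t, X ω t = B ω t)
    {t₀ : ι → unitInterval} (ht₀ : ∀ j, 0 < t₀ j) :
    IndepFun (fun ω => X ω - X ω t₀ • sheetDirection t₀) (fun ω => X ω t₀) P := by
  classical
  set κ := sheetDirection t₀
  have hG := hB.isGaussianProcess
  have hmem : ∀ t, MemLp (fun ω => B ω t) 2 P := fun t => (hG.hasGaussianLaw_eval t).memLp_two
  have hκ : ∀ t, κ t * ∏ j, (t₀ j : ℝ) = ∏ j, min (t₀ j : ℝ) (t j) := by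
    intro t
    show (∏ j, min (t₀ j : ℝ) (t j) / t₀ j) * _ = _
    rw [← Finset.prod_mul_distrib]
    refine Finset.prod_congr rfl fun j _ => div_mul_cancel₀ _ ?_
    exact ne_of_gt (show (0 : ℝ) < t₀ j from ht₀ j)
  have hproc : IsGaussianProcess (Sum.elim (fun t ω => B ω t - κ t * B ω t₀)
      (fun (_ : Unit) ω => B ω t₀)) P := by
    refine hG.of_isGaussianProcess fun s => ?_
    rcases s with t | u
    · refine ⟨{t, t₀}, ContinuousLinearMap.proj (R := ℝ)
        (φ := fun _ : ({t, t₀} : Finset (ι → unitInterval)) => ℝ) ⟨t, by simp⟩ -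
        κ t • ContinuousLinearMap.proj (R := ℝ)
        (φ := fun _ : ({t, t₀} : Finset (ι → unitInterval)) => ℝ) ⟨t₀, by simp⟩, fun ω => ?_⟩
      simp [Finset.restrict]
    · refine ⟨{t₀}, ContinuousLinearMap.proj (R := ℝ)
        (φ := fun _ : ({t₀} : Finset (ι → unitInterval)) => ℝ) ⟨t₀, by simp⟩, fun ω => ?_⟩
      simp [Finset.restrict]
  have hind := hproc.indepFun_of_covariance_eq_zero
    (fun t => ((hG.aemeasurable t).sub ((hG.aemeasurable t₀).const_mul (κ t))))
    (fun _ => hG.aemeasurable t₀) (fun t _ => by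
      rw [covariance_fun_sub_left (hmem t) ((hmem t₀).const_mul _) (hmem t₀),
        covariance_const_mul_left, hB.covariance_eq, hB.covariance_eq]
      simp only [min_self]
      rw [hκ, sub_eq_zero]
      exact Finset.prod_congr rfl fun j _ => min_comm _ _)
  -- `inv` rebuilds a path measurably from its values on a dense sequence, carrying independence
  -- from coordinates to random elements of the path space.
  obtain ⟨inv, hinv, hinvc⟩ := measurableEmbedding_evalDense.exists_measurable_extend
    (measurable_id (α := C(ι → unitInterval, ℝ))) (fun _ => ⟨0⟩)
  have hψ : Measurable (fun y : Unit → ℝ => y ()) := measurable_pi_apply _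
  have h2 := hind.comp (φ := fun y => inv fun k => y (TopologicalSpace.denseSeq _ k))
    (ψ := fun y : Unit → ℝ => y ())
    (hinv.comp (measurable_pi_lambda _ fun k => measurable_pi_apply _)) hψ
  refine h2.congr ?_ ?_
  · filter_upwards [hX] with ω hω
    have h3 : (fun k => B ω (TopologicalSpace.denseSeq _ k) -
        κ (TopologicalSpace.denseSeq _ k) * B ω t₀) = fun k =>
        (X ω - X ω t₀ • κ) (TopologicalSpace.denseSeq _ k) := by
      funext k
      simp [hω, mul_comm]
    simp only [Function.comp, h3]
    exact congrFun hinvc (X ω - X ω t₀ • κ)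
  · filter_upwards [hX] with ω hω
    exact (hω t₀).symm

/-- A set of paths that meets every line in the direction `sheetDirection t₀` in a countable set
is null for the Brownian sheet. -/
theorem measure_preimage_eq_zero [IsProbabilityMeasure P] (hB : IsBrownianSheet B P)
    {X : Ω → C(ι → unitInterval, ℝ)} (hXm : AEMeasurable X P)
    (hX : ∀ᵐ ω ∂P, ∀ t, X ω t = B ω t) {t₀ : ι → unitInterval} (ht₀ : ∀ j, 0 < t₀ j)
    {A : Set C(ι → unitInterval, ℝ)} (hA : MeasurableSet A)
    (hline : ∀ b, {r : ℝ | b + r • sheetDirection t₀ ∈ A}.Countable) :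
    P (X ⁻¹' A) = 0 := by
  set κ := sheetDirection t₀
  have hev : Measurable fun b : C(ι → unitInterval, ℝ) => b t₀ :=
    (continuous_eval_const t₀).measurable
  have hres : AEMeasurable (fun ω => X ω - X ω t₀ • κ) P := by
    have : Measurable fun b : C(ι → unitInterval, ℝ) => b - b t₀ • κ :=
      Continuous.measurable (by fun_prop)
    exact this.comp_aemeasurable hXm
  have hξ : AEMeasurable (fun ω => X ω t₀) P := hev.comp_aemeasurable hXm
  have hprod := (indepFun_iff_map_prod_eq_prod_map_map hres hξ).1 (hB.indepFun_residual hX ht₀)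
  have hadd : Measurable fun p : C(ι → unitInterval, ℝ) × ℝ => p.1 + p.2 • κ :=
    Continuous.measurable (by fun_prop)
  have hlaw : P.map (fun ω => X ω t₀) = gaussianReal 0 (∏ j, (t₀ j : ℝ)).toNNReal := by
    have h1 := hB.increment_law (fun _ => 0) t₀ fun j => (t₀ j).2.1
    rw [← Measure.map_congr (f := fun ω => X ω t₀)] at h1
    · simpa using h1
    · filter_upwards [hX, hB.ae_forall_eq_zero] with ω h1 h2
      rw [h1, altSum, Finset.sum_eq_single ∅]
      · simp
      · intro v _ hv
        obtain ⟨j, hj⟩ := Finset.nonempty_iff_ne_empty.2 hv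
        rw [h2 _ ⟨j, by simp [Finset.piecewise, hj]⟩, mul_zero]
      · simp
  have hna : NullSingletonClass (P.map fun ω => X ω t₀) := by
    rw [hlaw]
    refine nullSingletonClass_gaussianReal ?_
    rw [ne_eq, Real.toNNReal_eq_zero, not_le]
    exact Finset.prod_pos fun j _ => ht₀ j
  have hset : X ⁻¹' A = (fun ω => (X ω - X ω t₀ • κ, X ω t₀)) ⁻¹'
      ((fun p : C(ι → unitInterval, ℝ) × ℝ => p.1 + p.2 • κ) ⁻¹' A) := by
    ext ω
    simp
  rw [hset, ← Measure.map_apply_of_aemeasurable (hres.prodMk hξ) (hadd hA), hprod,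
    Measure.measure_prod_null (hadd hA)]
  -- Each slice at a fixed residual is countable, hence null for the atomless law of the value at
  -- `t₀`.
  exact Eventually.of_forall fun b => (hline b).measure_zero _

end IsBrownianSheet

/-- At most two values of `r` make `c` the supremum of `|g + r h|`, if `|h|` is bounded below. -/
theorem countable_setOf_sup_abs_eq {U : Type*} (K : Set U) (g h : U → ℝ) (c : ℝ) {η : ℝ}
    (hη : 0 < η) (hh : ∀ u ∈ K, η ≤ |h u|) :
    {r : ℝ | (∀ u ∈ K, |g u + r * h u| ≤ c) ∧
      ∀ m : ℕ, ∃ u ∈ K, c - 1 / ((m : ℝ) + 1) < |g u + r * h u|}.Countable := by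
  refine Set.Finite.countable ?_
  by_contra hinf
  obtain ⟨s, hs, hcard⟩ := Set.Infinite.exists_subset_card_eq hinf 3
  set r := s.orderEmbOfFin hcard
  have hr : ∀ i, r i ∈ {r : ℝ | (∀ u ∈ K, |g u + r * h u| ≤ c) ∧
      ∀ m : ℕ, ∃ u ∈ K, c - 1 / ((m : ℝ) + 1) < |g u + r * h u|} := fun i =>
    hs (s.orderEmbOfFin_mem hcard i)
  have h01 : r 0 < r 1 := r.strictMono (by decide)
  have h12 : r 1 < r 2 := r.strictMono (by decide)
  -- With three parameters in the set, a point `u` almost attaining `c` at the middle one gives a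
  -- contradiction: moving `r` to one side raises `|g u + r * h u|` by at least the gap times `η`,
  -- hence above `c`.
  obtain ⟨m, hm⟩ := exists_nat_one_div_lt
    (mul_pos (lt_min (sub_pos.2 h01) (sub_pos.2 h12)) hη)
  obtain ⟨u, hu, hlt⟩ := (hr 1).2 m
  have hu0 := (hr 0).1 u hu
  have hu2 := (hr 2).1 u hu
  have hhu := hh u hu
  have hd0 : min (r 1 - r 0) (r 2 - r 1) * η ≤ (r 1 - r 0) * |h u| :=
    mul_le_mul (min_le_left _ _) hhu hη.le (sub_pos.2 h01).le
  have hd2 : min (r 1 - r 0) (r 2 - r 1) * η ≤ (r 2 - r 1) * |h u| :=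
    mul_le_mul (min_le_right _ _) hhu hη.le (sub_pos.2 h12).le
  rw [abs_le] at hu0 hu2
  rcases lt_abs.1 hlt with h1 | h1 <;> rcases abs_cases (h u) with ⟨h2, -⟩ | ⟨h2, -⟩ <;>
    rw [h2] at hd0 hd2 <;> nlinarith

/-- A path functional `b ↦ Φ b u + m u`, affine in `b`, has no atom at level `c` in its absolute
supremum over `K`, provided `Φ` does not vanish near `K` in suitable directions. -/
theorem IsBrownianSheet.ae_not_sup_abs_eq {ι Ω U : Type*} [Fintype ι] [DecidableEq ι]
    [MeasurableSpace Ω] {B : Ω → SkorohodSpace ι} {P : Measure Ω} [IsProbabilityMeasure P]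
    (hB : IsBrownianSheet B P) [TopologicalSpace U] [CompactSpace U]
    (Φ : U → C(ι → unitInterval, ℝ) →ₗ[ℝ] ℝ) (hΦ : ∀ u, Continuous (Φ u))
    (hΦu : ∀ t, Continuous fun u => Φ u (sheetDirection t)) (m : U → ℝ) (c : ℝ)
    {K : Set U} (hK : ∀ u ∈ closure K, ∃ t : ι → unitInterval, (∀ j, 0 < t j) ∧
      Φ u (sheetDirection t) ≠ 0) :
    ∀ᵐ ω ∂P, ∀ b : C(ι → unitInterval, ℝ), (∀ t, b t = B ω t) →
      ¬ ((∀ u ∈ K, |Φ u b + m u| ≤ c) ∧ ∃ u ∈ K, |Φ u b + m u| = c) := by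
  classical
  let _ : MeasurableSpace C(ι → unitInterval, ℝ) := borel _
  have : BorelSpace C(ι → unitInterval, ℝ) := ⟨rfl⟩
  obtain ⟨X, hXm, hX⟩ := hB.exists_continuousMap
  choose! t ht0 htne using hK
  -- On `N u` the slope in the direction chosen for `u` stays bounded away from zero, so one
  -- direction serves the whole neighbourhood.
  set N : U → Set U := fun u => {u' | |Φ u (sheetDirection (t u))| / 2 <
    |Φ u' (sheetDirection (t u))|}
  have hN : ∀ u ∈ closure K, N u ∈ 𝓝 u := fun u hu =>
    (isOpen_lt continuous_const (hΦu (t u)).abs).mem_nhds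
      (half_lt_self (abs_pos.2 (htne u hu)))
  obtain ⟨F, hFK, hF⟩ := isClosed_closure.isCompact.elim_nhds_subcover N hN
  -- Approximate attainment replaces attainment: this makes the set Borel, as a closed set
  -- intersected with countably many open ones.
  set A : Set U → Set C(ι → unitInterval, ℝ) := fun K => {b | (∀ u ∈ K, |Φ u b + m u| ≤ c) ∧
    ∀ k : ℕ, ∃ u ∈ K, c - 1 / ((k : ℝ) + 1) < |Φ u b + m u|}
  have hcont : ∀ u, Continuous fun b => |Φ u b + m u| := fun u =>
    ((hΦ u).add continuous_const).abs
  have hA : ∀ K, MeasurableSet (A K) := by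
    intro K
    have h1 : IsClosed {b | ∀ u ∈ K, |Φ u b + m u| ≤ c} := by
      simp only [Set.ofPred_forall]
      exact isClosed_biInter fun u _ => isClosed_le (hcont u) continuous_const
    have h2 : MeasurableSet {b | ∀ k : ℕ, ∃ u ∈ K, c - 1 / ((k : ℝ) + 1) < |Φ u b + m u|} := by
      simp only [Set.ofPred_forall]
      refine MeasurableSet.iInter fun k => IsOpen.measurableSet ?_
      have : {b | ∃ u ∈ K, c - 1 / ((k : ℝ) + 1) < |Φ u b + m u|} =
          ⋃ u ∈ K, {b | c - 1 / ((k : ℝ) + 1) < |Φ u b + m u|} := by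
        ext b; simp
      rw [this]
      exact isOpen_biUnion fun u _ => isOpen_lt continuous_const (hcont u)
    exact h1.measurableSet.inter h2
  have hnull : ∀ᵐ ω ∂P, ∀ u ∈ F, X ω ∉ A (K ∩ N u) := by
    refine (ae_ball_iff F.countable_toSet).2 fun u hu => measure_eq_zero_iff_ae_notMem.1 ?_
    refine hB.measure_preimage_eq_zero hXm hX (ht0 u (hFK u hu)) (hA _) fun b => ?_
    have := countable_setOf_sup_abs_eq (K ∩ N u) (fun u => Φ u b + m u)
      (fun u' => Φ u' (sheetDirection (t u))) c
      (half_pos (abs_pos.2 (htne u (hFK u hu)))) fun u' hu' => le_of_lt hu'.2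
    refine this.mono fun r hr => ?_
    have e : ∀ u', Φ u' (b + r • sheetDirection (t u)) + m u' =
        Φ u' b + m u' + r * Φ u' (sheetDirection (t u)) := fun u' => by
      rw [map_add, map_smul, smul_eq_mul]; ring
    have hr' : b + r • sheetDirection (t u) ∈ A (K ∩ N u) := hr
    simp only [A, Set.mem_ofPred_eq, e] at hr'
    exact hr'
  filter_upwards [hnull, hX] with ω hω hXω b hb ⟨hle, u, hu, huc⟩
  have hbX : X ω = b := ContinuousMap.ext fun t => (hXω t).trans (hb t).symm
  obtain ⟨i, hi, hui⟩ := Set.mem_iUnion₂.1 (hF (subset_closure hu))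
  refine hω i hi ?_
  rw [hbX]
  refine ⟨fun u' hu' => hle u' hu'.1, fun k => ⟨u, ⟨hu, hui⟩, ?_⟩⟩
  rw [huc]
  have : (0 : ℝ) < 1 / ((k : ℝ) + 1) := by positivity
  linarith

/-! ### The extended continuous mapping theorem -/

/-- Portmanteau for open sets. The filter hypothesis says that `T n ω` is close to the limit once
`n` is large and `Z n ω` is near `Z' ω'`; `T n` need not be a function of `Z n`. -/
theorem TendstoInDistribution.of_tendsto_comap {ι Ω Ω' E F : Type*} [MeasurableSpace Ω]
    [MeasurableSpace Ω'] {P : Measure Ω} [IsProbabilityMeasure P] {P' : Measure Ω'}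
    [IsProbabilityMeasure P'] [TopologicalSpace E] [MeasurableSpace E] [OpensMeasurableSpace E]
    [HasOuterApproxClosed E] [TopologicalSpace F] [MeasurableSpace F] [OpensMeasurableSpace F]
    {l : Filter ι} [l.IsCountablyGenerated] {Z : ι → Ω → E} {Z' : Ω' → E}
    (hZ : TendstoInDistribution Z l Z' (fun _ => P) P') {T : ι → Ω → F} {T' : Ω' → F}
    (hT : ∀ n, AEMeasurable (T n) P) (hT' : AEMeasurable T' P')
    (hlim : ∀ᵐ ω' ∂P', Tendsto (fun p : ι × Ω => T p.1 p.2)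
      (comap (fun p : ι × Ω => (p.1, Z p.1 p.2)) (l ×ˢ 𝓝 (Z' ω'))) (𝓝 (T' ω'))) :
    TendstoInDistribution T l T' (fun _ => P) P' := by
  refine ⟨hT, hT', ?_⟩
  refine tendsto_of_forall_isOpen_le_liminf' fun G hG => ?_
  simp only [ProbabilityMeasure.coe_mk]
  rw [Measure.map_apply_of_aemeasurable hT' hG.measurableSet]
  simp_rw [Measure.map_apply_of_aemeasurable (hT _) hG.measurableSet]
  obtain ⟨L, hL⟩ := l.exists_antitone_basis
  -- `U k` is the largest open set for which `Z n ω ∈ U k` forces `T n ω ∈ G` for all `n ∈ L k`.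
  -- These sets increase, and almost surely `T' ∈ G` puts `Z'` into one of them.
  set U : ℕ → Set E := fun k => ⋃₀ {V | IsOpen V ∧
    ∀ n ∈ L k, ∀ ω, Z n ω ∈ V → T n ω ∈ G} with hU
  have hUo : ∀ k, IsOpen (U k) := fun k => isOpen_sUnion fun V hV => hV.1
  have hUmono : Monotone U := fun k k' hk => Set.sUnion_subset_sUnion fun V hV =>
    ⟨hV.1, fun n hn => hV.2 n (hL.antitone hk hn)⟩
  have hUsub : ∀ k, ∀ n ∈ L k, Z n ⁻¹' U k ⊆ T n ⁻¹' G := by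
    rintro k n hn ω ⟨V, hV, hω⟩
    exact hV.2 n hn ω hω
  have hcover : P' (T' ⁻¹' G) ≤ P' (⋃ k, Z' ⁻¹' U k) := by
    refine measure_mono_ae ?_
    filter_upwards [hlim] with ω' hω' hG'
    have h1 := hω'.eventually (hG.mem_nhds hG')
    obtain ⟨S, hS, hSsub⟩ := mem_comap.1 h1
    obtain ⟨A, hA, V, hV, hAV⟩ := mem_prod_iff.1 hS
    obtain ⟨k, hk⟩ := hL.mem_iff.1 hA
    obtain ⟨V', hV', hV'o, hz⟩ := mem_nhds_iff.1 hV
    refine Set.mem_iUnion.2 ⟨k, V', ⟨hV'o, fun n hn ω hω => ?_⟩, hz⟩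
    have h2 : (n, ω) ∈ (fun p : ι × Ω => (p.1, Z p.1 p.2)) ⁻¹' S :=
      hAV (show (n, Z n ω) ∈ A ×ˢ V from ⟨hk hn, hV' hω⟩)
    exact hSsub h2
  refine hcover.trans ?_
  have hmonoZ : Monotone fun k => Z' ⁻¹' U k := fun k k' hk => Set.preimage_mono (hUmono hk)
  rw [hmonoZ.measure_iUnion]
  refine iSup_le fun k => ?_
  have hport := ProbabilityMeasure.le_liminf_measure_open_of_tendsto hZ.tendsto (hUo k)
  simp only [ProbabilityMeasure.coe_mk] at hport
  rw [Measure.map_apply_of_aemeasurable hZ.aemeasurable_limit (hUo k).measurableSet] at hport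
  refine hport.trans (liminf_le_liminf ?_)
  filter_upwards [hL.mem k] with n hn
  rw [Measure.map_apply_of_aemeasurable (hZ.forall_aemeasurable n) (hUo k).measurableSet]
  exact measure_mono (hUsub k n hn)

/-! ### Skorohod convergence to continuous limits -/

namespace SkorohodSpace

variable {ι : Type*} [Fintype ι]

/-- A small time change moves a uniformly continuous function little, so Skorohod closeness to it is
uniform closeness. -/
theorem tendsto_apply_of_continuous {b : SkorohodSpace ι} (hb : Continuous b) :
    TendstoUniformly (fun (f : SkorohodSpace ι) t => f t) b (𝓝 b) := by
  rw [Metric.tendstoUniformly_iff]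
  intro ε hε
  obtain ⟨η, hη, hunif⟩ := Metric.uniformContinuous_iff.1
    (CompactSpace.uniformContinuous_of_continuous hb) (ε / 2) (half_pos hε)
  have hpos : (0 : ℝ≥0∞) < min (ENNReal.ofReal (ε / 2)) (ENNReal.ofReal η) :=
    lt_min (ENNReal.ofReal_pos.2 (half_pos hε)) (ENNReal.ofReal_pos.2 hη)
  filter_upwards [Metric.eball_mem_nhds b hpos] with f hf t
  obtain ⟨l, hl⟩ := iInf_lt_iff.1 (show (⨅ l : ι → (unitInterval ≃o unitInterval),
    max (⨆ t : ι → unitInterval, edist (f t) (b (fun j => l j (t j))))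
      (⨆ (j : ι) (u : unitInterval), edist (l j u) u)) < _ from hf)
  have h1 : edist (f t) (b (fun j => l j (t j))) < ENNReal.ofReal (ε / 2) :=
    (le_iSup (fun t : ι → unitInterval => edist (f t) (b (fun j => l j (t j)))) t).trans_lt
      (((le_max_left _ _).trans_lt hl).trans_le (min_le_left _ _))
  have h2 : ∀ j, edist (l j (t j)) (t j) < ENNReal.ofReal η := fun j =>
    (le_iSup₂ (f := fun (j : ι) (u : unitInterval) => edist (l j u) u) j (t j)).trans_lt
      (((le_max_right _ _).trans_lt hl).trans_le (min_le_right _ _))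
  rw [edist_dist, ENNReal.ofReal_lt_ofReal_iff (half_pos hε)] at h1
  have h3 : dist (fun j => l j (t j)) t < η := (dist_pi_lt_iff hη).2 fun j => by
    have := h2 j
    rwa [edist_dist, ENNReal.ofReal_lt_ofReal_iff hη] at this
  have h4 := hunif h3
  calc dist (b t) (f t) ≤ dist (b t) (b (fun j => l j (t j))) +
        dist (b (fun j => l j (t j))) (f t) := dist_triangle _ _ _
    _ < ε / 2 + ε / 2 := by rw [dist_comm (b t), dist_comm _ (f t)]; exact add_lt_add h4 h1
    _ = ε := add_halves ε

end SkorohodSpace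

/-! ### First passage times -/

theorem passageTime_lt_iff {s₀ c : ℝ} {S : ℝ → ℝ} {x : ℝ≥0∞} :
    passageTime s₀ c S < x ↔
      ∃ s, s₀ ≤ s ∧ s ≤ 1 ∧ c < S s ∧ ENNReal.ofReal s < x := by
  simp only [passageTime, iInf_lt_iff, Set.mem_ofPred_eq, exists_prop, and_assoc]

theorem firstAlarm_div_lt_iff {s₀ c : ℝ} {N : ℕ} (hN : 0 < N) {S : ℝ → ℝ} {x : ℝ≥0∞} :
    firstAlarm s₀ c N S / N < x ↔
      ∃ k : ℕ, ⌊(N : ℝ) * s₀⌋₊ ≤ k ∧ k ≤ N ∧ c < S (k / N) ∧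
        ENNReal.ofReal ((k : ℝ) / N) < x := by
  have hN0 : (N : ℝ≥0∞) ≠ 0 := by exact_mod_cast hN.ne'
  have hNt : (N : ℝ≥0∞) ≠ ⊤ := ENNReal.natCast_ne_top N
  have hk : ∀ k : ℕ, ENNReal.ofReal ((k : ℝ) / N) = (k : ℝ≥0∞) / N := by
    intro k
    rw [ENNReal.ofReal_div_of_pos (by exact_mod_cast hN), ENNReal.ofReal_natCast,
      ENNReal.ofReal_natCast]
  simp only [hk, ENNReal.div_lt_iff (Or.inl hN0) (Or.inl hNt), firstAlarm, iInf_lt_iff,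
    Set.mem_ofPred_eq, exists_prop, and_assoc]

/-- First passage times of discretely observed approximations converge, if the limit does not
reach the level before it exceeds it. -/
theorem tendsto_firstAlarm_div {α : Type*} {𝓕 : Filter α} {N : α → ℕ}
    (hN : Tendsto N 𝓕 atTop) {s₀ c : ℝ} (hs₀ : s₀ ∈ Set.Ioo (0 : ℝ) 1) {S' : α → ℝ → ℝ}
    {S : ℝ → ℝ} (hS : ContinuousOn S (Set.Icc 0 1))
    (hunif : ∀ ρ > 0, ∀ᶠ i in 𝓕, ∀ s ∈ Set.Icc (0 : ℝ) 1, |S' i s - S s| < ρ)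
    (hstick : ∀ q : ℝ, q ∈ Set.Icc s₀ 1 → (q = 1 ∨ ∃ r : ℚ, (r : ℝ) = q) →
      ¬ ((∀ s ∈ Set.Icc s₀ q, S s ≤ c) ∧ ∃ s ∈ Set.Icc s₀ q, S s = c)) :
    Tendsto (fun i => firstAlarm s₀ c (N i) (S' i) / (N i : ℝ≥0∞)) 𝓕
      (𝓝 (passageTime s₀ c S)) := by
  have hNpos : ∀ᶠ i in 𝓕, 0 < N i := hN.eventually (eventually_gt_atTop 0)
  have hsub : Set.Icc s₀ 1 ⊆ Set.Icc (0 : ℝ) 1 := Set.Icc_subset_Icc_left hs₀.1.le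
  have hfl : ∀ s, 0 ≤ s → Tendsto (fun i => (⌊(N i : ℝ) * s⌋₊ : ℝ) / N i) 𝓕 (𝓝 s) :=
    fun s hs => tendsto_floor_mul_div hN (fun _ => hs) tendsto_const_nhds
  rw [tendsto_order]
  constructor
  · intro x hx
    -- it suffices to exclude alarms up to some `q` with `x < q`
    have hq : ∃ q ∈ Set.Icc s₀ 1, (∀ s ∈ Set.Icc s₀ q, S s < c) ∧
        (q = 1 ∨ x < ENNReal.ofReal q) ∨ x < ENNReal.ofReal s₀ := by
      by_cases hxs : x < ENNReal.ofReal s₀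
      · exact ⟨s₀, ⟨le_rfl, hs₀.2.le⟩, Or.inr hxs⟩
      · have hxs' := not_lt.1 hxs
        -- Only rational `q` and `q = 1` are used, so that `hstick` costs countably many null sets.
        -- The value `q = 1` covers the case of no passage at all.
        have hqex : ∃ q ∈ Set.Icc s₀ 1, (q = 1 ∨ ∃ r : ℚ, (r : ℝ) = q) ∧
            (∀ s ∈ Set.Icc s₀ q, S s ≤ c) ∧ (q = 1 ∨ x < ENNReal.ofReal q) := by
          by_cases h1 : ENNReal.ofReal 1 < passageTime s₀ c S
          · refine ⟨1, ⟨hs₀.2.le, le_rfl⟩, Or.inl rfl, fun s hs => ?_, Or.inl rfl⟩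
            by_contra hcs
            refine absurd h1 (not_lt.2 (le_of_lt (lt_of_le_of_ne ?_ ?_)))
            · exact (iInf₂_le s ⟨hs.1, hs.2, not_le.1 hcs⟩).trans (ENNReal.ofReal_le_ofReal hs.2)
            · intro he
              exact absurd (he ▸ h1) (lt_irrefl _)
          · have hfin : passageTime s₀ c S ≠ ⊤ := (not_lt.1 h1).trans_lt ENNReal.ofReal_lt_top |>.ne
            have hxr : x.toReal < (passageTime s₀ c S).toReal :=
              (ENNReal.toReal_lt_toReal hx.ne_top hfin).2 hx
            obtain ⟨r, hr1, hr2⟩ := exists_rat_btwn hxr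
            have hr0 : s₀ ≤ r := by
              have := ENNReal.toReal_mono hx.ne_top hxs'
              rw [ENNReal.toReal_ofReal hs₀.1.le] at this
              exact this.trans hr1.le
            have hr01 : (r : ℝ) ≤ 1 := by
              have := ENNReal.toReal_mono ENNReal.ofReal_ne_top (not_lt.1 h1)
              rw [ENNReal.toReal_ofReal zero_le_one] at this
              exact hr2.le.trans this
            refine ⟨r, ⟨hr0, hr01⟩, Or.inr ⟨r, rfl⟩, fun s hs => ?_, Or.inr ?_⟩
            · by_contra hcs
              have h2 : passageTime s₀ c S ≤ ENNReal.ofReal s :=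
                iInf₂_le s ⟨hs.1, hs.2.trans hr01, not_le.1 hcs⟩
              have h3 := ENNReal.toReal_mono ENNReal.ofReal_ne_top h2
              rw [ENNReal.toReal_ofReal (hs₀.1.le.trans hs.1)] at h3
              linarith [hs.2]
            · exact (ENNReal.lt_ofReal_iff_toReal_lt hx.ne_top).2 hr1
        obtain ⟨q, hq, hqr, hle, hqx⟩ := hqex
        refine ⟨q, hq, Or.inl ⟨fun s hs => lt_of_le_of_ne (hle s hs) fun he => ?_, hqx⟩⟩
        exact hstick q hq hqr ⟨hle, s, hs, he⟩
    obtain ⟨q, hq, ⟨hlt, hqx⟩ | hxs⟩ := hq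
    swap
    · obtain ⟨y, hxy, hys⟩ := exists_between hxs
      have hyr : y.toReal < s₀ := (ENNReal.lt_ofReal_iff_toReal_lt hys.ne_top).1 hys
      filter_upwards [hNpos, (hfl s₀ hs₀.1.le).eventually (lt_mem_nhds hyr)] with i hi hfi
      refine lt_of_lt_of_le hxy (not_lt.1 fun hcon => ?_)
      obtain ⟨k, hk, -, -, hky⟩ := (firstAlarm_div_lt_iff hi).1 hcon
      have hNi : (0 : ℝ) < N i := by exact_mod_cast hi
      have h1 : (⌊(N i : ℝ) * s₀⌋₊ : ℝ) / N i ≤ (k : ℝ) / N i :=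
        (div_le_div_iff_of_pos_right hNi).2 (by exact_mod_cast hk)
      rw [ENNReal.ofReal_lt_iff_lt_toReal (by positivity) hys.ne_top] at hky
      linarith
    · -- a uniform gap on `[s₀ - θ, q]`
      have hgap : ∃ θ > 0, ∃ ρ > 0, ∀ s ∈ Set.Icc (max 0 (s₀ - θ)) (min 1 (q + θ)),
          S s < c - ρ := by
        have hK : IsCompact (Set.Icc s₀ q) := isCompact_Icc
        have hSK : ContinuousOn S (Set.Icc s₀ q) :=
          hS.mono fun s hs => ⟨hs₀.1.le.trans hs.1, hs.2.trans hq.2⟩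
        obtain ⟨sm, hsm, hmax⟩ := hK.exists_isMaxOn ⟨s₀, le_rfl, hq.1⟩ hSK
        have hgap0 : 0 < c - S sm := sub_pos.2 (hlt sm hsm)
        obtain ⟨θ, hθ, hθu⟩ := Metric.uniformContinuousOn_iff.1
          (isCompact_Icc.uniformContinuousOn_of_continuous hS) ((c - S sm) / 2) (half_pos hgap0)
        refine ⟨θ / 2, half_pos hθ, (c - S sm) / 2, half_pos hgap0, fun s hs => ?_⟩
        obtain ⟨s', hs', hd⟩ : ∃ s' ∈ Set.Icc s₀ q, |s - s'| ≤ θ / 2 := by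
          have h1 := (le_max_right _ _).trans hs.1
          have h2 := hs.2.trans (min_le_right _ _)
          refine ⟨max s₀ (min q s), ⟨le_max_left _ _, max_le hq.1 (min_le_left _ _)⟩, ?_⟩
          have := hq.1
          rcases le_total q s with h3 | h3
          · rw [min_eq_left h3, max_eq_right hq.1, abs_le]
            constructor <;> linarith
          · rw [min_eq_right h3]
            rcases le_total s₀ s with h4 | h4
            · rw [max_eq_right h4, sub_self, abs_zero]; exact (half_pos hθ).le
            · rw [max_eq_left h4, abs_le]
              constructor <;> linarith
        have h01 : s ∈ Set.Icc (0 : ℝ) 1 :=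
          ⟨(le_max_left _ _).trans hs.1, hs.2.trans (min_le_left _ _)⟩
        have h02 : s' ∈ Set.Icc (0 : ℝ) 1 := ⟨hs₀.1.le.trans hs'.1, hs'.2.trans hq.2⟩
        have h5 := hθu s h01 s' h02 (lt_of_le_of_lt (by rwa [Real.dist_eq]) (half_lt_self hθ))
        rw [Real.dist_eq, abs_lt] at h5
        have h6 : S s' ≤ S sm := hmax hs'
        linarith [h5.2]
      obtain ⟨θ, hθ, ρ, hρ, hgap⟩ := hgap
      -- The first admissible index `⌊N s₀⌋` may lie below `N s₀`, which is why the gap must extend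
      -- to the left of `s₀`.
      have hno : ∀ᶠ i in 𝓕, 0 < N i ∧ ∀ k : ℕ, ⌊(N i : ℝ) * s₀⌋₊ ≤ k → k ≤ N i →
          c < S' i (k / N i) → q + θ < (k : ℝ) / N i ∧ q ≠ 1 := by
        filter_upwards [hNpos, hunif ρ hρ,
          (hfl s₀ hs₀.1.le).eventually (lt_mem_nhds (sub_lt_self s₀ hθ))] with i hi hu hfi
        refine ⟨hi, fun k hk hkN hck => ?_⟩
        have hNi : (0 : ℝ) < N i := by exact_mod_cast hi
        have hk0 : (0 : ℝ) ≤ (k : ℝ) / N i := by positivity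
        have hk1 : (k : ℝ) / N i ≤ 1 := (div_le_one hNi).2 (by exact_mod_cast hkN)
        have h1 : (⌊(N i : ℝ) * s₀⌋₊ : ℝ) / N i ≤ (k : ℝ) / N i :=
          (div_le_div_iff_of_pos_right hNi).2 (by exact_mod_cast hk)
        have h2 := hu _ ⟨hk0, hk1⟩
        rw [abs_lt] at h2
        have h3 : q + θ < (k : ℝ) / N i := by
          by_contra hcon
          have := hgap _ ⟨max_le hk0 (hfi.le.trans h1), le_min hk1 (not_lt.1 hcon)⟩
          linarith [h2.2]
        exact ⟨h3, fun hq1 => by linarith⟩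
      filter_upwards [hno] with i hi
      rcases hqx with hq1 | hqx
      · have htop : ¬ firstAlarm s₀ c (N i) (S' i) / N i < ⊤ := by
          intro hcon
          obtain ⟨k, hk, hkN, hck, -⟩ := (firstAlarm_div_lt_iff hi.1).1 hcon
          exact (hi.2 k hk hkN hck).2 hq1
        exact hx.trans_le (le_top.trans (not_lt.1 htop))
      · refine hqx.trans_le (not_lt.1 fun hcon => ?_)
        obtain ⟨k, hk, hkN, hck, hkq⟩ := (firstAlarm_div_lt_iff hi.1).1 hcon
        have h1 := (hi.2 k hk hkN hck).1
        rw [ENNReal.ofReal_lt_ofReal_iff (hs₀.1.trans_le hq.1)] at hkq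
        linarith
  · intro x hx
    -- At an exceedance time `s` the grid time `⌊N s⌋ / N` lies at or below `s` and tends to it, so
    -- by continuity and uniform closeness it eventually gives an alarm.
    obtain ⟨s, hs0, hs1, hcs, hsx⟩ := passageTime_lt_iff.1 hx
    have hs00 : 0 ≤ s := hs₀.1.le.trans hs0
    have hlim := (hfl s hs00)
    have hmem : ∀ i, (⌊(N i : ℝ) * s⌋₊ : ℝ) / N i ∈ Set.Icc (0 : ℝ) 1 := by
      intro i
      refine ⟨by positivity, div_le_one_of_le₀ ?_ (Nat.cast_nonneg _)⟩
      exact (Nat.floor_le (by positivity)).trans (mul_le_of_le_one_right (Nat.cast_nonneg _) hs1)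
    have hSlim : Tendsto (fun i => S ((⌊(N i : ℝ) * s⌋₊ : ℝ) / N i)) 𝓕 (𝓝 (S s)) :=
      (hS s ⟨hs00, hs1⟩).tendsto.comp (tendsto_nhdsWithin_iff.2 ⟨hlim, Eventually.of_forall hmem⟩)
    have hmid : (S s + c) / 2 < S s := by linarith
    filter_upwards [hNpos, hunif ((S s - c) / 2) (by linarith),
      hSlim.eventually (lt_mem_nhds hmid)] with i hi hu hSi
    refine (firstAlarm_div_lt_iff hi).2 ⟨⌊(N i : ℝ) * s⌋₊, ?_, ?_, ?_, ?_⟩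
    · exact Nat.floor_mono (mul_le_mul_of_nonneg_left hs0 (Nat.cast_nonneg _))
    · refine Nat.floor_le_of_le ?_
      exact mul_le_of_le_one_right (Nat.cast_nonneg _) hs1
    · have := hu _ (hmem i)
      rw [abs_lt] at this
      linarith [this.1]
    · refine lt_of_le_of_lt (ENNReal.ofReal_le_ofReal ?_) hsx
      have hNi : (0 : ℝ) < N i := by exact_mod_cast hi
      rw [div_le_iff₀ hNi, mul_comm s]
      exact Nat.floor_le (by positivity)

/-! ### Growth of the sample sizes -/

namespace SampleSizeRegime

variable {β : Fin 3 → ℝ} {l : Filter (Fin 3 → ℕ)}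

theorem isCountablyGenerated (h : SampleSizeRegime β l) : l.IsCountablyGenerated := by
  rcases h with ⟨rfl, -⟩ | ⟨rfl, -⟩ <;> infer_instance

theorem neBot (h : SampleSizeRegime β l) : l.NeBot := by
  rcases h with ⟨rfl, -⟩ | ⟨rfl, -⟩
  · exact atTop_neBot.comap_of_surj fun m => ⟨fun _ => m, by simp⟩
  · infer_instance

theorem tendsto_apply (h : SampleSizeRegime β l) (j : Fin 3) :
    Tendsto (fun n : Fin 3 → ℕ => n j) l atTop := by
  rcases h with ⟨rfl, -⟩ | ⟨rfl, -⟩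
  · refine tendsto_atTop_mono (f := fun n : Fin 3 → ℕ => min (n 0) (min (n 1) (n 2)))
      (fun n => ?_) tendsto_comap
    fin_cases j <;> simp
  · exact tendsto_map'_iff.2 tendsto_id

/-- The only way the exponents enter: in either regime the local alternative shrinks at the noise
rate. -/
theorem eventually_prod_rpow (h : SampleSizeRegime β l) :
    ∀ᶠ n in l, ∏ j, (n j : ℝ) ^ β j = Real.sqrt (∏ j, (n j : ℝ)) := by
  rcases h with ⟨rfl, hβ⟩ | ⟨rfl, hβ⟩
  · refine Eventually.of_forall fun n => ?_
    simp only [hβ]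
    rw [Real.finsetProd_rpow _ _ fun j _ => Nat.cast_nonneg _, Real.sqrt_eq_rpow]
  · refine eventually_map.2 ((eventually_gt_atTop 0).mono fun m hm => ?_)
    have hm' : (0 : ℝ) < m := by exact_mod_cast hm
    simp only
    rw [← Real.rpow_sum_of_pos hm', hβ, Real.sqrt_eq_rpow, Finset.prod_const, Finset.card_univ,
      Fintype.card_fin, ← Real.rpow_natCast, ← Real.rpow_mul hm'.le]
    norm_num

end SampleSizeRegime

/-! ### Detector statistics on the unit cube -/

/-- The point of the block `[0, s τ̄₁] × [0, τ̄₂] × [0, τ̄₃]` with relative coordinates `y`. -/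
def blockPoint (τbar : Fin 3 → ℝ) (s : ℝ) (y : Fin 3 → unitInterval) : Fin 3 → ℝ :=
  fun j => (![s * τbar 0, τbar 1, τbar 2] : Fin 3 → ℝ) j * y j

/-- The supremum of `|G s|` over the points of the block with relative coordinates in `Q`. -/
def blockStat (Q : Set (Fin 3 → unitInterval)) (τbar : Fin 3 → ℝ) (G : ℝ → (Fin 3 → ℝ) → ℝ)
    (s : ℝ) : ℝ :=
  sSup ((fun y => |G s (blockPoint τbar s y)|) '' Q)

theorem continuous_blockPoint (τbar : Fin 3 → ℝ) :
    Continuous fun p : ℝ × (Fin 3 → unitInterval) => blockPoint τbar p.1 p.2 := by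
  refine continuous_pi fun j => ?_
  unfold blockPoint
  fin_cases j <;> simp <;> fun_prop

theorem exists_unitInterval_mul {a z : ℝ} (hz : z ∈ Set.Icc 0 a) :
    ∃ y : unitInterval, a * y = z := by
  rcases (hz.1.trans hz.2).eq_or_lt with ha | ha
  · refine ⟨0, ?_⟩
    have := hz.1
    have := hz.2
    simp
    linarith
  · exact ⟨⟨z / a, div_nonneg hz.1 ha.le, div_le_one_of_le₀ hz.2 ha.le⟩, by
      show a * (z / a) = z
      field_simp⟩

theorem globalStat_eq_blockStat {τbar : Fin 3 → ℝ} (hτ : ∀ j, 0 < τbar j)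
    (G : ℝ → (Fin 3 → ℝ) → ℝ) {s : ℝ} (hs : 0 ≤ s) :
    globalStat τbar G s = blockStat Set.univ τbar G s := by
  have hE : ∀ j, 0 ≤ (![s * τbar 0, τbar 1, τbar 2] : Fin 3 → ℝ) j := by
    intro j
    fin_cases j
    exacts [mul_nonneg hs (hτ 0).le, (hτ 1).le, (hτ 2).le]
  have h0 : (![0, 0, 0] : Fin 3 → ℝ) = fun _ => 0 := by
    funext j
    fin_cases j <;> rfl
  have himg : Set.Icc ![0, 0, 0] ![s * τbar 0, τbar 1, τbar 2] =
      blockPoint τbar s '' Set.univ := by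
    rw [h0]
    ext x
    simp only [Set.image_univ, Set.mem_range]
    constructor
    · rintro ⟨h1, h2⟩
      choose y hy using fun j => exists_unitInterval_mul ⟨h1 j, h2 j⟩
      exact ⟨y, funext hy⟩
    · rintro ⟨y, rfl⟩
      exact ⟨fun j => mul_nonneg (hE j) (y j).2.1, fun j => mul_le_of_le_one_right (hE j) (y j).2.2⟩
  rw [globalStat, blockStat, himg, Set.image_image]

theorem localStat_eq_blockStat {τbar : Fin 3 → ℝ} (hτ : ∀ j, 0 < τbar j)
    (G : ℝ → (Fin 3 → ℝ) → ℝ) (s : ℝ) :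
    localStat τbar G s = blockStat {y | y 0 = 1} τbar G s := by
  have himg : Set.Icc ![s * τbar 0, 0, 0] ![s * τbar 0, τbar 1, τbar 2] =
      blockPoint τbar s '' {y | y 0 = 1} := by
    ext x
    simp only [Set.mem_image, Set.mem_ofPred_eq]
    constructor
    · rintro ⟨h1, h2⟩
      obtain ⟨y1, hy1⟩ := exists_unitInterval_mul (a := τbar 1) (z := x 1) ⟨h1 1, h2 1⟩
      obtain ⟨y2, hy2⟩ := exists_unitInterval_mul (a := τbar 2) (z := x 2) ⟨h1 2, h2 2⟩
      have h0 : s * τbar 0 = x 0 := le_antisymm (h1 0) (h2 0)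
      refine ⟨![1, y1, y2], rfl, funext fun j => ?_⟩
      fin_cases j
      · simpa [blockPoint] using h0
      · simpa [blockPoint] using hy1
      · simpa [blockPoint] using hy2
    · rintro ⟨y, hy, rfl⟩
      constructor
      · intro j
        fin_cases j
        · simp [blockPoint, hy]
        · exact mul_nonneg (hτ 1).le (y 1).2.1
        · exact mul_nonneg (hτ 2).le (y 2).2.1
      · intro j
        fin_cases j
        · simp [blockPoint, hy]
        · exact mul_le_of_le_one_right (hτ 1).le (y 1).2.2
        · exact mul_le_of_le_one_right (hτ 2).le (y 2).2.2
  rw [localStat, blockStat, himg, Set.image_image]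

theorem firstAlarm_congr {s₀ c : ℝ} {N : ℕ} {S S' : ℝ → ℝ}
    (h : ∀ s ∈ Set.Icc (0 : ℝ) 1, S s = S' s) :
    firstAlarm s₀ c N S = firstAlarm s₀ c N S' := by
  have : ∀ k : ℕ, k ≤ N → S (k / N) = S' (k / N) := fun k hk =>
    h _ ⟨by positivity, div_le_one_of_le₀ (by exact_mod_cast hk) (Nat.cast_nonneg _)⟩
  have hset : {k : ℕ | ⌊(N : ℝ) * s₀⌋₊ ≤ k ∧ k ≤ N ∧ c < S (k / N)} =
      {k : ℕ | ⌊(N : ℝ) * s₀⌋₊ ≤ k ∧ k ≤ N ∧ c < S' (k / N)} := by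
    ext k
    simp only [Set.mem_ofPred_eq]
    refine and_congr_right fun _ => and_congr_right fun hk => ?_
    rw [this k hk]
  rw [firstAlarm, firstAlarm, hset]

theorem passageTime_congr {s₀ c : ℝ} (hs₀ : 0 ≤ s₀) {S S' : ℝ → ℝ}
    (h : ∀ s ∈ Set.Icc (0 : ℝ) 1, S s = S' s) :
    passageTime s₀ c S = passageTime s₀ c S' := by
  have hset : {s : ℝ | s₀ ≤ s ∧ s ≤ 1 ∧ c < S s} = {s : ℝ | s₀ ≤ s ∧ s ≤ 1 ∧ c < S' s} := by
    ext s
    simp only [Set.mem_ofPred_eq]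
    refine and_congr_right fun h0 => and_congr_right fun h1 => ?_
    rw [h s ⟨hs₀.trans h0, h1⟩]
  rw [passageTime, passageTime, hset]

theorem measurable_firstAlarm {E : Type*} [TopologicalSpace E] [MeasurableSpace E]
    [OpensMeasurableSpace E] {s₀ c : ℝ} {N : ℕ} {S : E → ℝ → ℝ}
    (hS : ∀ s ∈ Set.Icc (0 : ℝ) 1, Continuous fun b => S b s) :
    Measurable fun b => firstAlarm s₀ c N (S b) := by
  refine measurable_of_Iio fun x => IsOpen.measurableSet ?_
  have : (fun b => firstAlarm s₀ c N (S b)) ⁻¹' Set.Iio x =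
      ⋃ k : ℕ, ⋃ (_ : ⌊(N : ℝ) * s₀⌋₊ ≤ k ∧ k ≤ N ∧ (k : ℝ≥0∞) < x),
        {b | c < S b (k / N)} := by
    ext b
    simp only [Set.mem_preimage, Set.mem_Iio, firstAlarm, iInf_lt_iff, Set.mem_ofPred_eq,
      exists_prop, Set.mem_iUnion]
    exact exists_congr fun k => by tauto
  rw [this]
  refine isOpen_iUnion fun k => isOpen_iUnion fun hk => isOpen_lt continuous_const (hS _ ?_)
  exact ⟨by positivity, div_le_one_of_le₀ (by exact_mod_cast hk.2.1) (Nat.cast_nonneg _)⟩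

/-- The union over `s` is uncountable, but it is a union of open sets. -/
theorem measurable_passageTime {E : Type*} [TopologicalSpace E] [MeasurableSpace E]
    [OpensMeasurableSpace E] {s₀ c : ℝ} (hs₀ : 0 ≤ s₀) {S : E → ℝ → ℝ}
    (hS : ∀ s ∈ Set.Icc (0 : ℝ) 1, Continuous fun b => S b s) :
    Measurable fun b => passageTime s₀ c (S b) := by
  refine measurable_of_Iio fun x => IsOpen.measurableSet ?_
  have : (fun b => passageTime s₀ c (S b)) ⁻¹' Set.Iio x =
      ⋃ s : ℝ, ⋃ (_ : s₀ ≤ s ∧ s ≤ 1 ∧ ENNReal.ofReal s < x), {b | c < S b s} := by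
    ext b
    simp only [Set.mem_preimage, Set.mem_Iio, passageTime_lt_iff, exists_prop, Set.mem_iUnion,
      Set.mem_ofPred_eq]
    exact exists_congr fun k => by tauto
  rw [this]
  exact isOpen_iUnion fun s => isOpen_iUnion fun hs => isOpen_lt continuous_const
    (hS s ⟨hs₀.trans hs.1, hs.2.1⟩)

/-- Suprema over a nonempty set of uniformly close functions are close. -/
theorem abs_sSup_abs_image_sub_lt {Y : Type*} {Q : Set Y} (hQ : Q.Nonempty) {g h : Y → ℝ}
    (hg : BddAbove ((fun y => |g y|) '' Q)) {ρ : ℝ} (hgh : ∀ y ∈ Q, |h y - g y| ≤ ρ) :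
    |sSup ((fun y => |h y|) '' Q) - sSup ((fun y => |g y|) '' Q)| ≤ ρ := by
  have hle : ∀ y ∈ Q, |h y| ≤ sSup ((fun y => |g y|) '' Q) + ρ := fun y hy => by
    have h1 := le_csSup hg ⟨y, hy, rfl⟩
    have h2 := abs_sub_abs_le_abs_sub (h y) (g y)
    have h3 := hgh y hy
    simp only at h1
    linarith
  have hh : BddAbove ((fun y => |h y|) '' Q) :=
    ⟨_, by rintro _ ⟨y, hy, rfl⟩; exact hle y hy⟩
  rw [abs_sub_le_iff]
  constructor
  · rw [sub_le_iff_le_add']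
    exact csSup_le (hQ.image _) (by rintro _ ⟨y, hy, rfl⟩; linarith [hle y hy])
  · rw [sub_le_iff_le_add']
    refine csSup_le (hQ.image _) ?_
    rintro _ ⟨y, hy, rfl⟩
    have h1 := le_csSup hh ⟨y, hy, rfl⟩
    have h2 := abs_sub_abs_le_abs_sub (g y) (h y)
    have h3 := hgh y hy
    rw [abs_sub_comm] at h3
    simp only at h1 ⊢
    linarith

/-! ### Nondegeneracy of the limit -/

/-- Integration by parts against the truncated linear function `z ↦ min t z / t`. -/
theorem mul_min_sub_integral_deriv {G H : ℝ → ℝ} (hG : ∀ x, HasDerivAt G (H x) x)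
    (hH : Continuous H) {t e : ℝ} (ht : 0 < t) (hte : t ≤ e) :
    G e * (min t e / t) - ∫ z in Set.Icc 0 e, H z * (min t z / t) =
      t⁻¹ * ∫ z in (0 : ℝ)..t, G z := by
  have hGc : Continuous G := continuous_iff_continuousAt.2 fun x => (hG x).continuousAt
  have hi : ∀ a b, IntervalIntegrable (fun z => H z * (min t z / t)) volume a b := fun a b =>
    Continuous.intervalIntegrable (by fun_prop) _ _
  rw [integral_Icc_eq_integral_Ioc, ← intervalIntegral.integral_of_le (ht.le.trans hte),
    ← intervalIntegral.integral_add_adjacent_intervals (hi 0 t) (hi t e)]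
  have h1 : ∫ z in (0 : ℝ)..t, H z * (min t z / t) = t⁻¹ * ∫ z in (0 : ℝ)..t, z * H z := by
    rw [← intervalIntegral.integral_const_mul]
    refine intervalIntegral.integral_congr fun z hz => ?_
    rw [Set.uIcc_of_le ht.le] at hz
    simp only [min_eq_right hz.2]
    ring
  have h2 : ∫ z in t..e, H z * (min t z / t) = G e - G t := by
    rw [← intervalIntegral.integral_eq_sub_of_hasDerivAt (fun x _ => hG x)
      (hH.intervalIntegrable _ _)]
    refine intervalIntegral.integral_congr fun z hz => ?_
    rw [Set.uIcc_of_le hte] at hz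
    simp only [min_eq_left hz.1, div_self ht.ne', mul_one]
  have h3 : ∫ z in (0 : ℝ)..t, z * H z = t * G t - 0 * G 0 - ∫ z in (0 : ℝ)..t, 1 * G z :=
    intervalIntegral.integral_mul_deriv_eq_deriv_mul (fun x _ => hasDerivAt_id x)
      (fun x _ => hG x) (continuous_const.intervalIntegrable _ _) (hH.intervalIntegrable _ _)
  rw [h1, h2, h3, min_eq_left hte, div_self ht.ne']
  simp only [one_mul]
  field_simp
  ring

/-! ### The limit field and its continuity -/

/-- The drifted limit with the noise part written as a `sheetIntegral`. -/
def limitField (w τbar : Fin 3 → ℝ) (σ : ℝ) (δ : (Fin 3 → ℝ) → ℝ)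
    (b : (Fin 3 → unitInterval) → ℝ) (s : ℝ) (x : Fin 3 → ℝ) : ℝ :=
  Real.sqrt (∏ j, τbar j) * σ * sheetIntegral (scaledKernel w τbar x)
      (scaledKernelDeriv w τbar x) ![s, 1, 1] (fun z => b (projCube z)) +
    1 / Real.sqrt (∏ j, τbar j) *
      ∫ z in Set.Icc (fun _ => 0) ![s * τbar 0, τbar 1, τbar 2],
        reconKernel w (fun j => x j - z j) * δ z

theorem cons_one_one_mem_Icc {s : ℝ} (hs : s ∈ Set.Icc (0 : ℝ) 1) :
    (![s, 1, 1] : Fin 3 → ℝ) ∈ Set.Icc (fun _ => (0 : ℝ)) (fun _ => 1) := by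
  constructor <;> intro j <;> fin_cases j <;> simp [hs.1, hs.2]

theorem driftedLimit_eq_limitField (w τbar : Fin 3 → ℝ) (σ : ℝ) (δ : (Fin 3 → ℝ) → ℝ)
    {b : SkorohodSpace (Fin 3)} (hb : Continuous b)
    (hb0 : ∀ t : Fin 3 → unitInterval, (∃ j, t j = 0) → b t = 0) {s : ℝ}
    (hs : s ∈ Set.Icc (0 : ℝ) 1) (x : Fin 3 → ℝ) :
    driftedLimit w τbar σ δ b s x = limitField w τbar σ δ b s x := by
  have h := rsIntegralByParts_eq_sheetIntegral (G := scaledKernel w τbar x)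
    (H := scaledKernelDeriv w τbar x) (hasDerivAt_scaledKernel w τbar x)
    (continuous_scaledKernelDeriv_apply w τbar x) (cons_one_one_mem_Icc hs).1
    (b := fun z => b (projCube z)) (hb.comp continuous_projCube).continuousOn (by
      rintro z ⟨j, hj⟩
      refine hb0 _ ⟨j, ?_⟩
      simp [projCube, hj])
  exact congrArg (fun c => Real.sqrt (∏ j, τbar j) * σ * c + _) h

theorem tendsto_sheetIntegral_scaledKernel {α : Type*} {𝓕 : Filter α} [𝓕.IsCountablyGenerated]
    (w : Fin 3 → ℝ) {a' x' e' : α → Fin 3 → ℝ} {a x e : Fin 3 → ℝ}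
    (ha : Tendsto a' 𝓕 (𝓝 a)) (hx : Tendsto x' 𝓕 (𝓝 x)) (he : Tendsto e' 𝓕 (𝓝 e))
    (he1 : ∀ i, e' i ∈ Set.Icc (fun _ => 0) (fun _ => 1))
    (hee : e ∈ Set.Icc (fun _ => 0) (fun _ => 1))
    {b' : α → (Fin 3 → unitInterval) → ℝ} {b : (Fin 3 → unitInterval) → ℝ}
    (hbm : ∀ i, Measurable fun z => b' i (projCube z)) (hbc : Continuous b)
    (hb : TendstoUniformly b' b 𝓕) :
    Tendsto (fun i => sheetIntegral (scaledKernel w (a' i) (x' i))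
        (scaledKernelDeriv w (a' i) (x' i)) (e' i) (fun z => b' i (projCube z))) 𝓕
      (𝓝 (sheetIntegral (scaledKernel w a x) (scaledKernelDeriv w a x) e
        (fun z => b (projCube z)))) := by
  obtain ⟨D, hD⟩ : ∃ D, ∀ t, |b t| ≤ D := by
    obtain ⟨D, hD⟩ := isCompact_univ.exists_bound_of_continuousOn hbc.continuousOn
    exact ⟨D, fun t => hD t (Set.mem_univ t)⟩
  have hK : IsCompact (Metric.closedBall a 1 ×ˢ Metric.closedBall x 1 ×ˢ Set.Icc (0 : ℝ) 1) :=
    (isCompact_closedBall a 1).prod ((isCompact_closedBall x 1).prod isCompact_Icc)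
  -- Scalings and locations eventually stay in compact balls around their limits, which bounds the
  -- kernel derivatives uniformly.
  choose Cj hCj using fun j =>
    hK.exists_bound_of_continuousOn (continuous_scaledKernelDeriv w j).continuousOn
  refine tendsto_sheetIntegral (C := ∑ j, |Cj j|) (D := D + 1) (fun j => ?_)
    (fun i j => continuous_scaledKernelDeriv_apply w _ _ j) ?_ (fun j t _ => ?_) he he1 hee hbm
    ?_ ?_
  · exact ((continuous_scaledKernel w j).tendsto (a, x, e j)).comp
      (ha.prodMk_nhds (hx.prodMk_nhds ((tendsto_pi_nhds.1 he) j)))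
  · filter_upwards [ha.eventually (Metric.closedBall_mem_nhds a one_pos),
      hx.eventually (Metric.closedBall_mem_nhds x one_pos)] with i h1 h2 j t ht
    calc |scaledKernelDeriv w (a' i) (x' i) j t| ≤ Cj j := hCj j (a' i, x' i, t) ⟨h1, h2, ht⟩
      _ ≤ |Cj j| := le_abs_self _
      _ ≤ ∑ j, |Cj j| := Finset.single_le_sum (f := fun j => |Cj j|)
        (fun _ _ => abs_nonneg _) (Finset.mem_univ j)
  · exact ((continuous_scaledKernelDeriv w j).tendsto (a, x, t)).comp
      (ha.prodMk_nhds (hx.prodMk_nhds tendsto_const_nhds))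
  · filter_upwards [Metric.tendstoUniformly_iff.1 hb 1 one_pos] with i hi z _
    have h1 := hi (projCube z)
    rw [dist_comm, Real.dist_eq] at h1
    have h2 := abs_sub_abs_le_abs_sub (b' i (projCube z)) (b (projCube z))
    linarith [hD (projCube z)]
  · intro z _ z' _ hz'
    have h1 : Tendsto (fun i => projCube (z' i)) 𝓕 (𝓝 (projCube z)) :=
      (continuous_projCube.tendsto z).comp hz'
    have h2 := hb.tendsto_comp (x := projCube z) hbc.continuousAt h1
    exact h2

theorem tendsto_cons_one_one {α : Type*} {𝓕 : Filter α} {s' : α → ℝ} {s : ℝ}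
    (hs : Tendsto s' 𝓕 (𝓝 s)) :
    Tendsto (fun i => (![s' i, 1, 1] : Fin 3 → ℝ)) 𝓕 (𝓝 ![s, 1, 1]) := by
  refine tendsto_pi_nhds.2 fun j => ?_
  fin_cases j
  exacts [hs, tendsto_const_nhds, tendsto_const_nhds]

theorem continuous_sheetIntegral_scaledKernel (w τbar : Fin 3 → ℝ) :
    Continuous fun p : (unitInterval × (Fin 3 → unitInterval)) × C(Fin 3 → unitInterval, ℝ) =>
      sheetIntegral (scaledKernel w τbar (blockPoint τbar p.1.1 p.1.2))
        (scaledKernelDeriv w τbar (blockPoint τbar p.1.1 p.1.2)) ![(p.1.1 : ℝ), 1, 1]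
        (fun z => p.2 (projCube z)) := by
  refine continuous_iff_continuousAt.2 fun p => ?_
  refine tendsto_sheetIntegral_scaledKernel w tendsto_const_nhds
    (x' := fun p : (unitInterval × (Fin 3 → unitInterval)) × C(Fin 3 → unitInterval, ℝ) =>
      blockPoint τbar p.1.1 p.1.2) ?_
    (tendsto_cons_one_one (Continuous.tendsto (by fun_prop) p))
    (fun i => cons_one_one_mem_Icc i.1.1.2) (cons_one_one_mem_Icc p.1.1.2)
    (b' := fun p => p.2) (fun i => (i.2.continuous.comp continuous_projCube).measurable)
    p.2.continuous ?_
  · exact ((continuous_blockPoint τbar).comp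
      (f := fun p : (unitInterval × (Fin 3 → unitInterval)) × C(Fin 3 → unitInterval, ℝ) =>
        ((p.1.1 : ℝ), p.1.2)) (by fun_prop)).tendsto p
  · exact ContinuousMap.tendsto_iff_tendstoUniformly.1 (continuous_snd.tendsto p)

/-- A joint limit along `l ×ˢ 𝓝 u`, for every `u`, depends continuously on `u`. -/
theorem continuous_of_tendsto_prod_nhds {ι U : Type*} [TopologicalSpace U] {l : Filter ι} [l.NeBot]
    {F : ι × U → ℝ} {g : U → ℝ} (h : ∀ u, Tendsto F (l ×ˢ 𝓝 u) (𝓝 (g u))) : Continuous g := by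
  refine continuous_iff_continuousAt.2 fun u => ?_
  refine (closed_nhds_basis (g u)).tendsto_right_iff.2 fun V hV => ?_
  obtain ⟨A, hA, W, hW, hAW⟩ := mem_prod_iff.1 ((h u) hV.1)
  filter_upwards [hW] with u' hu'
  refine hV.2.mem_of_tendsto ((h u').comp
    (tendsto_id.prodMk (tendsto_const_nhds (x := u')))) ?_
  filter_upwards [hA] with i hi
  exact hAW ⟨hi, hu'⟩

/-- The hypotheses under which the drift of the detection process converges. -/
structure DriftHypotheses (l : Filter (Fin 3 → ℕ)) (τbar : Fin 3 → ℝ) (τ : Fin 3 → ℕ → ℝ)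
    (δ : (Fin 3 → ℝ) → ℝ) : Prop where
  tendsto_size : ∀ j, Tendsto (fun n : Fin 3 → ℕ => n j) l atTop
  tendsto_horizon : ∀ j, Tendsto (fun n : Fin 3 → ℕ => (n j : ℝ) * τ j (n j)) l (𝓝 (τbar j))
  ae_continuousAt : ∀ᵐ z, z ∈ Set.Icc (fun _ => 0) τbar → ContinuousAt δ z
  bounded : ∃ C : ℝ, ∀ᶠ n in l, ∀ k : Fin 3 → ℕ, (∀ j, k j ≤ n j) →
    |δ (fun j => k j * τ j (n j))| ≤ C

theorem DriftHypotheses.tendsto {l : Filter (Fin 3 → ℕ)} [l.IsCountablyGenerated]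
    {w τbar : Fin 3 → ℝ} (hw : ∀ j, 0 < w j) (hτbar : ∀ j, 0 < τbar j) {τ : Fin 3 → ℕ → ℝ}
    {δ : (Fin 3 → ℝ) → ℝ} (h : DriftHypotheses l τbar τ δ) {α : Type*} {𝓕 : Filter α}
    [𝓕.IsCountablyGenerated] {N : α → Fin 3 → ℕ} (hN : Tendsto N 𝓕 l)
    {u' : α → unitInterval × (Fin 3 → unitInterval)} {u : unitInterval × (Fin 3 → unitInterval)}
    (hu : Tendsto u' 𝓕 (𝓝 u)) :
    Tendsto (fun i => (∏ j, τbar j / N i j) *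
        ∑ k ∈ Finset.Icc (fun _ => 1) ![⌊(N i 0 : ℝ) * (u' i).1⌋₊, N i 1, N i 2],
          reconKernel w (fun j => blockPoint τbar (u' i).1 (u' i).2 j - k j * τ j (N i j)) *
            δ (fun j => k j * τ j (N i j))) 𝓕
      (𝓝 (∫ z in Set.Icc (fun _ => 0) ![u.1 * τbar 0, τbar 1, τbar 2],
        reconKernel w (fun j => blockPoint τbar u.1 u.2 j - z j) * δ z)) := by
  obtain ⟨C, hC⟩ := h.bounded
  refine tendsto_driftSum hw hτbar (fun j => (h.tendsto_size j).comp hN)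
    (τ := fun i j => τ j (N i j)) (fun j => (h.tendsto_horizon j).comp hN) h.ae_continuousAt
    (hN.eventually hC) (fun i => (u' i).1.2) u.1.2.2 ?_
    (x' := fun i => blockPoint τbar (u' i).1 (u' i).2) ?_
  · exact (Continuous.tendsto (f := fun u : unitInterval × (Fin 3 → unitInterval) => (u.1 : ℝ))
      (by fun_prop) u).comp hu
  · exact (((continuous_blockPoint τbar).comp
      (f := fun u : unitInterval × (Fin 3 → unitInterval) => ((u.1 : ℝ), u.2))
      (by fun_prop)).tendsto u).comp hu

theorem DriftHypotheses.continuous_drift {l : Filter (Fin 3 → ℕ)} [l.IsCountablyGenerated]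
    [l.NeBot] {w τbar : Fin 3 → ℝ} (hw : ∀ j, 0 < w j) (hτbar : ∀ j, 0 < τbar j)
    {τ : Fin 3 → ℕ → ℝ} {δ : (Fin 3 → ℝ) → ℝ} (h : DriftHypotheses l τbar τ δ) :
    Continuous fun u : unitInterval × (Fin 3 → unitInterval) =>
      ∫ z in Set.Icc (fun _ => 0) ![u.1 * τbar 0, τbar 1, τbar 2],
        reconKernel w (fun j => blockPoint τbar u.1 u.2 j - z j) * δ z :=
  continuous_of_tendsto_prod_nhds (l := l) fun _ =>
    h.tendsto hw hτbar tendsto_fst tendsto_snd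

theorem DriftHypotheses.continuous_limitField {l : Filter (Fin 3 → ℕ)} [l.IsCountablyGenerated]
    [l.NeBot] {w τbar : Fin 3 → ℝ} (hw : ∀ j, 0 < w j) (hτbar : ∀ j, 0 < τbar j)
    {τ : Fin 3 → ℕ → ℝ} {δ : (Fin 3 → ℝ) → ℝ} (h : DriftHypotheses l τbar τ δ) (σ : ℝ) :
    Continuous fun p : (unitInterval × (Fin 3 → unitInterval)) × C(Fin 3 → unitInterval, ℝ) =>
      limitField w τbar σ δ p.2 p.1.1 (blockPoint τbar p.1.1 p.1.2) :=
  (continuous_const.mul (continuous_sheetIntegral_scaledKernel w τbar)).add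
    (continuous_const.mul ((h.continuous_drift hw hτbar).comp continuous_fst))

/-! ### Convergence of the detection process -/

/-- Writing `l τ = (n τ) (l / n)` absorbs the sampling periods into the kernel scaling, and
splitting `√∏ (n τ)` into `√∏ n` and `√∏ τ` normalises noise and drift together. -/
theorem detectionProcess_eq {Ω : Type*} (ε : (Fin 3 → ℤ) → Ω → ℝ) (w : Fin 3 → ℝ)
    {τ : Fin 3 → ℝ} {τbar : Fin 3 → ℝ} (hτbar : ∀ j, 0 < τbar j)
    {n : Fin 3 → ℕ} (hn : ∀ j, 1 ≤ n j)
    {f f₀ δ : (Fin 3 → ℝ) → ℝ} (hf : ∀ x, f x - f₀ x = δ x / Real.sqrt (∏ j, (n j : ℝ))) (ω : Ω)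
    {s : ℝ} (hs : s ∈ Set.Icc (0 : ℝ) 1) (x : Fin 3 → ℝ) :
    detectionProcess w τ n (noisySamples f τ ε ω) f₀ s x =
      Real.sqrt (∏ j, n j * τ j) *
        (sheetIntegral (scaledKernel w (fun j => n j * τ j) x)
            (scaledKernelDeriv w (fun j => n j * τ j) x) ![(⌊(n 0 : ℝ) * s⌋₊ : ℝ) / n 0, 1, 1]
            (fun z => partialSumProcess ε n ω (projCube z)) +
          (∏ j, τbar j)⁻¹ * ((∏ j, τbar j / n j) *
            ∑ k ∈ Finset.Icc (fun _ => 1) ![⌊(n 0 : ℝ) * s⌋₊, n 1, n 2],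
              reconKernel w (fun j => x j - k j * τ j) * δ (fun j => k j * τ j))) := by
  have hn0 : ∀ j, (0 : ℝ) < n j := fun j => by exact_mod_cast hn j
  have hT : 0 < ∏ j, τbar j := Finset.prod_pos fun j _ => hτbar j
  have hNp : 0 < ∏ j, (n j : ℝ) := Finset.prod_pos fun j _ => hn0 j
  have hfl : (⌊(n 0 : ℝ) * s⌋₊ : ℝ) / n 0 ∈ Set.Icc (0 : ℝ) 1 := by
    refine ⟨by positivity, div_le_one_of_le₀ ?_ (hn0 0).le⟩
    exact (Nat.floor_le (mul_nonneg (hn0 0).le hs.1)).trans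
      (mul_le_of_le_one_right (hn0 0).le hs.2)
  have he := cons_one_one_mem_Icc hfl
  have hsheet : sheetIntegral (scaledKernel w (fun j => n j * τ j) x)
      (scaledKernelDeriv w (fun j => n j * τ j) x) ![(⌊(n 0 : ℝ) * s⌋₊ : ℝ) / n 0, 1, 1]
      (fun z => partialSumProcess ε n ω (projCube z)) =
      (Real.sqrt (∏ j, (n j : ℝ)))⁻¹ *
        ∑ k ∈ Finset.Icc (fun _ => 1) ![⌊(n 0 : ℝ) * s⌋₊, n 1, n 2],
          ε (fun j => (k j : ℤ)) ω * reconKernel w (fun j => x j - k j * τ j) := by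
    have h1 := sheetIntegral_lattice_sum
      (hasDerivAt_scaledKernel w (fun j => n j * τ j) x)
      (continuous_scaledKernelDeriv_apply w (fun j => n j * τ j) x) hn
      (m := ![⌊(n 0 : ℝ) * s⌋₊, n 1, n 2]) (e := ![(⌊(n 0 : ℝ) * s⌋₊ : ℝ) / n 0, 1, 1])
      (by
        intro j
        fin_cases j
        · rfl
        · exact (div_self (hn0 1).ne').symm
        · exact (div_self (hn0 2).ne').symm) (fun k => ε (fun j => (k j : ℤ)) ω)
    have h2 : ∀ k : Fin 3 → ℕ, ∏ j, scaledKernel w (fun j => n j * τ j) x j (k j / n j) =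
        reconKernel w (fun j => x j - k j * τ j) := by
      intro k
      refine Finset.prod_congr rfl fun j _ => ?_
      have : (n j : ℝ) * τ j * (k j / n j) = k j * τ j := by
        field_simp [(hn0 j).ne']
      simp only [scaledKernel, this]
    simp only [h2] at h1
    rw [← h1, ← sheetIntegral_const_mul]
    refine sheetIntegral_congr he.1 fun z hz => ?_
    have hz1 : z ∈ Set.Icc (fun _ => (0 : ℝ)) (fun _ => 1) := ⟨hz.1, hz.2.trans he.2⟩
    show (Real.sqrt (∏ j, (n j : ℝ)))⁻¹ * ∑ i ∈ Finset.Icc (fun _ => 1)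
      (fun j => ⌊(n j : ℝ) * projCube z j⌋₊), ε (fun j => (i j : ℤ)) ω = _
    simp only [coe_projCube hz1]
  rw [hsheet]
  have hsqrt : Real.sqrt (∏ j, n j * τ j) = Real.sqrt (∏ j, (n j : ℝ)) * Real.sqrt (∏ j, τ j) := by
    rw [Finset.prod_mul_distrib, Real.sqrt_mul hNp.le]
  have hdiv : ∏ j, τbar j / (n j : ℝ) = (∏ j, τbar j) / ∏ j, (n j : ℝ) :=
    Finset.prod_div_distrib _ _
  have hS : Real.sqrt (∏ j, (n j : ℝ)) ≠ 0 := (Real.sqrt_pos.2 hNp).ne'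
  have hSS : ∏ j, (n j : ℝ) = Real.sqrt (∏ j, (n j : ℝ)) * Real.sqrt (∏ j, (n j : ℝ)) :=
    (Real.mul_self_sqrt hNp.le).symm
  rw [hsqrt, hdiv, detectionProcess]
  set S := Real.sqrt (∏ j, (n j : ℝ))
  rw [hSS]
  have hsum : ∀ k : Fin 3 → ℕ, (noisySamples f τ ε ω k - f₀ (fun j => k j * τ j)) *
      reconKernel w (fun j => x j - k j * τ j) =
      ε (fun j => (k j : ℤ)) ω * reconKernel w (fun j => x j - k j * τ j) +
        S⁻¹ * (reconKernel w (fun j => x j - k j * τ j) * δ (fun j => k j * τ j)) := by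
    intro k
    have := hf (fun j => k j * τ j)
    rw [noisySamples, add_sub_right_comm, this]
    ring
  simp only [hsum, Finset.sum_add_distrib, ← Finset.mul_sum]
  field_simp

theorem measurable_partialSumProcess_projCube {Ω : Type*} (ε : (Fin 3 → ℤ) → Ω → ℝ)
    (n : Fin 3 → ℕ) (ω : Ω) : Measurable fun z => partialSumProcess ε n ω (projCube z) := by
  have h : Measurable fun z : Fin 3 → ℝ => fun j => ⌊(n j : ℝ) * (projCube z j : ℝ)⌋₊ := by
    refine measurable_pi_lambda _ fun j => Nat.measurable_floor.comp ?_
    exact Continuous.measurable (continuous_const.mul (continuous_subtype_val.comp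
      ((continuous_apply j).comp continuous_projCube)))
  exact (Measurable.of_discrete (f := fun m : Fin 3 → ℕ => (Real.sqrt (∏ j, (n j : ℝ)))⁻¹ *
      ∑ i ∈ Finset.Icc (fun _ => 1) m, ε (fun j => (i j : ℤ)) ω)).comp h

/-- The filter expresses convergence for every `ω`, as `n` grows, the partial sum process approaches
`σ • b` and the parameter approaches `u`; no probability is involved. -/
theorem DriftHypotheses.tendsto_detection {Ω : Type*} {l : Filter (Fin 3 → ℕ)}
    [l.IsCountablyGenerated] {w τbar : Fin 3 → ℝ} (hw : ∀ j, 0 < w j) (hτbar : ∀ j, 0 < τbar j)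
    {τ : Fin 3 → ℕ → ℝ} {δ : (Fin 3 → ℝ) → ℝ}
    (h : DriftHypotheses l τbar τ δ) {f : (Fin 3 → ℕ) → (Fin 3 → ℝ) → ℝ} {f₀ : (Fin 3 → ℝ) → ℝ}
    (hf : ∀ᶠ n in l, ∀ x, f n x - f₀ x = δ x / Real.sqrt (∏ j, (n j : ℝ)))
    (ε : (Fin 3 → ℤ) → Ω → ℝ) (σ : ℝ) {b : SkorohodSpace (Fin 3)} (hb : Continuous b)
    (u : unitInterval × (Fin 3 → unitInterval)) :
    Tendsto (fun q : ((Fin 3 → ℕ) × Ω) × (unitInterval × (Fin 3 → unitInterval)) =>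
        detectionProcess w (fun j => τ j (q.1.1 j)) q.1.1
          (noisySamples (f q.1.1) (fun j => τ j (q.1.1 j)) ε q.1.2) f₀ q.2.1
          (blockPoint τbar q.2.1 q.2.2))
      (comap (fun p : (Fin 3 → ℕ) × Ω => (p.1, partialSumProcess ε p.1 p.2))
        (l ×ˢ 𝓝 (σ • b)) ×ˢ 𝓝 u)
      (𝓝 (limitField w τbar σ δ b u.1 (blockPoint τbar u.1 u.2))) := by
  set 𝓕 := comap (fun p : (Fin 3 → ℕ) × Ω => (p.1, partialSumProcess ε p.1 p.2))
    (l ×ˢ 𝓝 (σ • b)) with h𝓕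
  have hc : Tendsto (fun p : (Fin 3 → ℕ) × Ω => (p.1, partialSumProcess ε p.1 p.2)) 𝓕
      (l ×ˢ 𝓝 (σ • b)) := tendsto_comap
  have hN : Tendsto (fun q : ((Fin 3 → ℕ) × Ω) × (unitInterval × (Fin 3 → unitInterval)) =>
      q.1.1) (𝓕 ×ˢ 𝓝 u) l := (tendsto_fst.comp hc).comp tendsto_fst
  have hZ : Tendsto (fun q : ((Fin 3 → ℕ) × Ω) × (unitInterval × (Fin 3 → unitInterval)) =>
      partialSumProcess ε q.1.1 q.1.2) (𝓕 ×ˢ 𝓝 u) (𝓝 (σ • b)) :=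
    (tendsto_snd.comp hc).comp tendsto_fst
  have hσb : Continuous (σ • b : SkorohodSpace (Fin 3)) := continuous_const.mul hb
  have hunif : TendstoUniformly
      (fun (q : ((Fin 3 → ℕ) × Ω) × (unitInterval × (Fin 3 → unitInterval))) t =>
        partialSumProcess ε q.1.1 q.1.2 t) (σ • b : SkorohodSpace (Fin 3)) (𝓕 ×ˢ 𝓝 u) := by
    rw [Metric.tendstoUniformly_iff]
    intro ρ hρ
    exact hZ.eventually
      (Metric.tendstoUniformly_iff.1 (SkorohodSpace.tendsto_apply_of_continuous hσb) ρ hρ)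
  have hs : Tendsto (fun q : ((Fin 3 → ℕ) × Ω) × (unitInterval × (Fin 3 → unitInterval)) =>
      (q.2.1 : ℝ)) (𝓕 ×ˢ 𝓝 u) (𝓝 u.1) :=
    (Continuous.tendsto (f := fun u : unitInterval × (Fin 3 → unitInterval) => (u.1 : ℝ))
      (by fun_prop) u).comp tendsto_snd
  have hx : Tendsto (fun q : ((Fin 3 → ℕ) × Ω) × (unitInterval × (Fin 3 → unitInterval)) =>
      blockPoint τbar q.2.1 q.2.2) (𝓕 ×ˢ 𝓝 u) (𝓝 (blockPoint τbar u.1 u.2)) :=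
    (((continuous_blockPoint τbar).comp
      (f := fun u : unitInterval × (Fin 3 → unitInterval) => ((u.1 : ℝ), u.2))
      (by fun_prop)).tendsto u).comp tendsto_snd
  have ha : Tendsto (fun q : ((Fin 3 → ℕ) × Ω) × (unitInterval × (Fin 3 → unitInterval)) =>
      fun j => (q.1.1 j : ℝ) * τ j (q.1.1 j)) (𝓕 ×ˢ 𝓝 u) (𝓝 τbar) :=
    tendsto_pi_nhds.2 fun j => (h.tendsto_horizon j).comp hN
  have hnoise := tendsto_sheetIntegral_scaledKernel w ha hx
    (tendsto_cons_one_one (tendsto_floor_mul_div ((h.tendsto_size 0).comp hN)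
      (s' := fun q => (q.2.1 : ℝ)) (fun q => q.2.1.2.1) hs))
    (fun q => cons_one_one_mem_Icc ⟨by positivity, div_le_one_of_le₀
      ((Nat.floor_le (mul_nonneg (Nat.cast_nonneg _) q.2.1.2.1)).trans
        (mul_le_of_le_one_right (Nat.cast_nonneg _) q.2.1.2.2)) (Nat.cast_nonneg _)⟩)
    (cons_one_one_mem_Icc u.1.2)
    (fun q => measurable_partialSumProcess_projCube ε q.1.1 q.1.2) hσb hunif
  have hdrift := h.tendsto hw hτbar hN (tendsto_snd (f := 𝓕) (g := 𝓝 u))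
  have hsq : Tendsto (fun q : ((Fin 3 → ℕ) × Ω) × (unitInterval × (Fin 3 → unitInterval)) =>
      Real.sqrt (∏ j, (q.1.1 j : ℝ) * τ j (q.1.1 j))) (𝓕 ×ˢ 𝓝 u)
      (𝓝 (Real.sqrt (∏ j, τbar j))) :=
    (Real.continuous_sqrt.tendsto _).comp
      (tendsto_finsetProd _ fun j _ => (tendsto_pi_nhds.1 ha) j)
  have hlim := hsq.mul (hnoise.add (hdrift.const_mul (∏ j, τbar j)⁻¹))
  have hT : 0 < ∏ j, τbar j := Finset.prod_pos fun j _ => hτbar j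
  have hval : Real.sqrt (∏ j, τbar j) * (sheetIntegral (scaledKernel w τbar
      (blockPoint τbar u.1 u.2)) (scaledKernelDeriv w τbar (blockPoint τbar u.1 u.2))
      ![(u.1 : ℝ), 1, 1] (fun z => (σ • b : SkorohodSpace (Fin 3)) (projCube z)) +
      (∏ j, τbar j)⁻¹ * ∫ z in Set.Icc (fun _ => 0) ![u.1 * τbar 0, τbar 1, τbar 2],
        reconKernel w (fun j => blockPoint τbar u.1 u.2 j - z j) * δ z) =
      limitField w τbar σ δ b u.1 (blockPoint τbar u.1 u.2) := by
    have h1 := sheetIntegral_const_mul (scaledKernel w τbar (blockPoint τbar u.1 u.2))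
      (scaledKernelDeriv w τbar (blockPoint τbar u.1 u.2)) ![(u.1 : ℝ), 1, 1] σ
      (fun z => b (projCube z))
    have h2 : (fun z => (σ • b : SkorohodSpace (Fin 3)) (projCube z)) =
      fun z => σ * b (projCube z) := rfl
    rw [h2, h1, limitField]
    have hTT : (∏ j, τbar j)⁻¹ = (Real.sqrt (∏ j, τbar j))⁻¹ * (Real.sqrt (∏ j, τbar j))⁻¹ := by
      rw [← mul_inv, Real.mul_self_sqrt hT.le]
    have hT0 : Real.sqrt (∏ j, τbar j) ≠ 0 := (Real.sqrt_pos.2 hT).ne'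
    rw [hTT]
    field_simp
  rw [hval] at hlim
  refine hlim.congr' ?_
  have hpos : ∀ᶠ n in l, ∀ j, 1 ≤ n j :=
    eventually_all.2 fun j => (h.tendsto_size j).eventually (eventually_ge_atTop 1)
  filter_upwards [hN.eventually hf, hN.eventually hpos] with q hq1 hq2
  exact (detectionProcess_eq ε w hτbar hq2 hq1 q.1.2 q.2.1.2 _).symm

/-! ### The noise part of the limit as a linear functional of the path -/

/-- The noise part of the limit field at a point of the parameter space. -/
def sheetFunctional (w τbar : Fin 3 → ℝ) (σ : ℝ) (u : unitInterval × (Fin 3 → unitInterval)) :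
    C(Fin 3 → unitInterval, ℝ) →ₗ[ℝ] ℝ where
  toFun b := Real.sqrt (∏ j, τbar j) * σ *
    sheetIntegral (scaledKernel w τbar (blockPoint τbar u.1 u.2))
      (scaledKernelDeriv w τbar (blockPoint τbar u.1 u.2)) ![(u.1 : ℝ), 1, 1]
      (fun z => b (projCube z))
  map_add' b b' := by
    have hm : ∀ c : C(Fin 3 → unitInterval, ℝ), Measurable fun z => c (projCube z) := fun c =>
      (c.continuous.comp continuous_projCube).measurable
    have hC : ∀ c : C(Fin 3 → unitInterval, ℝ), ∃ C, ∀ z ∈ Set.Icc (fun _ => 0) ![(u.1 : ℝ), 1, 1],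
        |c (projCube z)| ≤ C := fun c => ⟨‖c‖, fun z _ => c.norm_coe_le_norm _⟩
    have h := sheetIntegral_finset_sum (Finset.univ : Finset (Fin 2))
      (G := scaledKernel w τbar (blockPoint τbar u.1 u.2))
      (continuous_scaledKernelDeriv_apply w τbar (blockPoint τbar u.1 u.2))
      (cons_one_one_mem_Icc u.1.2).1 (b := fun k z => (![b, b'] k) (projCube z))
      (fun k _ => hm _) (fun k _ => hC _)
    simp only [Fin.sum_univ_two, Matrix.cons_val_zero, Matrix.cons_val_one] at h
    simp only [ContinuousMap.add_apply, h, mul_add]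
  map_smul' r b := by
    have h := sheetIntegral_const_mul (scaledKernel w τbar (blockPoint τbar u.1 u.2))
      (scaledKernelDeriv w τbar (blockPoint τbar u.1 u.2)) ![(u.1 : ℝ), 1, 1] r
      (fun z => b (projCube z))
    simp only [ContinuousMap.smul_apply, smul_eq_mul, h, RingHom.id_apply]
    ring

theorem continuous_sheetFunctional (w τbar : Fin 3 → ℝ) (σ : ℝ) :
    Continuous fun p : (unitInterval × (Fin 3 → unitInterval)) × C(Fin 3 → unitInterval, ℝ) =>
      sheetFunctional w τbar σ p.1 p.2 :=
  continuous_const.mul (continuous_sheetIntegral_scaledKernel w τbar)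

theorem sheetFunctional_add_drift (w τbar : Fin 3 → ℝ) (σ : ℝ) (δ : (Fin 3 → ℝ) → ℝ)
    (u : unitInterval × (Fin 3 → unitInterval)) (b : C(Fin 3 → unitInterval, ℝ)) :
    sheetFunctional w τbar σ u b + 1 / Real.sqrt (∏ j, τbar j) *
        ∫ z in Set.Icc (fun _ => 0) ![u.1 * τbar 0, τbar 1, τbar 2],
          reconKernel w (fun j => blockPoint τbar u.1 u.2 j - z j) * δ z =
      limitField w τbar σ δ b u.1 (blockPoint τbar u.1 u.2) :=
  rfl

theorem exists_sheetFunctional_sheetDirection_ne_zero {w τbar : Fin 3 → ℝ} (hw : ∀ j, 0 < w j)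
    (hτbar : ∀ j, 0 < τbar j) {σ : ℝ} (hσ : 0 < σ) {u : unitInterval × (Fin 3 → unitInterval)}
    (hu : 0 < (u.1 : ℝ)) :
    ∃ t : Fin 3 → unitInterval, (∀ j, 0 < t j) ∧
      sheetFunctional w τbar σ u (sheetDirection t) ≠ 0 := by
  -- Each `r j` is taken below the time `u.1`, hence below every corner coordinate, as integration
  -- by parts against the truncated linear function requires. This is where positive time is needed.
  choose r hr hne using fun j =>
    exists_integral_sincKernel_ne_zero (hw j) (hτbar j) (blockPoint τbar u.1 u.2 j) hu
  have hr1 : ∀ j, r j ≤ 1 := fun j => (hr j).2.le.trans u.1.2.2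
  have hre : ∀ j, r j ≤ (![(u.1 : ℝ), 1, 1] : Fin 3 → ℝ) j := by
    intro j
    fin_cases j
    exacts [(hr 0).2.le, hr1 1, hr1 2]
  set t : Fin 3 → unitInterval := fun j => ⟨r j, (hr j).1.le, hr1 j⟩ with ht
  refine ⟨t, fun j => (hr j).1, ?_⟩
  have he := cons_one_one_mem_Icc u.1.2
  have hcongr := sheetIntegral_congr (G := scaledKernel w τbar (blockPoint τbar u.1 u.2))
    (H := scaledKernelDeriv w τbar (blockPoint τbar u.1 u.2)) he.1
    (b := fun z => sheetDirection t (projCube z))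
    (b' := fun z => ∏ j, min (r j) (z j) / r j) (fun z hz => by
      have hz1 : z ∈ Set.Icc (fun _ => (0 : ℝ)) (fun _ => 1) := ⟨hz.1, hz.2.trans he.2⟩
      show ∏ j, min (t j : ℝ) (projCube z j) / t j = _
      simp only [coe_projCube hz1, ht])
  show Real.sqrt (∏ j, τbar j) * σ * sheetIntegral _ _ _
    (fun z => sheetDirection t (projCube z)) ≠ 0
  rw [hcongr, sheetIntegral_prod _ _ _ (fun j z => min (r j) z / r j)]
  have hT : 0 < ∏ j, τbar j := Finset.prod_pos fun j _ => hτbar j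
  refine mul_ne_zero (mul_pos (Real.sqrt_pos.2 hT) hσ).ne' (Finset.prod_ne_zero_iff.2 fun j _ => ?_)
  rw [mul_min_sub_integral_deriv (hasDerivAt_scaledKernel w τbar _ j)
    (continuous_scaledKernelDeriv_apply w τbar _ j) (hr j).1 (hre j)]
  exact mul_ne_zero (inv_ne_zero (hr j).1.ne') (hne j)

attribute [irreducible] sheetFunctional

/-! ### Convergence of the detectors -/

theorem continuous_detection (w τ : Fin 3 → ℝ) (n : Fin 3 → ℕ) (f f₀ : (Fin 3 → ℝ) → ℝ)
    (s : ℝ) : Continuous fun p : ((Fin 3 → ℤ) → ℝ) × (Fin 3 → ℝ) =>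
      detectionProcess w τ n (fun l => f (fun j => l j * τ j) + p.1 (fun j => (l j : ℤ))) f₀ s
        p.2 := by
  refine continuous_const.mul (continuous_finsetSum _ fun l _ => Continuous.mul ?_ ?_)
  · fun_prop
  · exact (continuous_reconKernel w).comp (by fun_prop)

/-- The statistic, a supremum over a compact set, is continuous in the whole noise array, so the
alarm time is a measurable function of that array. -/
theorem aemeasurable_firstAlarm_noisySamples {Ω : Type*} [MeasurableSpace Ω] {P : Measure Ω}
    {ε : (Fin 3 → ℤ) → Ω → ℝ} (hε : ∀ i, AEMeasurable (ε i) P) (w τ τbar : Fin 3 → ℝ)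
    (n : Fin 3 → ℕ) (f f₀ : (Fin 3 → ℝ) → ℝ) {Q : Set (Fin 3 → unitInterval)} (hQ : IsClosed Q)
    (s₀ c : ℝ) : AEMeasurable (fun ω => firstAlarm s₀ c (n 0)
      (blockStat Q τbar (detectionProcess w τ n (noisySamples f τ ε ω) f₀))) P := by
  have hS : ∀ s ∈ Set.Icc (0 : ℝ) 1, Continuous fun v : (Fin 3 → ℤ) → ℝ =>
      blockStat Q τbar (detectionProcess w τ n
        (fun l => f (fun j => l j * τ j) + v (fun j => (l j : ℤ))) f₀) s := by
    intro s _
    refine hQ.isCompact.continuous_sSup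
      (f := fun (v : (Fin 3 → ℤ) → ℝ) y => abs (detectionProcess w τ n
        (fun l => f (fun j => l j * τ j) + v (fun j => (l j : ℤ))) f₀ s (blockPoint τbar s y))) ?_
    have h1 : Continuous fun p : ((Fin 3 → ℤ) → ℝ) × (Fin 3 → unitInterval) =>
        (p.1, blockPoint τbar s p.2) := continuous_fst.prodMk
      ((continuous_blockPoint τbar).comp
        (f := fun p : ((Fin 3 → ℤ) → ℝ) × (Fin 3 → unitInterval) => (s, p.2)) (by fun_prop))
    have h2 := ((continuous_detection w τ n f f₀ s).comp h1).abs
    exact h2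
  have hm : Measurable fun v : (Fin 3 → ℤ) → ℝ => firstAlarm s₀ c (n 0)
      (blockStat Q τbar (detectionProcess w τ n
        (fun l => f (fun j => l j * τ j) + v (fun j => (l j : ℤ))) f₀)) := measurable_firstAlarm hS
  have he : AEMeasurable (fun ω i => ε i ω) P := aemeasurable_pi_iff.2 hε
  have h3 := hm.comp_aemeasurable he
  simp only [Function.comp_def] at h3
  exact h3

theorem continuous_blockStat {E : Type*} [TopologicalSpace E] {Q : Set (Fin 3 → unitInterval)}
    (hQ : IsClosed Q) {τbar : Fin 3 → ℝ} {G : E → ℝ → (Fin 3 → ℝ) → ℝ}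
    (hG : Continuous fun p : (unitInterval × (Fin 3 → unitInterval)) × E =>
      G p.2 p.1.1 (blockPoint τbar p.1.1 p.1.2)) :
    Continuous fun p : E × unitInterval => blockStat Q τbar (G p.1) p.2 := by
  refine hQ.isCompact.continuous_sSup
    (f := fun (p : E × unitInterval) y => |G p.1 p.2 (blockPoint τbar p.2 y)|) ?_
  exact (hG.comp (f := fun p : (E × unitInterval) × (Fin 3 → unitInterval) =>
    ((p.1.2, p.2), p.1.1)) (by fun_prop)).abs

/-- Almost surely the limiting statistic does not reach the level `c` without exceeding it. -/
theorem ae_not_touch_level {Ω' : Type*} [MeasurableSpace Ω'] {P' : Measure Ω'}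
    [IsProbabilityMeasure P']
    {w τbar : Fin 3 → ℝ} (hw : ∀ j, 0 < w j) (hτbar : ∀ j, 0 < τbar j) {σ : ℝ} (hσ : 0 < σ)
    {B : Ω' → SkorohodSpace (Fin 3)} (hB : IsBrownianSheet B P') {δ : (Fin 3 → ℝ) → ℝ}
    (hlf : Continuous fun p : (unitInterval × (Fin 3 → unitInterval)) ×
      C(Fin 3 → unitInterval, ℝ) => limitField w τbar σ δ p.2 p.1.1 (blockPoint τbar p.1.1 p.1.2))
    {s₀ : ℝ} (hs₀ : 0 < s₀) (c : ℝ) {Q : Set (Fin 3 → unitInterval)} (hQ : IsClosed Q)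
    (hQne : Q.Nonempty) {q : ℝ} (hq : q ≤ 1) :
    ∀ᵐ ω ∂P', ∀ b : C(Fin 3 → unitInterval, ℝ), (∀ t, b t = B ω t) →
      ¬ ((∀ s ∈ Set.Icc s₀ q, blockStat Q τbar (limitField w τbar σ δ b) s ≤ c) ∧
        ∃ s ∈ Set.Icc s₀ q, blockStat Q τbar (limitField w τbar σ δ b) s = c) := by
  -- The supremum over times of the statistic is a single supremum over time-location pairs in `K`.
  set K : Set (unitInterval × (Fin 3 → unitInterval)) :=
    {u | (u.1 : ℝ) ∈ Set.Icc s₀ q ∧ u.2 ∈ Q} with hK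
  have hKc : IsClosed K := (isClosed_Icc.preimage (f := fun u : unitInterval ×
    (Fin 3 → unitInterval) => (u.1 : ℝ)) (by fun_prop)).inter (hQ.preimage continuous_snd)
  have hΦ : ∀ u, Continuous (sheetFunctional w τbar σ u) := fun u =>
    (continuous_sheetFunctional w τbar σ).comp (Continuous.prodMk_right u)
  have hΦu : ∀ t, Continuous fun u => sheetFunctional w τbar σ u (sheetDirection t) := fun t =>
    (continuous_sheetFunctional w τbar σ).comp (Continuous.prodMk_left _)
  have h := hB.ae_not_sup_abs_eq (sheetFunctional w τbar σ) hΦ hΦu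
    (fun u => 1 / Real.sqrt (∏ j, τbar j) *
      ∫ z in Set.Icc (fun _ => 0) ![u.1 * τbar 0, τbar 1, τbar 2],
        reconKernel w (fun j => blockPoint τbar u.1 u.2 j - z j) * δ z) c (K := K)
    (fun u hu => exists_sheetFunctional_sheetDirection_ne_zero hw hτbar hσ
      (hs₀.trans_le (hKc.closure_subset hu).1.1))
  simp only [sheetFunctional_add_drift] at h
  filter_upwards [h] with ω hω b hb ⟨hle, s, hs, hsc⟩
  have hcont : ∀ s : unitInterval, Continuous fun y =>
      |limitField w τbar σ δ b s (blockPoint τbar s y)| := fun s =>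
    (hlf.comp (f := fun y : Fin 3 → unitInterval => ((s, y), b)) (by fun_prop)).abs
  refine hω b hb ⟨fun u hu => ?_, ?_⟩
  · refine le_trans ?_ (hle u.1 hu.1)
    exact le_csSup (hQ.isCompact.image (hcont u.1)).bddAbove ⟨u.2, hu.2, rfl⟩
  · obtain ⟨y, hy, hyc⟩ := hQ.isCompact.exists_sSup_image_eq hQne
      (hcont ⟨s, hs₀.le.trans hs.1, hs.2.trans hq⟩).continuousOn
    exact ⟨(⟨s, hs₀.le.trans hs.1, hs.2.trans hq⟩, y), ⟨hs, hy⟩, hyc.symm.trans hsc⟩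

theorem tendstoInDistribution_firstAlarm_blockStat {Ω Ω' : Type*} [MeasurableSpace Ω]
    [MeasurableSpace Ω'] {P : Measure Ω} [IsProbabilityMeasure P] {P' : Measure Ω'}
    [IsProbabilityMeasure P'] {l : Filter (Fin 3 → ℕ)} [l.IsCountablyGenerated] [l.NeBot]
    {w τbar : Fin 3 → ℝ} (hw : ∀ j, 0 < w j) (hτbar : ∀ j, 0 < τbar j)
    {τ : Fin 3 → ℕ → ℝ} {δ : (Fin 3 → ℝ) → ℝ} (h : DriftHypotheses l τbar τ δ)
    {f : (Fin 3 → ℕ) → (Fin 3 → ℝ) → ℝ} {f₀ : (Fin 3 → ℝ) → ℝ}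
    (hf : ∀ᶠ n in l, ∀ x, f n x - f₀ x = δ x / Real.sqrt (∏ j, (n j : ℝ)))
    {ε : (Fin 3 → ℤ) → Ω → ℝ} (hε : ∀ i, AEMeasurable (ε i) P) {σ : ℝ} (hσ : 0 < σ)
    {B : Ω' → SkorohodSpace (Fin 3)} (hB : IsBrownianSheet B P')
    (hclt : TendstoInDistribution (fun n : Fin 3 → ℕ => partialSumProcess ε n) l
      (fun ω' => σ • B ω') (fun _ => P) P')
    {s₀ : ℝ} (hs₀ : s₀ ∈ Set.Ioo (0 : ℝ) 1) (c : ℝ) {Q : Set (Fin 3 → unitInterval)}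
    (hQ : IsClosed Q) (hQne : Q.Nonempty) :
    TendstoInDistribution
      (fun (n : Fin 3 → ℕ) (ω : Ω) => firstAlarm s₀ c (n 0) (blockStat Q τbar
        (detectionProcess w (fun j => τ j (n j)) n
          (noisySamples (f n) (fun j => τ j (n j)) ε ω) f₀)) / (n 0 : ℝ≥0∞))
      l
      (fun ω' => passageTime s₀ c (blockStat Q τbar (driftedLimit w τbar σ δ (B ω'))))
      (fun _ => P) P' := by
  let _ : MeasurableSpace C(Fin 3 → unitInterval, ℝ) := borel _
  have _ : BorelSpace C(Fin 3 → unitInterval, ℝ) := ⟨rfl⟩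
  obtain ⟨X, hXm, hX⟩ := hB.exists_continuousMap
  have hlf := h.continuous_limitField hw hτbar σ
  have hstat := continuous_blockStat hQ (τbar := τbar)
    (G := fun b : C(Fin 3 → unitInterval, ℝ) => limitField w τbar σ δ b) hlf
  have hSc : ∀ b : C(Fin 3 → unitInterval, ℝ),
      ContinuousOn (blockStat Q τbar (limitField w τbar σ δ b)) (Set.Icc 0 1) := fun b =>
    continuousOn_iff_continuous_domRestrict.2
      (hstat.comp (f := fun s : unitInterval => (b, s)) (by fun_prop))
  have hlim : ∀ᵐ ω' ∂P', ∀ s ∈ Set.Icc (0 : ℝ) 1,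
      blockStat Q τbar (driftedLimit w τbar σ δ (B ω')) s =
        blockStat Q τbar (limitField w τbar σ δ (X ω')) s := by
    filter_upwards [hB.ae_continuous, hB.ae_forall_eq_zero, hX] with ω' h1 h2 h3 s hs
    have h4 : (fun t => B ω' t) = fun t => X ω' t := funext fun t => (h3 t).symm
    simp only [blockStat, driftedLimit_eq_limitField w τbar σ δ h1 h2 hs]
    rw [show (B ω' : (Fin 3 → unitInterval) → ℝ) = X ω' from h4]
  have hstick : ∀ᵐ ω' ∂P', ∀ q : ℝ, q ∈ Set.Icc s₀ 1 → (q = 1 ∨ ∃ r : ℚ, (r : ℝ) = q) →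
      ¬ ((∀ s ∈ Set.Icc s₀ q, blockStat Q τbar (limitField w τbar σ δ (X ω')) s ≤ c) ∧
        ∃ s ∈ Set.Icc s₀ q, blockStat Q τbar (limitField w τbar σ δ (X ω')) s = c) := by
    have h1 := ae_not_touch_level hw hτbar hσ hB hlf hs₀.1 c hQ hQne le_rfl
    have h2 := ae_all_iff.2 fun r : {r : ℚ // (r : ℝ) ≤ 1} =>
      ae_not_touch_level hw hτbar hσ hB hlf hs₀.1 c hQ hQne r.2
    filter_upwards [h1, h2, hX] with ω' h1 h2 h3 q hq hqr
    rcases hqr with rfl | ⟨r, rfl⟩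
    · exact h1 (X ω') h3
    · exact h2 ⟨r, hq.2⟩ (X ω') h3
  refine TendstoInDistribution.of_tendsto_comap hclt (fun n => ?_) ?_ ?_
  · exact (aemeasurable_firstAlarm_noisySamples hε w _ τbar n (f n) f₀ hQ s₀ c).mul_const
      (n 0 : ℝ≥0∞)⁻¹
  · have hm := measurable_passageTime (E := C(Fin 3 → unitInterval, ℝ)) (c := c) hs₀.1.le
      (S := fun b => blockStat Q τbar (limitField w τbar σ δ b))
      (fun s hs => hstat.comp (f := fun b => (b, (⟨s, hs⟩ : unitInterval))) (by fun_prop))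
    refine (hm.comp_aemeasurable hXm).congr ?_
    filter_upwards [hlim] with ω' hω'
    exact (passageTime_congr hs₀.1.le hω').symm
  · filter_upwards [hB.ae_continuous, hX, hlim, hstick] with ω' h1 h2 h3 h4
    rw [passageTime_congr hs₀.1.le h3]
    have hBX : (B ω' : (Fin 3 → unitInterval) → ℝ) = X ω' := funext fun t => (h2 t).symm
    have hg : Continuous fun u : unitInterval × (Fin 3 → unitInterval) =>
        limitField w τbar σ δ (X ω') u.1 (blockPoint τbar u.1 u.2) :=
      hlf.comp (f := fun u => (u, X ω')) (by fun_prop)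
    set 𝓕 := comap (fun p : (Fin 3 → ℕ) × Ω => (p.1, partialSumProcess ε p.1 p.2))
      (l ×ˢ 𝓝 (σ • B ω')) with h𝓕
    have hc : Tendsto (fun p : (Fin 3 → ℕ) × Ω => (p.1, partialSumProcess ε p.1 p.2)) 𝓕
      (l ×ˢ 𝓝 (σ • B ω')) := tendsto_comap
    -- Joint convergence at every parameter, with a continuous limit, is locally uniform; the
    -- parameter cube is compact.
    have hunif : TendstoUniformly
        (fun (p : (Fin 3 → ℕ) × Ω) (u : unitInterval × (Fin 3 → unitInterval)) =>
          detectionProcess w (fun j => τ j (p.1 j)) p.1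
            (noisySamples (f p.1) (fun j => τ j (p.1 j)) ε p.2) f₀ u.1 (blockPoint τbar u.1 u.2))
        (fun u => limitField w τbar σ δ (X ω') u.1 (blockPoint τbar u.1 u.2)) 𝓕 := by
      rw [← tendstoLocallyUniformly_iff_tendstoUniformly_of_compactSpace,
        tendstoLocallyUniformly_iff_forall_tendsto]
      intro u
      have h5 := h.tendsto_detection hw hτbar hf ε σ h1 u
      rw [hBX] at h5
      have h6 := (hg.tendsto u).comp (tendsto_snd (f := 𝓕))
      exact (h6.prodMk_nhds h5).mono_right (nhds_le_uniformity _)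
    have hfst := tendsto_fst.comp hc
    refine tendsto_firstAlarm_div (N := fun p : (Fin 3 → ℕ) × Ω => p.1 0)
      ((h.tendsto_size 0).comp hfst) hs₀ ?_ ?_ h4
    · exact hSc (X ω')
    · intro ρ hρ
      filter_upwards [Metric.tendstoUniformly_iff.1 hunif (ρ / 2) (half_pos hρ)] with p hp s hs
      refine lt_of_le_of_lt ?_ (half_lt_self hρ)
      refine abs_sSup_abs_image_sub_lt hQne ?_ fun y _ => ?_
      · exact (hQ.isCompact.image ((hg.comp (f := fun y : Fin 3 → unitInterval =>
          ((⟨s, hs⟩ : unitInterval), y)) (by fun_prop)).abs)).bddAbove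
      · have := hp (⟨s, hs⟩, y)
        rw [dist_comm, Real.dist_eq] at this
        exact this.le

/-! ### The two sets of conditions on the disturbance -/

theorem DriftHypotheses.of_continuousOn {l : Filter (Fin 3 → ℕ)} {τbar : Fin 3 → ℝ}
    {τ : Fin 3 → ℕ → ℝ} (hτ : ∀ j m, 1 ≤ m → 0 < τ j m) {δ : (Fin 3 → ℝ) → ℝ}
    (hN : ∀ j, Tendsto (fun n : Fin 3 → ℕ => n j) l atTop)
    (hδ : ContinuousOn δ (Set.Icc (fun _ => 0) τbar)) {η C : ℝ} (hη : 0 < η)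
    (hC : ∀ x ∈ Set.Icc (fun _ => 0) (fun j => τbar j + η), |δ x| ≤ C)
    (hlim : ∀ j, Tendsto (fun m : ℕ => (m : ℝ) * τ j m) atTop (𝓝 (τbar j))) :
    DriftHypotheses l τbar τ δ where
  tendsto_size := hN
  tendsto_horizon j := (hlim j).comp (hN j)
  ae_continuousAt := by
    filter_upwards [ae_mem_Icc_mem_nhds (fun _ => 0) τbar] with z hz hzK
    exact hδ.continuousAt (hz hzK)
  bounded := by
    refine ⟨C, ?_⟩
    have h1 : ∀ᶠ n in l, ∀ j, (n j : ℝ) * τ j (n j) < τbar j + η := eventually_all.2 fun j =>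
      ((hlim j).comp (hN j)).eventually (gt_mem_nhds (lt_add_of_pos_right _ hη))
    have h2 : ∀ᶠ n in l, ∀ j, 1 ≤ n j :=
      eventually_all.2 fun j => (hN j).eventually (eventually_ge_atTop 1)
    filter_upwards [h1, h2] with n hn1 hn2 k hk
    have hpos : ∀ j, 0 ≤ τ j (n j) := fun j => (hτ j _ (hn2 j)).le
    refine hC _ ⟨fun j => mul_nonneg (Nat.cast_nonneg _) (hpos j), fun j => ?_⟩
    exact (mul_le_mul_of_nonneg_right (Nat.cast_le.2 (hk j)) (hpos j)).trans (hn1 j).le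

theorem DriftHypotheses.of_isBVHK {l : Filter (Fin 3 → ℕ)} {τbar : Fin 3 → ℝ}
    (hτbar : ∀ j, 0 < τbar j) {τ : Fin 3 → ℕ → ℝ} (hτ : ∀ j m, 1 ≤ m → 0 < τ j m)
    {δ : (Fin 3 → ℝ) → ℝ} (hN : ∀ j, Tendsto (fun n : Fin 3 → ℕ => n j) l atTop)
    (hδ : IsBVHK δ (fun _ => 0) τbar) (heq : ∀ j, ∀ m : ℕ, 1 ≤ m → (m : ℝ) * τ j m = τbar j) :
    DriftHypotheses l τbar τ δ where
  tendsto_size := hN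
  tendsto_horizon j := tendsto_const_nhds.congr'
    (((hN j).eventually (eventually_ge_atTop 1)).mono fun n hn => (heq j _ hn).symm)
  ae_continuousAt := hδ.ae_continuousAt fun j => (hτbar j).le
  bounded := by
    obtain ⟨C, hC⟩ := hδ.exists_abs_le
    have h2 : ∀ᶠ n in l, ∀ j, 1 ≤ n j :=
      eventually_all.2 fun j => (hN j).eventually (eventually_ge_atTop 1)
    refine ⟨C, h2.mono fun n hn k hk => ?_⟩
    have hpos : ∀ j, 0 ≤ τ j (n j) := fun j => (hτ j _ (hn j)).le
    refine hC _ ⟨fun j => mul_nonneg (Nat.cast_nonneg _) (hpos j), fun j => ?_⟩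
    exact (mul_le_mul_of_nonneg_right (Nat.cast_le.2 (hk j)) (hpos j)).trans (heq j _ (hn j)).le

end

theorem mainTheorem8
    {Ω Ω' : Type*} [MeasurableSpace Ω] [MeasurableSpace Ω']
    (P : Measure Ω) [IsProbabilityMeasure P] (P' : Measure Ω') [IsProbabilityMeasure P']
    -- bandwidths, observation horizons, sampling periods
    (w : Fin 3 → ℝ) (hw : ∀ j, 0 < w j)
    (τbar : Fin 3 → ℝ) (hτbar : ∀ j, 0 < τbar j)
    (τ : Fin 3 → ℕ → ℝ) (hτ : ∀ j m, 1 ≤ m → 0 < τ j m)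
    -- sample size regime and the exponents of the local alternative
    (β : Fin 3 → ℝ) (hβ : ∀ j, 0 < β j)
    (l : Filter (Fin 3 → ℕ)) (hl : SampleSizeRegime β l)
    -- noise with its functional central limit theorem
    (ε : (Fin 3 → ℤ) → Ω → ℝ) (hε : IsCenteredWeaklyStationary ε P)
    (σ : ℝ) (hσ : 0 < σ)
    (B : Ω' → SkorohodSpace (Fin 3)) (hB : IsBrownianSheet B P')
    (hclt : TendstoInDistribution (fun n : Fin 3 → ℕ => partialSumProcess ε n) l
      (fun ω' => σ • B ω') (fun _ => P) P')
    -- signals and disturbance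
    (f : (Fin 3 → ℕ) → (Fin 3 → ℝ) → ℝ) (f₀ δ : (Fin 3 → ℝ) → ℝ)
    (hf : ∀ n : Fin 3 → ℕ, (∀ j, 1 ≤ n j) → ∀ x : Fin 3 → ℝ,
      f n x - f₀ x = δ x / ∏ j, (n j : ℝ) ^ β j)
    (hδ : ∃ x ∈ Set.Icc (fun _ => 0) τbar, δ x ≠ 0)
    (hcase :
      (ContinuousOn δ (Set.Icc (fun _ => 0) τbar) ∧
        (∃ η > 0, ∃ C : ℝ, ∀ x ∈ Set.Icc (fun _ => 0) (fun j => τbar j + η), |δ x| ≤ C) ∧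
        ∀ j, Tendsto (fun m : ℕ => (m : ℝ) * τ j m) atTop (𝓝 (τbar j))) ∨
      (IsBVHK δ (fun _ => 0) τbar ∧ ∀ j, ∀ m : ℕ, 1 ≤ m → (m : ℝ) * τ j m = τbar j))
    -- learning sample
    (s₀ : ℝ) (hs₀ : s₀ ∈ Set.Ioo (0 : ℝ) 1)
    (hlearn : ∀ n : Fin 3 → ℕ, (∀ j, 1 ≤ n j) → ∀ x ∈ Set.Icc (fun _ => 0) τbar,
      x 0 ≤ s₀ * τbar 0 → f n x = f₀ x)
    -- control limits
    (cL cM : ℝ) (hcL : 0 < cL) (hcM : 0 < cM) :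
    TendstoInDistribution
      (fun (n : Fin 3 → ℕ) (ω : Ω) =>
        firstAlarm s₀ cL (n 0) (localStat τbar
          (detectionProcess w (fun j => τ j (n j)) n
            (noisySamples (f n) (fun j => τ j (n j)) ε ω) f₀)) / (n 0 : ℝ≥0∞))
      l
      (fun ω' => passageTime s₀ cL (localStat τbar (driftedLimit w τbar σ δ (B ω'))))
      (fun _ => P) P' ∧
    TendstoInDistribution
      (fun (n : Fin 3 → ℕ) (ω : Ω) =>
        firstAlarm s₀ cM (n 0) (globalStat τbar
          (detectionProcess w (fun j => τ j (n j)) n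
            (noisySamples (f n) (fun j => τ j (n j)) ε ω) f₀)) / (n 0 : ℝ≥0∞))
      l
      (fun ω' => passageTime s₀ cM (globalStat τbar (driftedLimit w τbar σ δ (B ω'))))
      (fun _ => P) P' := by
  have hcg : l.IsCountablyGenerated := hl.isCountablyGenerated
  have hne : l.NeBot := hl.neBot
  have hN := hl.tendsto_apply
  have hdrift : DriftHypotheses l τbar τ δ := by
    rcases hcase with ⟨hc, ⟨η, hη, C, hC⟩, hlim⟩ | ⟨hbv, heq⟩
    · exact .of_continuousOn hτ hN hc hη hC hlim
    · exact .of_isBVHK hτbar hτ hN hbv heq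
  have hf' : ∀ᶠ n in l, ∀ x, f n x - f₀ x = δ x / Real.sqrt (∏ j, (n j : ℝ)) := by
    have h1 : ∀ᶠ n in l, ∀ j, 1 ≤ n j :=
      eventually_all.2 fun j => (hN j).eventually (eventually_ge_atTop 1)
    filter_upwards [h1, hl.eventually_prod_rpow] with n hn1 hn2 x
    rw [hf n hn1 x, hn2]
  have hεm : ∀ i, AEMeasurable (ε i) P := fun i => (hε.memLp i).aestronglyMeasurable.aemeasurable
  constructor
  · have h := tendstoInDistribution_firstAlarm_blockStat hw hτbar hdrift hf' hεm hσ hB hclt hs₀ cL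
      (Q := {y | y 0 = 1}) (isClosed_singleton.preimage (continuous_apply 0)) ⟨fun _ => 1, rfl⟩
    have h1 : ∀ N G, firstAlarm s₀ cL N (localStat τbar G) =
        firstAlarm s₀ cL N (blockStat {y | y 0 = 1} τbar G) := fun _ G =>
      firstAlarm_congr fun s _ => localStat_eq_blockStat hτbar G s
    have h2 : ∀ G, passageTime s₀ cL (localStat τbar G) =
        passageTime s₀ cL (blockStat {y | y 0 = 1} τbar G) := fun G =>
      passageTime_congr hs₀.1.le fun s _ => localStat_eq_blockStat hτbar G s
    simpa only [h1, h2] using h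
  · have h := tendstoInDistribution_firstAlarm_blockStat hw hτbar hdrift hf' hεm hσ hB hclt hs₀ cM
      (Q := Set.univ) isClosed_univ Set.univ_nonempty
    have h1 : ∀ N G, firstAlarm s₀ cM N (globalStat τbar G) =
        firstAlarm s₀ cM N (blockStat Set.univ τbar G) := fun _ G =>
      firstAlarm_congr fun s hs => globalStat_eq_blockStat hτbar G hs.1
    have h2 : ∀ G, passageTime s₀ cM (globalStat τbar G) =
        passageTime s₀ cM (blockStat Set.univ τbar G) := fun G =>
      passageTime_congr hs₀.1.le fun s hs => globalStat_eq_blockStat hτbar G hs.1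
    simpa only [h1, h2] using h
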